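/- Let $1\le k<n$ and let $G$ be the simply connected complex simple Lie group of type $B_n$, with Borel subgroup $B$, simple roots $\alpha_j=\varepsilon_j-\varepsilon_{j+1}$ $(1\le j<n)$ and $\alpha_n=\varepsilon_n$, and Weyl group $W$ generated by the simple reflections $s_1,\dots,s_n$. Let $\{\sigma^w\}_{w\in W}$ be the basis of Schubert classes of $H^*(G/B,\mathbb{Q})$, where $\sigma^w\in H^{2\ell(w)}(G/B,\mathbb Q)$, and define the classical structure coefficients $N_{u,v}^{w,0}$ by $\sigma^u\cup\sigma^v=\sum_{w\in W}N_{u,v}^{w,0}\sigma^w$. (Here $H^*(G/B,\mathbb Q)$ is taken in Borel's presentation, as the quotient of the symmetric algebra of the weights by the ideal generated by the $W$-invariants without constant term, and $\sigma^w$ is given by the Bernstein–Gelfand–Gelfand construction: $\sigma^w$ is the class of $\partial_{w^{-1}w_0}\big(|W|^{-1}\prod_{\gamma>0}\gamma\big)$, where $w_0$ is the longest element of $W$ and $\partial_w$ are the divided difference operators.) Let $W^{\tilde P}$ be the set of minimal length representatives of the cosets $W/W_{\tilde P}$, where $W_{\tilde P}$ is generated by the $s_j$ with $j\ne k-1$ (so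 $W^{\tilde P}=\{\mathrm{id}\}$ if $k=1$). Let $\mathcal P_{k-1}$ be the set of shapes $\mu=(\mu^t//\mu^b)$: pairs of strict partitions $n\ge\mu^t_1>\dots>\mu^t_{n-k+1}>0$ and $n\ge\mu^b_1>\dots>\mu^b_m>0$ with $m=\ell(\mu^b)\le k-1$ and $\mu^t_{n-k+1}\ge m+1$. The element $w\in W^{\tilde P}$ that corresponds to $\mu$ is the one whose barred permutation is $(y_1,\dots,y_{k-1-m},\bar z_m,\dots,\bar z_1,v_1,\dots,v_{n-k+1})$ with $\mu^b_j=n+1-z_j$ and $\mu^t_r=n+1-v_r+\#\{i\mid z_i<v_r\}$; here an entry $y$ (resp. $\bar z$) in position $i$ means $w\varepsilon_i=\varepsilon_y$ (resp. $w\varepsilon_i=-\varepsilon_z$). Put $\vec\mu=\sum_{i=1}^{n-k+1}\mu^t_i\mathbf e_i+\sum_{j=1}^m\mu^b_j\mathbf e_{n-k+1+j}\in\mathbb Z^n$. Let $S(\mu)$ be the set of all $\nu\in\mathcal P_{k-1}$ such that - $\vec\nu=\vec\mu-\mathbf e_j$ for some $2\le j\le n-k+1+m$, or - $\vec\nu=\vec\mu-(f+1)\mathbf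 e_{n-k+1+j}+f\mathbf e_i$ and $\mu^t_i=\mu^b_j+j-f-1$ for some $f>0$, $1\le j\le m$, $1\le i\le n-k+1$. Let $\Gamma_2(\mu)$ be the set of all $\nu\in\mathcal P_{k-1}$ such that - for some $1\le j\le m$ we have $\vec\nu=\vec\mu-\mathbf e_{n-k+1+j}$ and $\mu^t_i\ne\mu^b_j+j-1$ for all $2\le i\le n-k+1$, or - $\vec\nu=\vec\mu-(f+1)\mathbf e_{n-k+1+j}+f\mathbf e_1$ and $\mu^t_1=\mu^b_j+j-f-1$ for some $f>0$, $1\le j\le m$. Let $\Gamma_1(\mu)=S(\mu)\setminus\Gamma_2(\mu)$. Suppose that $v',w'\in W^{\tilde P}$ correspond to the shapes $\nu,\mu\in\mathcal P_{k-1}$ respectively. Then $N_{s_k,v'}^{w',0}\ne0$ if and only if $\nu\in S(\mu)$. Furthermore, $N_{s_k,v'}^{w',0}=1$ if $\nu\in\Gamma_1(\mu)$, and $N_{s_k,v'}^{w',0}=2$ if $\nu\in\Gamma_2(\mu)$. -/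

import Mathlib

namespace TypeB

/-- The rational span of the weights of the root system `B_n`, with its orthonormal basis. -/
abbrev V (n : ℕ) : Type := Fin n → ℚ

/-- The orthonormal basis vectors `ε_1, …, ε_n`, numbered from `1`. -/
def ε (n i : ℕ) : V n := fun a => if (a : ℕ) + 1 = i then 1 else 0

/-- The simple roots, numbered by `Fin n` (so `α_j` of the usual numbering has index `j - 1`):
`α_j = ε_j - ε_{j+1}` for `j < n`, and `α_n = ε_n`. -/
def simpleRoot (n : ℕ) (i : Fin n) : V n :=
  if (i : ℕ) + 1 < n then ε n (i + 1) - ε n (i + 2) else ε n n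

/-- The simple coroots, as linear forms: `⟨β, α^∨⟩ = 2 (α, β) / (α, α)`. -/
def simpleCoroot (n : ℕ) (i : Fin n) : Module.Dual ℚ (V n) :=
  (2 / (simpleRoot n i ⬝ᵥ simpleRoot n i)) • dotProductBilin ℚ ℚ (simpleRoot n i)

theorem simpleRoot_ne_zero (n : ℕ) (i : Fin n) : simpleRoot n i ≠ 0 := by
  intro h
  have h1 := congrFun h i
  have := i.isLt
  unfold simpleRoot ε at h1
  split_ifs at h1 with h2
  · simp at h1
  · have h3 : (i : ℕ) + 1 = n := by omega
    simp [h3] at h1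

theorem simpleCoroot_simpleRoot (n : ℕ) (i : Fin n) :
    simpleCoroot n i (simpleRoot n i) = 2 := by
  have h : simpleRoot n i ⬝ᵥ simpleRoot n i ≠ 0 := by
    rw [Ne, dotProduct_self_eq_zero]
    exact simpleRoot_ne_zero n i
  simp [simpleCoroot, h]

/-- The reflection `β ↦ β - ⟨β, α^∨⟩ α` in a simple root. -/
noncomputable def simpleReflection (n : ℕ) (i : Fin n) : V n ≃ₗ[ℚ] V n :=
  Module.reflection (simpleCoroot_simpleRoot n i)

/-- The Weyl group of type `B_n`, generated by the simple reflections. -/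
def W (n : ℕ) : Subgroup (V n ≃ₗ[ℚ] V n) :=
  Subgroup.closure (Set.range (simpleReflection n))

/-- The simple reflections as elements of the Weyl group. -/
noncomputable def sFin (n : ℕ) (i : Fin n) : W n :=
  ⟨simpleReflection n i, Subgroup.subset_closure ⟨i, rfl⟩⟩

/-- The simple reflection `s_j`, in the usual numbering `1 ≤ j ≤ n`
(and the identity for other `j`). -/
noncomputable def s (n j : ℕ) : W n :=
  if h : 1 ≤ j ∧ j ≤ n then sFin n ⟨j - 1, by omega⟩ else 1

/-- The length of a Weyl group element: the least length of a word in the simple reflections. -/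
noncomputable def length {n : ℕ} (w : W n) : ℕ :=
  sInf {l | ∃ L : List (Fin n), L.length = l ∧ (L.map (sFin n)).prod = w}

/-- The parabolic subgroup of the Weyl group generated by the `s_j` with `j ≠ K`. -/
def parabolic (n K : ℕ) : Subgroup (W n) :=
  Subgroup.closure {g | ∃ j, 1 ≤ j ∧ j ≤ n ∧ j ≠ K ∧ g = s n j}

/-- The minimal length representatives of the left cosets of `parabolic n K`. -/
def minReps (n K : ℕ) : Set (W n) :=
  {w | ∀ u ∈ parabolic n K, length w ≤ length (w * u)}

/-! ### The rational cohomology ring of the flag variety `G/B` and its Schubert basis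

By Borel, `H^*(G/B, ℚ)` is the quotient of the symmetric algebra of the weights by the ideal
generated by the Weyl group invariants without constant term; by Bernstein-Gelfand-Gelfand and
Demazure the Schubert classes are obtained from the class of a point by divided differences. -/

/-- The symmetric algebra of `V n`. -/
abbrev Sym (n : ℕ) : Type := MvPolynomial (Fin n) ℚ

/-- A vector of `V n`, regarded as an element of degree one of the symmetric algebra. -/
noncomputable def linForm {n : ℕ} (v : V n) : Sym n :=
  ∑ a, MvPolynomial.C (v a) * MvPolynomial.X a

/-- The action of a linear automorphism of `V n` on the symmetric algebra. -/
noncomputable def act {n : ℕ} (g : V n ≃ₗ[ℚ] V n) : Sym n →ₐ[ℚ] Sym n :=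
  MvPolynomial.aeval fun a => linForm (g (Pi.single a 1))

theorem linForm_dvd_sub_act {n : ℕ} (i : Fin n) (f : Sym n) :
    ∃ g, f - act (simpleReflection n i) f = linForm (simpleRoot n i) * g := by
  set I : Ideal (Sym n) := Ideal.span {linForm (simpleRoot n i)} with hI
  have key : (Ideal.Quotient.mkₐ ℚ I).comp (act (simpleReflection n i)) =
      Ideal.Quotient.mkₐ ℚ I := by
    apply MvPolynomial.algHom_ext
    intro a
    simp only [AlgHom.comp_apply, Ideal.Quotient.mkₐ_eq_mk]
    rw [Ideal.Quotient.eq, hI, Ideal.mem_span_singleton]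
    refine ⟨- MvPolynomial.C (simpleCoroot n i (Pi.single a 1)), ?_⟩
    have hX : linForm (Pi.single a 1 : V n) = MvPolynomial.X a := by
      rw [linForm, Finset.sum_eq_single a]
      · simp
      · intro b _ hb
        simp [Pi.single_eq_of_ne hb]
      · simp
    have hs : ∀ (c : ℚ) (v w : V n),
        linForm (v - c • w) = linForm v - MvPolynomial.C c * linForm w := by
      intro c v w
      simp only [linForm, Finset.mul_sum, ← Finset.sum_sub_distrib]
      refine Finset.sum_congr rfl fun b _ => ?_
      simp only [Pi.sub_apply, Pi.smul_apply, smul_eq_mul, map_sub, map_mul]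
      ring
    rw [act, MvPolynomial.aeval_X, simpleReflection, Module.reflection_apply, hs, hX]
    ring
  have h := DFunLike.congr_fun key f
  simp only [AlgHom.comp_apply, Ideal.Quotient.mkₐ_eq_mk] at h
  rw [eq_comm, Ideal.Quotient.eq, hI, Ideal.mem_span_singleton] at h
  exact h

/-- The divided difference operator `f ↦ (f - s_α f) / α` of a simple root `α`. -/
noncomputable def divDiff {n : ℕ} (i : Fin n) (f : Sym n) : Sym n :=
  (linForm_dvd_sub_act i f).choose

/-- A word of least possible length in the simple reflections with product `w`. -/
noncomputable def reducedWord {n : ℕ} (w : W n) : List (Fin n) :=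
  Classical.epsilon fun L => (L.map (sFin n)).prod = w ∧ L.length = length w

/-- The divided difference operator of a Weyl group element: the composite of the operators
of the letters of a reduced word. -/
noncomputable def divDiffW {n : ℕ} (w : W n) (f : Sym n) : Sym n :=
  (reducedWord w).foldr divDiff f

/-- The longest element of the Weyl group. -/
noncomputable def longest (n : ℕ) : W n :=
  Classical.epsilon fun w => ∀ u : W n, length u ≤ length w

/-- The product of the positive roots `ε_a`, `ε_a - ε_b`, `ε_a + ε_b` (`a < b`), divided by the
order of the Weyl group. It represents the class of a point. -/
noncomputable def topPoly (n : ℕ) : Sym n :=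
  MvPolynomial.C (1 / (Nat.card (W n) : ℚ)) *
    ((∏ a : Fin n, MvPolynomial.X a) *
      ∏ a : Fin n, ∏ b ∈ Finset.Ioi a,
        ((MvPolynomial.X a - MvPolynomial.X b) * (MvPolynomial.X a + MvPolynomial.X b)))

/-- The ideal generated by the Weyl group invariants without constant term. -/
noncomputable def coinvIdeal (n : ℕ) : Ideal (Sym n) :=
  Ideal.span {f | (∀ w ∈ W n, act w f = f) ∧ MvPolynomial.constantCoeff f = 0}

/-- The ring `H^*(G/B, ℚ)`, for `G` of type `B_n`. -/
abbrev Cohomology (n : ℕ) : Type := Sym n ⧸ coinvIdeal n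

/-- The Schubert class `σ^w` in `H^{2ℓ(w)}(G/B, ℚ)`. -/
noncomputable def schubert {n : ℕ} (w : W n) : Cohomology n :=
  Ideal.Quotient.mk (coinvIdeal n) (divDiffW (w⁻¹ * longest n) (topPoly n))

open Classical in
/-- The classical structure coefficient `N_{u,v}^{w,0}`: the coefficient of `σ^w` in the expansion
of the cup product `σ^u ∪ σ^v` in the basis of Schubert classes of `H^*(G/B, ℚ)`. -/
noncomputable def N {n : ℕ} (u v w : W n) : ℚ :=
  if h : LinearIndependent ℚ (schubert (n := n)) ∧
      ⊤ ≤ Submodule.span ℚ (Set.range (schubert (n := n))) then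
    (Module.Basis.mk h.1 h.2).repr (schubert u * schubert v) w
  else 0

/-! ### Shapes -/

/-- The set `P_K` of shapes `μ = (μ^t // μ^b)`: strict partitions inside an `(n - K) × n` and a
`K × n` rectangle such that the last part `μ^t_{n-K}` is at least `ℓ(μ^b) + 1`.
Parts are numbered from `1`; `top i = 0` and `bot j = 0` outside the ranges
`1 ≤ i ≤ n - K` and `1 ≤ j ≤ len = ℓ(μ^b)`. -/
@[ext]
structure Shape (n K : ℕ) where
  top : ℕ → ℕ
  bot : ℕ → ℕ
  len : ℕ
  top_zero : ∀ i, ¬ (1 ≤ i ∧ i ≤ n - K) → top i = 0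
  top_le : ∀ i, top i ≤ n
  top_strict : ∀ i j, 1 ≤ i → i < j → j ≤ n - K → top j < top i
  len_lt_top : ∀ i, 1 ≤ i → i ≤ n - K → len + 1 ≤ top i
  len_le : len ≤ K
  bot_pos_iff : ∀ j, 0 < bot j ↔ 1 ≤ j ∧ j ≤ len
  bot_le : ∀ j, bot j ≤ n
  bot_strict : ∀ i j, 1 ≤ i → i < j → j ≤ len → bot j < bot i

/-- The vector of a shape in `ℤ^n`, with coordinates numbered `1, …, n` (and zero elsewhere):
the parts of `μ^t` followed by those of `μ^b`. -/
def Shape.vec {n K : ℕ} (μ : Shape n K) : ℕ → ℤ := fun i =>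
  if i ≤ n - K then (μ.top i : ℤ) else (μ.bot (i - (n - K)) : ℤ)

/-- The canonical basis vector `e_i`. -/
def e (i : ℕ) : ℕ → ℤ := Pi.single i 1

/-- `w` is the minimal length representative that corresponds to the shape `μ`. As a barred
permutation, `w = (y_1, …, y_{K-m}, \bar z_m, …, \bar z_1, v_1, …, v_{n-K})` with `m = ℓ(μ^b)`,
where a barred entry `\bar z` in position `i` means `w ε_i = - ε_z` and an unbarred entry `y`
means `w ε_i = ε_y`; the shape has the parts `μ^b_j = n + 1 - z_j` and
`μ^t_r = n + 1 - v_r + #{i | z_i < v_r}`. -/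
def Corresponds {n K : ℕ} (w : W n) (μ : Shape n K) : Prop :=
  w ∈ minReps n K ∧
  ∃ y z v : ℕ → ℕ,
    (∀ i, 1 ≤ i → i ≤ K - μ.len → 1 ≤ y i ∧ y i ≤ n ∧ w.1 (ε n i) = ε n (y i)) ∧
    (∀ j, 1 ≤ j → j ≤ μ.len →
      1 ≤ z j ∧ z j ≤ n ∧ w.1 (ε n (K + 1 - j)) = - ε n (z j) ∧ μ.bot j = n + 1 - z j) ∧
    (∀ r, 1 ≤ r → r ≤ n - K →
      1 ≤ v r ∧ v r ≤ n ∧ w.1 (ε n (K + r)) = ε n (v r) ∧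
        μ.top r = n + 1 - v r + ((Finset.Icc 1 μ.len).filter fun i => z i < v r).card)

/-- The set `S(μ)`, for `μ` in `P_K` with `K = k - 1`, so that `n - K = n - k + 1`. -/
def S {n K : ℕ} (μ : Shape n K) : Set (Shape n K) :=
  {ν | ∃ j, 2 ≤ j ∧ j ≤ n - K + μ.len ∧ ν.vec = μ.vec - e j} ∪
  {ν | ∃ f j i : ℕ, 0 < f ∧ 1 ≤ j ∧ j ≤ μ.len ∧ 1 ≤ i ∧ i ≤ n - K ∧
    ν.vec = μ.vec - ((f : ℤ) + 1) • e (n - K + j) + (f : ℤ) • e i ∧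
    (μ.top i : ℤ) = (μ.bot j : ℤ) + j - f - 1}

/-- The set `Γ_2(μ)`. -/
def Γ₂ {n K : ℕ} (μ : Shape n K) : Set (Shape n K) :=
  {ν | ∃ j, 1 ≤ j ∧ j ≤ μ.len ∧ ν.vec = μ.vec - e (n - K + j) ∧
    ∀ i, 2 ≤ i → i ≤ n - K → (μ.top i : ℤ) ≠ (μ.bot j : ℤ) + j - 1} ∪
  {ν | ∃ f j : ℕ, 0 < f ∧ 1 ≤ j ∧ j ≤ μ.len ∧
    ν.vec = μ.vec - ((f : ℤ) + 1) • e (n - K + j) + (f : ℤ) • e 1 ∧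
    (μ.top 1 : ℤ) = (μ.bot j : ℤ) + j - f - 1}

/-- The set `Γ_1(μ)`. -/
def Γ₁ {n K : ℕ} (μ : Shape n K) : Set (Shape n K) := S μ \ Γ₂ μ

end TypeB

/-! ### Divided difference operators on the symmetric algebra. -/

namespace TypeB

open MvPolynomial

variable {n : ℕ}

/-! ### Linear forms and the action on the symmetric algebra -/

/-! The proof has two halves: Chevalley's formula for multiplication by `σ^{s_k}`, and a dictionary
between the covers in that formula and changes of shape.

For the first half, consider the functional sending `f` to the constant term of `∂_w f`. It kills
the ideal of invariants without constant term because `∂_w` is linear over the invariants, and an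
averaging argument shows that these functionals together cut out exactly that ideal
(`mem_coinvIdeal_iff`). Since `∂_u ∂_w` is `∂_{uw}` or `0`, and `∂_{w₀}` sends the point class to
`1` (`DW_longest_topPoly`), they form the basis dual to the Schubert classes (`coef_schubertPoly`).
So structure coefficients are constant terms. For `k < n` the class `σ^{s_k}` is represented by `ω_k
= ε_1 + ⋯ + ε_k`, and moving `ω_k` through `∂_w` by the Leibniz rule gives `chevalley`: the
coefficient is `⟨ω_k, γ^∨⟩` if `v = w s_γ` with `γ` positive and `v` one shorter than `w`, and `0`
if there is no such `γ`.

For the second half put `K = k - 1` and record `w` by the heights `wt w i` of the vectors `w ε_i`.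
For a minimal representative they decrease on the head `1, …, K`, and decrease and stay positive on
the tail. The bottom parts of the shape are the negated negative head entries; a top part is a tail
entry `t` plus the number of bottom parts that exceed `t` (`Std`). As `t + #{j | μ^b_j > t}` is
strictly increasing on values that are not parts, the top parts determine the tail. Length and
number of boxes differ by a constant (`Std.inv_add_size`), so a cover loses exactly one box.

The relevant roots are now easy to list. A root `ε_p - ε_q` exchanges a head and a tail entry and
lowers one top part; its pairing with `ω_k` is nonzero only if the index of that part is at least
`2`, and then it is `1`. The roots `ε_p` and `ε_p + ε_q` inside the head lower one bottom part, with
pairing `2`. A root `ε_p + ε_q` with one position in the tail lowers a bottom part by `f + 1` and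
raises a top part by `f`, with pairing `2` if that top part is the first and `1` otherwise. For `f =
0` this looks like a plain loss of a bottom box, which is the reason for the inequality in the
definition of `Γ₂`.

Conversely, a change of shape in `S μ` names a root `γ`, and the length of `w s_γ` need not be
computed: it is less than that of `w`, it is at least that of `v` because both lie in one coset and
`v` is shortest there, and the box count leaves no room between (`covers_of_head`). -/

theorem linForm_single (a : Fin n) : linForm (Pi.single a 1 : V n) = X a := by
  rw [linForm, Finset.sum_eq_single a]
  · simp
  · intro b _ hb
    simp [Pi.single_eq_of_ne hb]
  · simp

/-- `linForm` as a linear map. -/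
noncomputable def linFormₗ (n : ℕ) : V n →ₗ[ℚ] Sym n where
  toFun := linForm
  map_add' v w := by simp [linForm, add_mul, Finset.sum_add_distrib]
  map_smul' c v := by
    simp [linForm, Finset.smul_sum, MvPolynomial.smul_eq_C_mul, mul_assoc]

theorem linFormₗ_apply (v : V n) : linFormₗ n v = linForm v := rfl

theorem linForm_sub (v w : V n) : linForm (v - w) = linForm v - linForm w :=
  map_sub (linFormₗ n) v w

theorem linForm_add (v w : V n) : linForm (v + w) = linForm v + linForm w :=
  map_add (linFormₗ n) v w

theorem linForm_neg (v : V n) : linForm (-v) = -linForm v := map_neg (linFormₗ n) v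

theorem linForm_smul (c : ℚ) (v : V n) : linForm (c • v) = C c * linForm v := by
  rw [← MvPolynomial.smul_eq_C_mul]; exact map_smul (linFormₗ n) c v

theorem linForm_ne_zero {v : V n} (hv : v ≠ 0) : linForm v ≠ 0 := by
  contrapose! hv
  funext a
  have h : ∀ b, (eval (Pi.single a (1 : ℚ))) (linForm v) = v b → v b = 0 := by
    intro b h; rw [← h, hv, map_zero]
  refine h a ?_
  simp [linForm, Pi.single_apply]

theorem act_linForm (g : V n ≃ₗ[ℚ] V n) (v : V n) : act g (linForm v) = linForm (g v) := by
  have h : (act g).toLinearMap ∘ₗ linFormₗ n = linFormₗ n ∘ₗ g.toLinearMap := by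
    refine LinearMap.pi_ext' fun a => LinearMap.ext_ring ?_
    simp [linFormₗ_apply, linForm_single, act]
  exact LinearMap.congr_fun h v

theorem act_mul (g g' : V n ≃ₗ[ℚ] V n) (f : Sym n) : act (g * g') f = act g (act g' f) := by
  have h : act (g * g') = (act g).comp (act g') := by
    apply MvPolynomial.algHom_ext
    intro a
    simp only [← linForm_single, AlgHom.comp_apply, act_linForm, LinearEquiv.mul_apply]
  rw [h]; rfl

theorem act_one (f : Sym n) : act (1 : V n ≃ₗ[ℚ] V n) f = f := by
  have h : act (1 : V n ≃ₗ[ℚ] V n) = AlgHom.id ℚ (Sym n) := by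
    apply MvPolynomial.algHom_ext
    intro a
    simp only [← linForm_single, act_linForm, AlgHom.id_apply]
    rfl
  rw [h]; rfl

theorem act_C (g : V n ≃ₗ[ℚ] V n) (c : ℚ) : act g (C c) = C c := by
  simp [act]

/-! ### Divided differences -/

theorem linForm_simpleRoot_ne_zero (i : Fin n) : linForm (simpleRoot n i) ≠ 0 :=
  linForm_ne_zero (simpleRoot_ne_zero n i)

theorem simpleRoot_mul_divDiff (i : Fin n) (f : Sym n) :
    linForm (simpleRoot n i) * divDiff i f = f - act (simpleReflection n i) f :=
  (linForm_dvd_sub_act i f).choose_spec.symm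

/-- The polynomial ring is a domain, so the quotient picked by choice is unique. Identities for
divided differences are therefore checked after multiplication by the root. -/
theorem divDiff_eq {i : Fin n} {f g : Sym n}
    (h : linForm (simpleRoot n i) * g = f - act (simpleReflection n i) f) : divDiff i f = g :=
  mul_left_cancel₀ (linForm_simpleRoot_ne_zero i) ((simpleRoot_mul_divDiff i f).trans h.symm)

/-- The divided difference operator as a linear map. -/
noncomputable def dd (i : Fin n) : Sym n →ₗ[ℚ] Sym n where
  toFun := divDiff i
  map_add' f g := by
    apply divDiff_eq
    rw [mul_add, simpleRoot_mul_divDiff, simpleRoot_mul_divDiff, map_add]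
    ring
  map_smul' c f := by
    apply divDiff_eq
    rw [RingHom.id_apply, mul_smul_comm, simpleRoot_mul_divDiff, map_smul, smul_sub]

theorem mul_dd (i : Fin n) (f : Sym n) :
    linForm (simpleRoot n i) * dd i f = f - act (simpleReflection n i) f :=
  simpleRoot_mul_divDiff i f

theorem dd_eq {i : Fin n} {f g : Sym n}
    (h : linForm (simpleRoot n i) * g = f - act (simpleReflection n i) f) : dd i f = g :=
  divDiff_eq h

theorem dd_mul (i : Fin n) (f g : Sym n) :
    dd i (f * g) = dd i f * g + act (simpleReflection n i) f * dd i g := by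
  apply dd_eq
  have h1 := mul_dd i f
  have h2 := mul_dd i g
  rw [map_mul]
  linear_combination g * h1 + act (simpleReflection n i) f * h2

theorem simpleReflection_apply (i : Fin n) (v : V n) :
    simpleReflection n i v = v - simpleCoroot n i v • simpleRoot n i :=
  Module.reflection_apply _ _

theorem dd_linForm (i : Fin n) (v : V n) : dd i (linForm v) = C (simpleCoroot n i v) := by
  apply dd_eq
  rw [act_linForm, simpleReflection_apply, linForm_sub, linForm_smul]
  ring

theorem dd_C (i : Fin n) (c : ℚ) : dd i (C c) = 0 := by
  apply dd_eq
  rw [act_C]; ring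

theorem simpleReflection_mul_self (i : Fin n) :
    simpleReflection n i * simpleReflection n i = 1 :=
  LinearEquiv.ext fun v => Module.involutive_reflection (simpleCoroot_simpleRoot n i) v

theorem simpleReflection_simpleRoot (i : Fin n) :
    simpleReflection n i (simpleRoot n i) = - simpleRoot n i := by
  rw [simpleReflection_apply, simpleCoroot_simpleRoot, two_smul]; abel

theorem act_simpleReflection_twice (i : Fin n) (f : Sym n) :
    act (simpleReflection n i) (act (simpleReflection n i) f) = f := by
  rw [← act_mul, simpleReflection_mul_self, act_one]

/-- Both `f - s_i f` and `α_i` change sign under `s_i`, so their quotient does not. This gives `∂_i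
∂_i = 0`. -/
theorem act_dd (i : Fin n) (f : Sym n) : act (simpleReflection n i) (dd i f) = dd i f := by
  apply mul_left_cancel₀ (linForm_simpleRoot_ne_zero i)
  have h := congrArg (act (simpleReflection n i)) (mul_dd i f)
  rw [map_mul, act_linForm, simpleReflection_simpleRoot, linForm_neg, map_sub,
    act_simpleReflection_twice] at h
  rw [mul_dd]
  linear_combination -h

theorem dd_dd (i : Fin n) (f : Sym n) : dd i (dd i f) = 0 := by
  apply dd_eq
  rw [act_dd]; ring

theorem dd_act (i : Fin n) (f : Sym n) : dd i (act (simpleReflection n i) f) = - dd i f := by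
  apply dd_eq
  rw [act_simpleReflection_twice]
  linear_combination - mul_dd i f

theorem dd_mul_of_invariant {i : Fin n} {g : Sym n} (hg : act (simpleReflection n i) g = g)
    (f : Sym n) : dd i (f * g) = dd i f * g := by
  have h : dd i g = 0 := by
    apply dd_eq
    rw [hg]; ring
  rw [dd_mul, h]; ring

/-- The composite of the divided difference operators of the letters of a word. -/
noncomputable def D : List (Fin n) → Sym n →ₗ[ℚ] Sym n
  | [] => LinearMap.id
  | i :: L => dd i ∘ₗ D L

theorem D_nil (f : Sym n) : D [] f = f := rfl

theorem D_cons (i : Fin n) (L : List (Fin n)) (f : Sym n) : D (i :: L) f = dd i (D L f) := rfl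

theorem D_append (L M : List (Fin n)) (f : Sym n) : D (L ++ M) f = D L (D M f) := by
  induction L with
  | nil => rfl
  | cons i L ih => rw [List.cons_append, D_cons, ih, D_cons]

theorem divDiffW_eq (w : W n) (f : Sym n) : divDiffW w f = D (reducedWord w) f := by
  rw [divDiffW]
  induction reducedWord w with
  | nil => rfl
  | cons i L ih => rw [List.foldr_cons, ih]; rfl

/-- Linearity over the invariants is what lets divided differences descend to the coinvariant ring.
-/
theorem D_mul_of_invariant {g : Sym n} (hg : ∀ w ∈ W n, act w g = g) (L : List (Fin n))
    (f : Sym n) : D L (f * g) = D L f * g := by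
  induction L with
  | nil => rfl
  | cons i L ih =>
    rw [D_cons, ih, dd_mul_of_invariant (hg _ (sFin n i).2), D_cons]

theorem constantCoeff_act (g : V n ≃ₗ[ℚ] V n) (f : Sym n) :
    constantCoeff (act g f) = constantCoeff f := by
  induction f using MvPolynomial.induction_on with
  | C a => rw [act_C]
  | add p q hp hq => rw [map_add, map_add, hp, hq, map_add]
  | mul_X p a hp => rw [map_mul, map_mul, hp, ← linForm_single, act_linForm, map_mul]; simp [linForm]

/-! ### Degrees -/

/-- The homogeneous polynomials of degree `d`, as sums of products of `d` linear forms. -/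
noncomputable def homog (n d : ℕ) : Submodule ℚ (Sym n) := (LinearMap.range (linFormₗ n)) ^ d

theorem linForm_mem_homog (v : V n) : linForm v ∈ homog n 1 := by
  rw [homog, pow_one]; exact ⟨v, rfl⟩

/-- With `homog` defined as a power of the space of linear forms, one factor splits off and the
twisted Leibniz rule gives the induction. -/
theorem dd_mem_homog (i : Fin n) {d : ℕ} {f : Sym n} (hf : f ∈ homog n (d + 1)) :
    dd i f ∈ homog n d := by
  induction d generalizing f with
  | zero =>
    rw [homog, zero_add, pow_one] at hf
    obtain ⟨v, rfl⟩ := hf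
    rw [linFormₗ_apply, dd_linForm, homog, pow_zero]
    exact Submodule.mem_one.2 ⟨_, rfl⟩
  | succ d ih =>
    rw [homog, pow_succ'] at hf
    refine Submodule.mul_induction_on hf ?_ ?_
    · rintro _ ⟨v, rfl⟩ g hg
      rw [linFormₗ_apply, dd_mul, dd_linForm, act_linForm, ← MvPolynomial.smul_eq_C_mul]
      refine Submodule.add_mem _ (Submodule.smul_mem _ _ hg) ?_
      rw [homog, pow_succ']
      exact Submodule.mul_mem_mul ⟨_, rfl⟩ (ih hg)
    · intro x y hx hy
      rw [map_add]; exact Submodule.add_mem _ hx hy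

theorem D_mem_homog (L : List (Fin n)) {d : ℕ} {f : Sym n} (hf : f ∈ homog n (d + L.length)) :
    D L f ∈ homog n d := by
  induction L generalizing d with
  | nil => exact hf
  | cons i L ih =>
    rw [D_cons]
    refine dd_mem_homog i (ih ?_)
    rwa [List.length_cons, ← add_assoc, add_right_comm] at hf

theorem constantCoeff_of_mem_homog {d : ℕ} (hd : 0 < d) {f : Sym n} (hf : f ∈ homog n d) :
    constantCoeff f = 0 := by
  obtain ⟨d, rfl⟩ : ∃ e, d = e + 1 := ⟨d - 1, by omega⟩
  rw [homog, pow_succ'] at hf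
  refine Submodule.mul_induction_on hf ?_ ?_
  · rintro _ ⟨v, rfl⟩ g hg
    rw [map_mul, linFormₗ_apply]; simp [linForm]
  · intro x y hx hy
    rw [map_add, hx, hy, add_zero]

theorem eq_C_of_mem_homog_zero {f : Sym n} (hf : f ∈ homog n 0) : f = C (constantCoeff f) := by
  rw [homog, pow_zero] at hf
  obtain ⟨c, rfl⟩ := Submodule.mem_one.1 hf
  simp [MvPolynomial.algebraMap_eq]

theorem mul_mem_homog {d e : ℕ} {f g : Sym n} (hf : f ∈ homog n d) (hg : g ∈ homog n e) :
    f * g ∈ homog n (d + e) := by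
  rw [homog, pow_add]; exact Submodule.mul_mem_mul hf hg

theorem prod_mem_homog {ι : Type*} (s : Finset ι) (v : ι → V n) :
    ∏ i ∈ s, linForm (v i) ∈ homog n s.card := by
  classical
  induction s using Finset.induction_on with
  | empty => rw [Finset.prod_empty, homog, Finset.card_empty, pow_zero]; exact Submodule.one_le.1 le_rfl
  | insert a s ha ih =>
    rw [Finset.prod_insert ha, Finset.card_insert_of_notMem ha, add_comm]
    exact mul_mem_homog (linForm_mem_homog _) ih

end TypeB

/-! ### The root system of type B and its Weyl group of signed permutations. -/

namespace TypeB

variable {n : ℕ}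

/-! ### Signed permutations -/

theorem ε_succ (a : Fin n) : ε n (a + 1) = Pi.single a 1 := by
  funext b
  by_cases h : b = a
  · subst h; simp [ε]
  · have : (b : ℕ) ≠ a := fun h' => h (Fin.ext h')
    simp [ε, h, this]

theorem ε_eq_single {i : ℕ} (h1 : 1 ≤ i) (h2 : i ≤ n) :
    ε n i = Pi.single (⟨i - 1, by omega⟩ : Fin n) 1 := by
  rw [← ε_succ]; congr 1; simp; omega

theorem dot_ε {i j : ℕ} (h1 : 1 ≤ i) (h2 : i ≤ n) :
    ε n i ⬝ᵥ ε n j = if i = j then 1 else 0 := by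
  rw [ε_eq_single h1 h2, single_one_dotProduct, ε]
  congr 1
  simp; omega

/-- The pairing `⟨x, β^∨⟩ = 2 (x, β) / (β, β)`. -/
noncomputable def cor (β x : V n) : ℚ := 2 * (x ⬝ᵥ β) / (β ⬝ᵥ β)

/-- The reflection in `β`. -/
noncomputable def refl (β x : V n) : V n := x - cor β x • β

theorem cor_single {a : ℕ} (ha : 1 ≤ a) (ha' : a ≤ n) (x : V n) :
    cor (ε n a) x = 2 * (x ⬝ᵥ ε n a) := by
  simp [cor, dot_ε ha ha']

theorem cor_sub {a b : ℕ} (ha : 1 ≤ a) (ha' : a ≤ n) (hb : 1 ≤ b) (hb' : b ≤ n) (hab : a ≠ b)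
    (x : V n) : cor (ε n a - ε n b) x = x ⬝ᵥ ε n a - x ⬝ᵥ ε n b := by
  simp only [cor, sub_dotProduct, dotProduct_sub, dot_ε ha ha', dot_ε hb hb']
  rw [if_neg hab, if_neg hab.symm]; simp; ring

theorem cor_add {a b : ℕ} (ha : 1 ≤ a) (ha' : a ≤ n) (hb : 1 ≤ b) (hb' : b ≤ n) (hab : a ≠ b)
    (x : V n) : cor (ε n a + ε n b) x = x ⬝ᵥ ε n a + x ⬝ᵥ ε n b := by
  simp only [cor, add_dotProduct, dotProduct_add, dot_ε ha ha', dot_ε hb hb']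
  rw [if_neg hab, if_neg hab.symm]; simp; ring

theorem simpleCoroot_eq (i : Fin n) (x : V n) : simpleCoroot n i x = cor (simpleRoot n i) x := by
  simp only [simpleCoroot, cor, LinearMap.smul_apply, dotProductBilin_apply_apply, smul_eq_mul]
  rw [dotProduct_comm x]; ring

theorem simpleReflection_eq (i : Fin n) (x : V n) :
    simpleReflection n i x = refl (simpleRoot n i) x := by
  rw [simpleReflection_apply, simpleCoroot_eq, refl]

/-- The integers `⟨ε_p, α_j^∨⟩`. -/
def cartan (n j p : ℕ) : ℤ :=
  if j < n then (if p = j then 1 else 0) - (if p = j + 1 then 1 else 0)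
  else 2 * (if p = j then 1 else 0)

theorem simpleCoroot_ε (i : Fin n) {p : ℕ} (h1 : 1 ≤ p) (h2 : p ≤ n) :
    simpleCoroot n i (ε n p) = cartan n (i + 1) p := by
  have hi := i.isLt
  rw [simpleCoroot_eq, simpleRoot, cartan]
  by_cases h : (i : ℕ) + 1 < n
  · rw [if_pos h, if_pos h, cor_sub (by omega) (by omega) (by omega) (by omega) (by omega), dot_ε h1 h2, dot_ε h1 h2]
    push_cast; rfl
  · obtain h' : (i : ℕ) + 1 = n := by omega
    rw [if_neg h, if_neg h, cor_single (by omega) (by omega), dot_ε h1 h2, h']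
    push_cast; rfl

theorem mul_coe_apply (w u : W n) (x : V n) : (w * u).1 x = w.1 (u.1 x) := rfl

theorem inv_coe_apply (w : W n) (x : V n) : (w⁻¹).1 (w.1 x) = x := by
  rw [← mul_coe_apply, inv_mul_cancel]; rfl

theorem coe_inv_apply (w : W n) (x : V n) : w.1 ((w⁻¹).1 x) = x := by
  rw [← mul_coe_apply, mul_inv_cancel]; rfl

theorem one_coe_apply (x : V n) : (1 : W n).1 x = x := rfl

theorem sFin_mul_self (i : Fin n) : sFin n i * sFin n i = 1 :=
  Subtype.ext (simpleReflection_mul_self i)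

theorem sFin_inv (i : Fin n) : (sFin n i)⁻¹ = sFin n i :=
  inv_eq_of_mul_eq_one_left (sFin_mul_self i)

theorem sFin_apply (i : Fin n) (x : V n) :
    (sFin n i).1 x = x - simpleCoroot n i x • simpleRoot n i := simpleReflection_apply i x

theorem sFin_apply_twice (i : Fin n) (x : V n) : (sFin n i).1 ((sFin n i).1 x) = x := by
  rw [← mul_coe_apply, sFin_mul_self]; rfl

theorem sFin_simpleRoot (i : Fin n) : (sFin n i).1 (simpleRoot n i) = - simpleRoot n i :=
  simpleReflection_simpleRoot i

theorem W_induction {p : W n → Prop} (h1 : p 1) (hs : ∀ i w, p w → p (sFin n i * w)) (w : W n) :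
    p w := by
  obtain ⟨w, hw⟩ := w
  refine Subgroup.closure_induction_left (p := fun w hw => p ⟨w, hw⟩) h1 ?_ ?_ hw
  · rintro _ ⟨i, rfl⟩ y hy h
    exact hs i ⟨y, hy⟩ h
  · rintro _ ⟨i, rfl⟩ y hy h
    have := hs i ⟨y, hy⟩ h
    rwa [← sFin_inv] at this

theorem sFin_ε (i : Fin n) {p : ℕ} (h1 : 1 ≤ p) (h2 : p ≤ n) :
    ∃ c, 1 ≤ c ∧ c ≤ n ∧ ((sFin n i).1 (ε n p) = ε n c ∨ (sFin n i).1 (ε n p) = - ε n c) := by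
  have hi := i.isLt
  simp only [sFin_apply, simpleCoroot_ε i h1 h2, simpleRoot, cartan]
  by_cases h : (i : ℕ) + 1 < n
  · simp only [if_pos h]
    by_cases h3 : p = i + 1
    · refine ⟨i + 2, by omega, by omega, Or.inl ?_⟩
      subst h3; simp
    · by_cases h4 : p = i + 2
      · refine ⟨i + 1, by omega, by omega, Or.inl ?_⟩
        subst h4; simp
      · refine ⟨p, h1, h2, Or.inl ?_⟩
        simp [h3, h4]
  · simp only [if_neg h]
    refine ⟨p, h1, h2, ?_⟩
    by_cases h3 : p = i + 1
    · right
      have h4 : n = p := by omega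
      rw [if_pos h3, ← h4]
      simp only [mul_one, Int.cast_ofNat, two_smul]; abel
    · left; simp [h3]

theorem W_ε (w : W n) {p : ℕ} (h1 : 1 ≤ p) (h2 : p ≤ n) :
    ∃ c, 1 ≤ c ∧ c ≤ n ∧ (w.1 (ε n p) = ε n c ∨ w.1 (ε n p) = - ε n c) := by
  induction w using W_induction with
  | h1 => exact ⟨p, h1, h2, Or.inl rfl⟩
  | hs i w ih =>
    obtain ⟨c, hc1, hc2, hc⟩ := ih
    obtain ⟨d, hd1, hd2, hd⟩ := sFin_ε i hc1 hc2
    refine ⟨d, hd1, hd2, ?_⟩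
    rw [mul_coe_apply]
    rcases hc with hc | hc <;> rcases hd with hd | hd <;> simp [hc, hd]

theorem simpleReflection_dot (i : Fin n) (x y : V n) :
    (sFin n i).1 x ⬝ᵥ (sFin n i).1 y = x ⬝ᵥ y := by
  have h : simpleRoot n i ⬝ᵥ simpleRoot n i ≠ 0 := by
    rw [Ne, dotProduct_self_eq_zero]; exact simpleRoot_ne_zero n i
  simp only [sFin_apply, simpleCoroot_eq, cor, sub_dotProduct, dotProduct_sub, smul_dotProduct,
    dotProduct_smul, smul_eq_mul]
  rw [dotProduct_comm (simpleRoot n i) y]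
  field_simp; ring

theorem W_dot (w : W n) (x y : V n) : w.1 x ⬝ᵥ w.1 y = x ⬝ᵥ y := by
  induction w using W_induction generalizing x y with
  | h1 => rfl
  | hs i w ih => rw [mul_coe_apply, mul_coe_apply, simpleReflection_dot, ih]

theorem cor_W (w : W n) (β x : V n) : cor (w.1 β) (w.1 x) = cor β x := by
  simp only [cor, W_dot]

theorem refl_W (w : W n) (β x : V n) : refl (w.1 β) (w.1 x) = w.1 (refl β x) := by
  rw [refl, refl, cor_W, map_sub, map_smul]

theorem ε_ne {a b : ℕ} (ha : 1 ≤ a) (ha' : a ≤ n) (hab : a ≠ b) :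
    ε n a ≠ ε n b ∧ ε n a ≠ - ε n b := by
  constructor <;> intro h <;> have h1 := congrArg (ε n a ⬝ᵥ ·) h <;>
    simp [dot_ε ha ha', hab] at h1

theorem W_ε_ne (w : W n) {a b c d : ℕ} (ha : 1 ≤ a) (ha' : a ≤ n) (hab : a ≠ b)
    (hc : w.1 (ε n a) = ε n c ∨ w.1 (ε n a) = - ε n c)
    (hd : w.1 (ε n b) = ε n d ∨ w.1 (ε n b) = - ε n d) : c ≠ d := by
  rintro rfl
  obtain ⟨h1, h2⟩ := ε_ne ha ha' hab
  rcases hc with hc | hc <;> rcases hd with hd | hd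
  · exact h1 (w.1.injective (hc.trans hd.symm))
  · exact h2 (w.1.injective (by rw [map_neg, hc, hd, neg_neg]))
  · exact h2 (w.1.injective (by rw [map_neg, hc, hd]))
  · exact h1 (w.1.injective (hc.trans hd.symm))

/-! ### Heights and positive roots -/

/-- The height of a vector: it takes the value `1` on the simple roots. -/
noncomputable def hgt (n : ℕ) : V n →ₗ[ℚ] ℚ :=
  dotProductBilin ℚ ℚ fun a : Fin n => (n : ℚ) - a

theorem hgt_ε {i : ℕ} (h1 : 1 ≤ i) (h2 : i ≤ n) : hgt n (ε n i) = ((n + 1 - i : ℤ) : ℚ) := by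
  rw [hgt, dotProductBilin_apply_apply, dotProduct_comm, ε_eq_single h1 h2, single_one_dotProduct]
  push_cast [Nat.cast_sub h1]; ring

theorem exists_hgt_ε {i : ℕ} (h1 : 1 ≤ i) (h2 : i ≤ n) :
    ∃ z : ℤ, hgt n (ε n i) = z ∧ z + i = n + 1 := ⟨_, hgt_ε h1 h2, by ring⟩

theorem hgt_simpleRoot (i : Fin n) : hgt n (simpleRoot n i) = 1 := by
  have := i.isLt
  rw [simpleRoot]
  split_ifs with h
  · rw [map_sub, hgt_ε (by omega) (by omega), hgt_ε (by omega) (by omega)]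
    push_cast; ring
  · rw [hgt_ε (by omega) le_rfl]; simp

/-- The positive roots, numbered by pairs: `ε_p - ε_q` for `p < q`, `ε_p + ε_q` for `q < p`,
and `ε_p` for `p = q`. -/
def rt (n p q : ℕ) : V n :=
  if p < q then ε n p - ε n q else if q < p then ε n p + ε n q else ε n p

/-- The set of positive roots. -/
def posRoots (n : ℕ) : Finset (V n) :=
  (Finset.Icc 1 n ×ˢ Finset.Icc 1 n).image fun x => rt n x.1 x.2

theorem mem_posRoots {β : V n} :
    β ∈ posRoots n ↔ ∃ p q, 1 ≤ p ∧ p ≤ n ∧ 1 ≤ q ∧ q ≤ n ∧ rt n p q = β := by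
  simp only [posRoots, Finset.mem_image, Finset.mem_product, Finset.mem_Icc, Prod.exists]
  constructor
  · rintro ⟨p, q, ⟨⟨h1, h2⟩, h3, h4⟩, h⟩; exact ⟨p, q, h1, h2, h3, h4, h⟩
  · rintro ⟨p, q, h1, h2, h3, h4, h⟩; exact ⟨p, q, ⟨⟨h1, h2⟩, h3, h4⟩, h⟩

theorem ε_mem_posRoots {p : ℕ} (h1 : 1 ≤ p) (h2 : p ≤ n) : ε n p ∈ posRoots n :=
  mem_posRoots.2 ⟨p, p, h1, h2, h1, h2, by simp [rt]⟩

theorem sub_mem_posRoots {p q : ℕ} (h1 : 1 ≤ p) (h2 : p < q) (h3 : q ≤ n) :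
    ε n p - ε n q ∈ posRoots n :=
  mem_posRoots.2 ⟨p, q, h1, by omega, by omega, h3, by simp [rt, h2]⟩

theorem add_mem_posRoots {p q : ℕ} (h1 : 1 ≤ p) (h2 : p ≤ n) (h3 : 1 ≤ q) (h4 : q ≤ n)
    (h : p ≠ q) : ε n p + ε n q ∈ posRoots n := by
  rcases lt_or_gt_of_ne h with h | h
  · exact mem_posRoots.2 ⟨q, p, h3, h4, h1, h2, by simp [rt, h, h.not_gt, add_comm]⟩
  · exact mem_posRoots.2 ⟨p, q, h1, h2, h3, h4, by simp [rt, h, h.not_gt]⟩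

/-- The coordinates of the two roots at the positions `p, q, p', q'` already force the pairs to
agree. This is how the positive roots are counted: there are `n * n`. -/
theorem rt_injOn : Set.InjOn (fun x : ℕ × ℕ => rt n x.1 x.2)
    (Finset.Icc 1 n ×ˢ Finset.Icc 1 n : Finset (ℕ × ℕ)) := by
  rintro ⟨p, q⟩ h ⟨p', q'⟩ h' e
  simp only [Finset.coe_product, Finset.coe_Icc, Set.mem_prod, Set.mem_Icc] at h h'
  have key : ∀ i, 1 ≤ i → i ≤ n → ∀ p q, ε n i ⬝ᵥ rt n p q =
      (if i = p then 1 else 0) + (if p < q then -1 else if q < p then 1 else 0) *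
        (if i = q then 1 else 0) := by
    intro i h1 h2 p q
    rw [rt]
    by_cases h5 : p < q
    · simp only [if_pos h5, dotProduct_sub, dot_ε h1 h2]; ring
    · by_cases h6 : q < p
      · simp only [if_neg h5, if_pos h6, dotProduct_add, dot_ε h1 h2]; ring
      · simp only [if_neg h5, if_neg h6, dot_ε h1 h2]; ring
  have e' : ∀ i, 1 ≤ i → i ≤ n → _ := fun i h1 h2 =>
    (key i h1 h2 p q).symm.trans ((congrArg (ε n i ⬝ᵥ ·) e).trans (key i h1 h2 p' q'))
  have e1 := e' p (by omega) (by omega)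
  have e2 := e' q (by omega) (by omega)
  have e3 := e' p' (by omega) (by omega)
  have e4 := e' q' (by omega) (by omega)
  clear e' e key
  grind

theorem card_posRoots : (posRoots n).card = n * n := by
  rw [posRoots, Finset.card_image_of_injOn rt_injOn]; simp

theorem one_le_hgt {β : V n} (h : β ∈ posRoots n) : 1 ≤ hgt n β := by
  obtain ⟨p, q, h1, h2, h3, h4, rfl⟩ := mem_posRoots.1 h
  obtain ⟨z, hz, hz'⟩ := exists_hgt_ε h1 h2
  obtain ⟨t, ht, ht'⟩ := exists_hgt_ε h3 h4
  rw [rt]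
  split_ifs with h5 h6
  · rw [map_sub, hz, ht]; exact_mod_cast (by omega)
  · rw [map_add, hz, ht]; exact_mod_cast (by omega)
  · rw [hz]; exact_mod_cast (by omega)

theorem hgt_pos {β : V n} (h : β ∈ posRoots n) : 0 < hgt n β :=
  lt_of_lt_of_le one_pos (one_le_hgt h)

theorem simpleRoot_mem (i : Fin n) : simpleRoot n i ∈ posRoots n := by
  have := i.isLt
  rw [simpleRoot]
  split_ifs with h
  · exact sub_mem_posRoots (by omega) (by omega) (by omega)
  · exact ε_mem_posRoots (by omega) le_rfl

/-- The roots. -/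
def IsRoot (β : V n) : Prop := β ∈ posRoots n ∨ -β ∈ posRoots n

theorem isRoot_neg {β : V n} : IsRoot (-β) ↔ IsRoot β := by
  rw [IsRoot, IsRoot, neg_neg, or_comm]

theorem isRoot_sub {p q : ℕ} (h1 : 1 ≤ p) (h2 : p ≤ n) (h3 : 1 ≤ q) (h4 : q ≤ n)
    (h : p ≠ q) : IsRoot (ε n p - ε n q) := by
  rcases lt_or_gt_of_ne h with h | h
  · exact Or.inl (sub_mem_posRoots h1 h h4)
  · right; rw [neg_sub]; exact sub_mem_posRoots h3 h h2

theorem isRoot_W (w : W n) {β : V n} (h : IsRoot β) : IsRoot (w.1 β) := by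
  wlog hβ : β ∈ posRoots n generalizing β
  · have := this (isRoot_neg.2 h) (h.resolve_left hβ)
    rwa [map_neg, isRoot_neg] at this
  obtain ⟨p, q, h1, h2, h3, h4, rfl⟩ := mem_posRoots.1 hβ
  obtain ⟨c, hc1, hc2, hc⟩ := W_ε w h1 h2
  obtain ⟨d, hd1, hd2, hd⟩ := W_ε w h3 h4
  by_cases hpq : p = q
  · subst hpq
    rw [rt, if_neg (lt_irrefl _), if_neg (lt_irrefl _)]
    rcases hc with hc | hc <;> rw [hc]
    · exact Or.inl (ε_mem_posRoots hc1 hc2)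
    · exact isRoot_neg.2 (Or.inl (ε_mem_posRoots hc1 hc2))
  · have hcd := W_ε_ne w h1 h2 hpq hc hd
    have r1 : IsRoot (ε n c + ε n d) := Or.inl (add_mem_posRoots hc1 hc2 hd1 hd2 hcd)
    have r2 := isRoot_sub hc1 hc2 hd1 hd2 hcd
    have r3 := isRoot_neg.2 r1
    have r4 := isRoot_neg.2 r2
    rw [neg_add'] at r3
    rw [neg_sub'] at r4
    rw [rt]
    split_ifs with h5 h6
    · rcases hc with hc | hc <;> rcases hd with hd | hd <;> rw [map_sub, hc, hd]
      all_goals first | exact r2 | exact r3 | simpa using r1 | simpa using r4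
    · rcases hc with hc | hc <;> rcases hd with hd | hd <;> rw [map_add, hc, hd, ← sub_neg_eq_add]
      all_goals first | simpa using r1 | simpa using r2 | simpa using r3 | simpa using r4
    · omega

theorem IsRoot.mem_of_hgt_pos {β : V n} (h : IsRoot β) (h' : 0 < hgt n β) : β ∈ posRoots n := by
  refine h.resolve_right fun h2 => ?_
  have := hgt_pos h2
  rw [map_neg] at this; linarith

theorem IsRoot.hgt_ne_zero {β : V n} (h : IsRoot β) : hgt n β ≠ 0 := by
  rcases h with h | h
  · exact (hgt_pos h).ne'
  · have := hgt_pos h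
    rw [map_neg] at this; linarith

theorem IsRoot.neg_mem_of_hgt_neg {β : V n} (h : IsRoot β) (h' : hgt n β < 0) :
    -β ∈ posRoots n :=
  (isRoot_neg.2 h).mem_of_hgt_pos (by rw [map_neg]; linarith)

/-- Since `α_i` has height `1`, the reflection `s_i` lowers the height of `β` by `⟨β, α_i^∨⟩`.
Comparing this with the height for each type of root shows that the sign survives unless `β = α_i`.
-/
theorem sFin_mem_posRoots (i : Fin n) {β : V n} (h : β ∈ posRoots n) (hβ : β ≠ simpleRoot n i) :
    (sFin n i).1 β ∈ posRoots n := by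
  refine (isRoot_W (sFin n i) (Or.inl h)).mem_of_hgt_pos ?_
  have hi := i.isLt
  rw [sFin_apply, map_sub, map_smul, hgt_simpleRoot, smul_eq_mul, mul_one]
  obtain ⟨p, q, h1, h2, h3, h4, rfl⟩ := mem_posRoots.1 h
  obtain ⟨z, hz, hz'⟩ := exists_hgt_ε h1 h2
  obtain ⟨t, ht, ht'⟩ := exists_hgt_ε h3 h4
  rw [simpleRoot] at hβ
  rw [rt] at hβ ⊢
  split_ifs at hβ ⊢ with h5 h6 h7 h8 h9
  all_goals
    simp only [map_sub, map_add, simpleCoroot_ε i h1 h2, simpleCoroot_ε i h3 h4, hz, ht]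
    norm_cast
    rw [cartan]
    try rw [cartan]
  · have : ¬ (p = i + 1 ∧ q = i + 2) := by rintro ⟨rfl, rfl⟩; exact hβ rfl
    split_ifs <;> omega
  · split_ifs <;> omega
  · split_ifs <;> omega
  · split_ifs <;> omega
  · split_ifs <;> omega
  · have : p ≠ n := by rintro rfl; exact hβ rfl
    split_ifs <;> omega

end TypeB

/-! ### Inversions, length and the longest element. -/

namespace TypeB

variable {n : ℕ}

/-! ### Weights at positions -/

/-- The height of `w ε_i`; it is `n + 1 - c` if `w ε_i = ε_c` and `-(n + 1 - c)` if
`w ε_i = - ε_c`. -/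
noncomputable def wt (w : W n) (i : ℕ) : ℤ := ⌊hgt n (w.1 (ε n i))⌋

theorem wt_of_eq {w : W n} {i c : ℕ} (h1 : 1 ≤ c) (h2 : c ≤ n) (h : w.1 (ε n i) = ε n c) :
    wt w i = n + 1 - c := by
  rw [wt, h, hgt_ε h1 h2, Int.floor_intCast]

theorem wt_of_eq_neg {w : W n} {i c : ℕ} (h1 : 1 ≤ c) (h2 : c ≤ n) (h : w.1 (ε n i) = - ε n c) :
    wt w i = - (n + 1 - c) := by
  rw [wt, h, map_neg, hgt_ε h1 h2, ← Int.cast_neg, Int.floor_intCast]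

theorem wt_cast (w : W n) {i : ℕ} (h1 : 1 ≤ i) (h2 : i ≤ n) :
    hgt n (w.1 (ε n i)) = (wt w i : ℚ) := by
  obtain ⟨c, hc1, hc2, hc | hc⟩ := W_ε w h1 h2
  · rw [wt_of_eq hc1 hc2 hc, hc, hgt_ε hc1 hc2]
  · rw [wt_of_eq_neg hc1 hc2 hc, hc, map_neg, hgt_ε hc1 hc2, Int.cast_neg]

theorem wt_bounds (w : W n) {i : ℕ} (h1 : 1 ≤ i) (h2 : i ≤ n) :
    wt w i ≠ 0 ∧ -n ≤ wt w i ∧ wt w i ≤ n := by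
  obtain ⟨c, hc1, hc2, hc | hc⟩ := W_ε w h1 h2
  · rw [wt_of_eq hc1 hc2 hc]; omega
  · rw [wt_of_eq_neg hc1 hc2 hc]; omega

theorem wt_ne (w : W n) {i j : ℕ} (h1 : 1 ≤ i) (h2 : i ≤ n) (h3 : 1 ≤ j) (h4 : j ≤ n)
    (h : i ≠ j) : wt w i ≠ wt w j ∧ wt w i ≠ - wt w j := by
  obtain ⟨c, hc1, hc2, hc⟩ := W_ε w h1 h2
  obtain ⟨d, hd1, hd2, hd⟩ := W_ε w h3 h4
  have := W_ε_ne w h1 h2 h hc hd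
  rcases hc with hc | hc <;> rcases hd with hd | hd
  · rw [wt_of_eq hc1 hc2 hc, wt_of_eq hd1 hd2 hd]; omega
  · rw [wt_of_eq hc1 hc2 hc, wt_of_eq_neg hd1 hd2 hd]; omega
  · rw [wt_of_eq_neg hc1 hc2 hc, wt_of_eq hd1 hd2 hd]; omega
  · rw [wt_of_eq_neg hc1 hc2 hc, wt_of_eq_neg hd1 hd2 hd]; omega

theorem W_ext {w u : W n} (h : ∀ i, 1 ≤ i → i ≤ n → w.1 (ε n i) = u.1 (ε n i)) : w = u := by
  apply Subtype.ext
  apply LinearEquiv.toLinearMap_injective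
  refine LinearMap.pi_ext' fun a => LinearMap.ext_ring ?_
  simp only [LinearMap.comp_apply, LinearMap.single_apply, LinearEquiv.coe_coe, ← ε_succ]
  exact h _ (by omega) a.isLt

theorem W_ext_wt {w u : W n} (h : ∀ i, 1 ≤ i → i ≤ n → wt w i = wt u i) : w = u := by
  refine W_ext fun i h1 h2 => ?_
  have := h i h1 h2
  obtain ⟨c, hc1, hc2, hc⟩ := W_ε w h1 h2
  obtain ⟨d, hd1, hd2, hd⟩ := W_ε u h1 h2
  rcases hc with hc | hc <;> rcases hd with hd | hd
  · rw [wt_of_eq hc1 hc2 hc, wt_of_eq hd1 hd2 hd] at this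
    rw [hc, hd, show c = d by omega]
  · rw [wt_of_eq hc1 hc2 hc, wt_of_eq_neg hd1 hd2 hd] at this; omega
  · rw [wt_of_eq_neg hc1 hc2 hc, wt_of_eq hd1 hd2 hd] at this; omega
  · rw [wt_of_eq_neg hc1 hc2 hc, wt_of_eq_neg hd1 hd2 hd] at this
    rw [hc, hd, show c = d by omega]

instance : Finite (W n) := by
  let f : W n → (Finset.Icc 1 n → Finset.Icc (-n : ℤ) n) := fun w i =>
    ⟨wt w i, by
      have := Finset.mem_Icc.1 i.2
      exact Finset.mem_Icc.2 (wt_bounds w this.1 this.2).2⟩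
  refine Finite.of_injective f fun w u h => W_ext_wt fun i h1 h2 => ?_
  exact congrArg Subtype.val (congrFun h ⟨i, Finset.mem_Icc.2 ⟨h1, h2⟩⟩)

noncomputable instance : Fintype (W n) := Fintype.ofFinite _

/-! ### Inversions and length -/

/-- The inversions of `w`: the positive roots that `w` makes negative. -/
noncomputable def Inv (w : W n) : Finset (V n) := (posRoots n).filter fun β => hgt n (w.1 β) < 0

theorem mem_Inv {w : W n} {β : V n} : β ∈ Inv w ↔ β ∈ posRoots n ∧ hgt n (w.1 β) < 0 := by
  simp [Inv]

theorem hgt_W_ne_zero (w : W n) {β : V n} (h : IsRoot β) : hgt n (w.1 β) ≠ 0 :=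
  (isRoot_W w h).hgt_ne_zero

theorem isRoot_simpleRoot (i : Fin n) : IsRoot (simpleRoot n i) := Or.inl (simpleRoot_mem i)

/-- The only roots whose sign `s_i` changes are `±α_i`, so passing from `w` to `s_i w` affects only
the positive root that `w` sends to `±α_i`. -/
theorem Inv_sFin_mul {w : W n} {i : Fin n} (h : 0 < hgt n ((w⁻¹).1 (simpleRoot n i))) :
    Inv (sFin n i * w) = insert ((w⁻¹).1 (simpleRoot n i)) (Inv w) := by
  ext β
  rw [Finset.mem_insert, mem_Inv, mem_Inv, mul_coe_apply]
  have hr := isRoot_W w⁻¹ (isRoot_simpleRoot i)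
  by_cases hβ : β = (w⁻¹).1 (simpleRoot n i)
  · subst hβ
    rw [coe_inv_apply, sFin_simpleRoot, map_neg, hgt_simpleRoot]
    exact iff_of_true ⟨hr.mem_of_hgt_pos h, by norm_num⟩ (Or.inl rfl)
  · simp only [hβ, false_or, and_congr_right_iff]
    intro hp
    have hw := isRoot_W w (Or.inl hp)
    constructor
    · intro h1
      by_contra h2
      have h3 := hw.mem_of_hgt_pos (lt_of_le_of_ne (not_lt.1 h2) hw.hgt_ne_zero.symm)
      have h4 := hgt_pos (sFin_mem_posRoots i h3 fun h5 => hβ (by rw [← h5, inv_coe_apply]))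
      linarith
    · intro h1
      have h3 := hw.neg_mem_of_hgt_neg h1
      have h4 := hgt_pos (sFin_mem_posRoots i h3 fun h5 => by
        have : β = - (w⁻¹).1 (simpleRoot n i) := by
          rw [← h5, map_neg, inv_coe_apply, neg_neg]
        have h6 := hgt_pos hp
        rw [this, map_neg] at h6; linarith)
      rw [map_neg, map_neg] at h4
      linarith

theorem notMem_Inv {w : W n} {i : Fin n} : (w⁻¹).1 (simpleRoot n i) ∉ Inv w := by
  rw [mem_Inv, coe_inv_apply, hgt_simpleRoot]; norm_num

theorem Inv_mul_sFin {w : W n} {i : Fin n} (h : 0 < hgt n (w.1 (simpleRoot n i))) :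
    Inv (w * sFin n i) = insert (simpleRoot n i) ((Inv w).image (sFin n i).1) := by
  ext β
  rw [Finset.mem_insert, mem_Inv, mul_coe_apply, Finset.mem_image]
  by_cases hβ : β = simpleRoot n i
  · subst hβ
    simp [sFin_simpleRoot, simpleRoot_mem, h]
  · simp only [hβ, false_or]
    constructor
    · rintro ⟨h1, h2⟩
      exact ⟨_, mem_Inv.2 ⟨sFin_mem_posRoots i h1 hβ, h2⟩, sFin_apply_twice i β⟩
    · rintro ⟨β', h1, rfl⟩
      obtain ⟨h1, h2⟩ := mem_Inv.1 h1
      rw [sFin_apply_twice]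
      refine ⟨sFin_mem_posRoots i h1 ?_, h2⟩
      rintro rfl; linarith

/-- The number of inversions. -/
noncomputable def inv (w : W n) : ℕ := (Inv w).card

theorem inv_sFin_mul {w : W n} {i : Fin n} (h : 0 < hgt n ((w⁻¹).1 (simpleRoot n i))) :
    inv (sFin n i * w) = inv w + 1 := by
  rw [inv, Inv_sFin_mul h, Finset.card_insert_of_notMem notMem_Inv, inv]

theorem inv_sFin_mul' {w : W n} {i : Fin n} (h : hgt n ((w⁻¹).1 (simpleRoot n i)) < 0) :
    inv w = inv (sFin n i * w) + 1 := by
  have h1 : 0 < hgt n (((sFin n i * w)⁻¹).1 (simpleRoot n i)) := by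
    rw [mul_inv_rev, sFin_inv, mul_coe_apply, sFin_simpleRoot, map_neg, map_neg]; linarith
  have := inv_sFin_mul h1
  rwa [← mul_assoc, sFin_mul_self, one_mul] at this

theorem hgt_W_simpleRoot_cases (w : W n) (i : Fin n) :
    0 < hgt n (w.1 (simpleRoot n i)) ∨ hgt n (w.1 (simpleRoot n i)) < 0 :=
  (lt_or_gt_of_ne (hgt_W_ne_zero w (isRoot_simpleRoot i))).symm

/-- The map `β ↦ -w β` carries inversions of `w` injectively to inversions of `w⁻¹`; symmetry gives
equality. -/
theorem inv_inverse (w : W n) : inv w⁻¹ = inv w := by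
  have key : ∀ w : W n, inv w ≤ inv w⁻¹ := by
    intro w
    refine Finset.card_le_card_of_injOn (fun β => - w.1 β) ?_ ?_
    · intro β hβ
      obtain ⟨h1, h2⟩ := mem_Inv.1 hβ
      refine mem_Inv.2 ⟨(isRoot_W w (Or.inl h1)).neg_mem_of_hgt_neg h2, ?_⟩
      rw [map_neg, inv_coe_apply, map_neg]
      linarith [hgt_pos h1]
    · intro β _ β' _ h
      exact w.1.injective (neg_injective h)
  refine le_antisymm ?_ (key w)
  have := key w⁻¹
  rwa [inv_inv] at this

theorem inv_mul_sFin {w : W n} {i : Fin n} (h : 0 < hgt n (w.1 (simpleRoot n i))) :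
    inv (w * sFin n i) = inv w + 1 := by
  rw [← inv_inverse, mul_inv_rev, sFin_inv, inv_sFin_mul (by rwa [inv_inv]), inv_inverse]

theorem inv_mul_sFin' {w : W n} {i : Fin n} (h : hgt n (w.1 (simpleRoot n i)) < 0) :
    inv w = inv (w * sFin n i) + 1 := by
  rw [← inv_inverse (w * _), mul_inv_rev, sFin_inv, ← inv_sFin_mul' (by rwa [inv_inv]),
    inv_inverse]

theorem inv_one : inv (1 : W n) = 0 := by
  rw [inv, Finset.card_eq_zero, Finset.eq_empty_iff_forall_notMem]
  intro β hβ
  obtain ⟨h1, h2⟩ := mem_Inv.1 hβ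
  have := hgt_pos h1
  rw [one_coe_apply] at h2; linarith

theorem simpleRoot_of_lt {j : ℕ} (h1 : 1 ≤ j) (h2 : j < n) :
    simpleRoot n ⟨j - 1, by omega⟩ = ε n j - ε n (j + 1) := by
  rw [simpleRoot, if_pos (by simp; omega)]
  congr 2 <;> simp <;> omega

theorem simpleRoot_last (h : 1 ≤ n) : simpleRoot n ⟨n - 1, by omega⟩ = ε n n := by
  rw [simpleRoot, if_neg (by simp; omega)]

/-- Counting up from the positive last value bounds `t i` below, and counting down from the first
value bounds it above by the same number. -/
theorem eq_of_strictAnti_of_le {t : ℕ → ℤ} (h1 : ∀ j, 1 ≤ j → j < n → t (j + 1) < t j)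
    (h0 : 1 ≤ n → 0 < t n) (hn : 1 ≤ n → t 1 ≤ n) {i : ℕ} (hi : 1 ≤ i) (hi' : i ≤ n) :
    t i = n + 1 - i := by
  have h2 : ∀ k, k < n → (k : ℤ) + 1 ≤ t (n - k) := by
    intro k
    induction k with
    | zero => intro hk; have := h0 (by omega); simp only [Nat.sub_zero]; omega
    | succ k ih =>
      intro hk
      have h3 := ih (by omega)
      have h4 := h1 (n - (k + 1)) (by omega) (by omega)
      rw [show n - (k + 1) + 1 = n - k by omega] at h4
      push_cast; omega
  have h3 : ∀ i, 1 ≤ i → i ≤ n → t i ≤ n + 1 - i := by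
    intro i hi
    induction i, hi using Nat.le_induction with
    | base => intro h; have := hn h; push_cast; omega
    | succ i hi ih =>
      intro hn
      have h3 := ih (by omega)
      have h4 := h1 i hi (by omega)
      push_cast; omega
  have h4 := h2 (n - i) (by omega)
  rw [show n - (n - i) = i by omega] at h4
  have := h3 i hi hi'
  omega

theorem hgt_W_simpleRoot_of_lt (w : W n) {j : ℕ} (h1 : 1 ≤ j) (h2 : j < n) :
    hgt n (w.1 (simpleRoot n ⟨j - 1, by omega⟩)) = ((wt w j - wt w (j + 1) : ℤ) : ℚ) := by
  rw [simpleRoot_of_lt h1 h2, map_sub, map_sub, wt_cast w h1 h2.le,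
    wt_cast w (by omega) (by omega), Int.cast_sub]

theorem hgt_W_simpleRoot_last (w : W n) (h : 1 ≤ n) :
    hgt n (w.1 (simpleRoot n ⟨n - 1, by omega⟩)) = (wt w n : ℚ) := by
  rw [simpleRoot_last h, wt_cast w h le_rfl]

theorem eq_one_of_forall_pos {w : W n} (h : ∀ i, 0 < hgt n (w.1 (simpleRoot n i))) : w = 1 := by
  refine W_ext_wt fun i hi hi' => ?_
  rw [wt_of_eq hi hi' (one_coe_apply (ε n i))]
  refine eq_of_strictAnti_of_le (t := wt w) ?_ ?_ ?_ hi hi'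
  · intro j h1 h2
    have := h ⟨j - 1, by omega⟩
    rw [hgt_W_simpleRoot_of_lt w h1 h2, Int.cast_pos] at this; omega
  · intro hn
    have := h ⟨n - 1, by omega⟩
    rwa [hgt_W_simpleRoot_last w hn, Int.cast_pos] at this
  · intro hn; exact (wt_bounds w le_rfl hn).2.2

theorem eq_neg_of_forall_neg {w : W n} (h : ∀ i, hgt n (w.1 (simpleRoot n i)) < 0) (x : V n) :
    w.1 x = -x := by
  have key : ∀ i, 1 ≤ i → i ≤ n → w.1 (ε n i) = - ε n i := by
    intro i hi hi'
    have h1 : - wt w i = n + 1 - i := by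
      refine eq_of_strictAnti_of_le (t := fun i => - wt w i) ?_ ?_ ?_ hi hi'
      · intro j h1 h2
        have := h ⟨j - 1, by omega⟩
        rw [hgt_W_simpleRoot_of_lt w h1 h2, Int.cast_lt_zero] at this; omega
      · intro hn
        have := h ⟨n - 1, by omega⟩
        rw [hgt_W_simpleRoot_last w hn, Int.cast_lt_zero] at this; omega
      · intro hn; have := (wt_bounds w le_rfl hn).2.1; omega
    obtain ⟨c, hc1, hc2, hc | hc⟩ := W_ε w hi hi'
    · rw [wt_of_eq hc1 hc2 hc] at h1; omega
    · rw [wt_of_eq_neg hc1 hc2 hc] at h1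
      rw [hc, show c = i by omega]
  have : w.1.toLinearMap = -LinearMap.id := by
    refine LinearMap.pi_ext' fun a => LinearMap.ext_ring ?_
    simp only [LinearMap.comp_apply, LinearMap.single_apply, LinearEquiv.coe_coe, ← ε_succ,
      LinearMap.neg_apply, LinearMap.id_apply]
    exact key _ (by omega) a.isLt
  exact LinearMap.congr_fun this x

/-- The product of a word in the simple reflections. -/
noncomputable def wprod (L : List (Fin n)) : W n := (L.map (sFin n)).prod

theorem wprod_nil : wprod ([] : List (Fin n)) = 1 := rfl

theorem wprod_cons (i : Fin n) (L : List (Fin n)) : wprod (i :: L) = sFin n i * wprod L := by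
  simp [wprod]

theorem wprod_append (L M : List (Fin n)) : wprod (L ++ M) = wprod L * wprod M := by
  simp [wprod]

theorem inv_wprod_le (L : List (Fin n)) : inv (wprod L) ≤ L.length := by
  induction L with
  | nil => rw [wprod_nil, inv_one]; simp
  | cons i L ih =>
    rw [wprod_cons, List.length_cons]
    rcases hgt_W_simpleRoot_cases (wprod L)⁻¹ i with h | h
    · rw [inv_sFin_mul h]; omega
    · have := inv_sFin_mul' h; omega

/-- An element other than `1` has a left descent, and removing descents one at a time spells a word
with one letter for each inversion. Together with `inv_wprod_le` this identifies length with the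
number of inversions. -/
theorem exists_word (w : W n) : ∃ L, L.length = inv w ∧ wprod L = w := by
  induction h : inv w using Nat.strong_induction_on generalizing w with
  | _ d ih =>
    by_cases hw : w⁻¹ = 1
    · rw [inv_eq_one] at hw
      subst hw
      exact ⟨[], by rw [← h, inv_one]; rfl, rfl⟩
    · obtain ⟨i, hi⟩ : ∃ i, hgt n ((w⁻¹).1 (simpleRoot n i)) < 0 := by
        by_contra! hc
        refine hw (eq_one_of_forall_pos fun i => ?_)
        exact (hgt_W_simpleRoot_cases w⁻¹ i).resolve_right (not_lt.2 (hc i))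
      have h1 := inv_sFin_mul' hi
      obtain ⟨L, hL1, hL2⟩ := ih (inv (sFin n i * w)) (by omega) _ rfl
      refine ⟨i :: L, by rw [List.length_cons, hL1]; omega, ?_⟩
      rw [wprod_cons, hL2, ← mul_assoc, sFin_mul_self, one_mul]

theorem length_eq_inv (w : W n) : length w = inv w := by
  obtain ⟨L, hL1, hL2⟩ := exists_word w
  refine le_antisymm (Nat.sInf_le ⟨L, hL1, hL2⟩) ?_
  refine le_csInf ⟨_, L, rfl, hL2⟩ ?_
  rintro _ ⟨M, rfl, hM⟩
  have := inv_wprod_le M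
  rwa [wprod, hM] at this

theorem reducedWord_spec (w : W n) :
    wprod (reducedWord w) = w ∧ (reducedWord w).length = inv w := by
  obtain ⟨L, hL1, hL2⟩ := exists_word w
  have := Classical.epsilon_spec
    (p := fun L => (L.map (sFin n)).prod = w ∧ L.length = length w)
    ⟨L, hL2, by rw [hL1, length_eq_inv]⟩
  exact ⟨this.1, this.2.trans (length_eq_inv w)⟩

/-! ### The longest element -/

/-- An element of greatest length makes every simple root negative, since otherwise a right factor
`s_i` would lengthen it. In type B only `-1` does so. -/
theorem longest_apply (x : V n) : (longest n).1 x = -x := by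
  have hw : ∀ u : W n, length u ≤ length (longest n) := by
    refine Classical.epsilon_spec (p := fun w : W n => ∀ u : W n, length u ≤ length w) ?_
    exact Finite.exists_max _
  refine eq_neg_of_forall_neg (fun i => ?_) x
  refine (hgt_W_simpleRoot_cases _ i).resolve_left fun h => ?_
  have := hw (longest n * sFin n i)
  rw [length_eq_inv, length_eq_inv, inv_mul_sFin h] at this
  omega

theorem inv_mul_longest_add (w : W n) : inv (w * longest n) + inv w = n * n := by
  have h : Inv (w * longest n) = (posRoots n).filter fun β => ¬ hgt n (w.1 β) < 0 := by
    ext β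
    rw [mem_Inv, Finset.mem_filter, mul_coe_apply, longest_apply, map_neg, map_neg]
    refine and_congr_right fun h => ?_
    have := hgt_W_ne_zero w (Or.inl h)
    rw [neg_lt_zero, not_lt]
    exact ⟨le_of_lt, fun h => lt_of_le_of_ne h this.symm⟩
  rw [inv, inv, h, Inv, add_comm, Finset.card_filter_add_card_filter_not, card_posRoots]

theorem Inv_longest : Inv (longest n) = posRoots n := by
  refine Finset.filter_true_of_mem fun β h => ?_
  rw [longest_apply, map_neg]; linarith [hgt_pos h]

theorem inv_longest : inv (longest n) = n * n := by rw [inv, Inv_longest, card_posRoots]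

theorem longest_inv : (longest n)⁻¹ = longest n := by
  refine inv_eq_of_mul_eq_one_left (W_ext fun i _ _ => ?_)
  rw [mul_coe_apply, longest_apply, longest_apply, neg_neg, one_coe_apply]

theorem inv_le (w : W n) : inv w ≤ n * n := by
  have := inv_mul_longest_add w; omega

theorem eq_longest {w : W n} (h : inv w = n * n) : w = longest n := by
  have h1 := inv_mul_longest_add w
  have h2 : inv (w * longest n) = 0 := by omega
  have h3 : w * longest n = 1 := by
    refine eq_one_of_forall_pos fun i => ?_
    refine (hgt_W_simpleRoot_cases _ i).resolve_right fun h => ?_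
    have := inv_mul_sFin' h
    omega
  rw [eq_comm, ← longest_inv]; exact inv_eq_of_mul_eq_one_left h3

end TypeB

/-! ### The Leibniz rule for words, and independence of the reduced word. -/

namespace TypeB

open MvPolynomial

variable {n : ℕ}

/-! ### Divided differences of words -/

/-- The words obtained from `L` by leaving out one letter, each with the root `γ` such that its
product is the product of `L` times the reflection in `γ`. -/
noncomputable def deletions : List (Fin n) → List (V n × List (Fin n))
  | [] => []
  | i :: L => (((wprod L)⁻¹).1 (simpleRoot n i), L) ::
      (deletions L).map fun p => (p.1, i :: p.2)

theorem deletions_spec {L : List (Fin n)} {p : V n × List (Fin n)} (hp : p ∈ deletions L) :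
    IsRoot p.1 ∧ p.2.length + 1 = L.length ∧
      ∀ x, (wprod p.2).1 x = (wprod L).1 (refl p.1 x) := by
  induction L generalizing p with
  | nil => simp [deletions] at hp
  | cons i L ih =>
    rw [deletions, List.mem_cons, List.mem_map] at hp
    rcases hp with rfl | ⟨p, hp, rfl⟩
    · refine ⟨isRoot_W _ (isRoot_simpleRoot i), rfl, fun x => ?_⟩
      have h := refl_W (wprod L)⁻¹ (simpleRoot n i) ((wprod L).1 x)
      rw [inv_coe_apply] at h
      change _ = (wprod (i :: L)).1 (refl (((wprod L)⁻¹).1 (simpleRoot n i)) x)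
      rw [h, wprod_cons, mul_coe_apply, coe_inv_apply, ← simpleReflection_eq]
      exact (sFin_apply_twice i _).symm
    · obtain ⟨h1, h2, h3⟩ := ih hp
      refine ⟨h1, by simp [h2], fun x => ?_⟩
      rw [wprod_cons, wprod_cons, mul_coe_apply, mul_coe_apply, h3]

theorem cor_inv_W (w : W n) (β x : V n) : cor ((w⁻¹).1 β) x = cor β (w.1 x) := by
  rw [← cor_W w, coe_inv_apply]

/-- As the linear form travels outwards through the word, each letter may act on it, which produces
a scalar and deletes that letter. The word need not be reduced. -/
theorem D_linForm_mul (L : List (Fin n)) (v : V n) (f : Sym n) :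
    D L (linForm v * f) = linForm ((wprod L).1 v) * D L f +
      ((deletions L).map fun p => cor p.1 v • D p.2 f).sum := by
  induction L with
  | nil => simp [D_nil, deletions, wprod_nil]
  | cons i L ih =>
    have h : dd i ((deletions L).map fun p => cor p.1 v • D p.2 f).sum =
        ((deletions L).map fun p => cor p.1 v • D (i :: p.2) f).sum := by
      rw [map_list_sum, List.map_map]
      congr 1
      refine List.map_congr_left fun p _ => ?_
      rw [Function.comp_apply, map_smul, D_cons]
    rw [D_cons, ih, map_add, h, dd_mul, dd_linForm, act_linForm, deletions, List.map_cons,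
      List.sum_cons, List.map_map, wprod_cons, mul_coe_apply, cor_inv_W, simpleCoroot_eq,
      MvPolynomial.smul_eq_C_mul, D_cons, sFin]
    simp only [Function.comp_def]
    ring

/-- A word is reduced if it has the least possible length for its product. -/
def Reduced (L : List (Fin n)) : Prop := inv (wprod L) = L.length

theorem Reduced.of_cons {i : Fin n} {L : List (Fin n)} (h : Reduced (i :: L)) :
    Reduced L ∧ 0 < hgt n (((wprod L)⁻¹).1 (simpleRoot n i)) := by
  rw [Reduced, wprod_cons, List.length_cons] at h
  have h1 := inv_wprod_le L
  rcases hgt_W_simpleRoot_cases (wprod L)⁻¹ i with h2 | h2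
  · rw [inv_sFin_mul h2] at h
    exact ⟨by rw [Reduced]; omega, h2⟩
  · have := inv_sFin_mul' h2; omega

/-- A letter put in front of a reduced word, if the result is reduced, adds one inversion, and it is
the root attached to deleting that letter. -/
theorem Reduced.map_fst_deletions {L : List (Fin n)} (h : Reduced L) :
    (((deletions L).map Prod.fst : List (V n)) : Multiset (V n)) = (Inv (wprod L)).val := by
  induction L with
  | nil =>
    have := inv_one (n := n)
    rw [inv, Finset.card_eq_zero] at this
    simp [deletions, wprod_nil, this]
  | cons i L ih =>
    obtain ⟨h1, h2⟩ := h.of_cons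
    rw [wprod_cons, Inv_sFin_mul h2, Finset.insert_val_of_notMem notMem_Inv, ← ih h1, deletions]
    simp [Function.comp_def]

theorem exists_deletion {L : List (Fin n)} (h : Reduced L) {γ : V n} (hγ : γ ∈ Inv (wprod L)) :
    ∃ M, (γ, M) ∈ deletions L := by
  rw [← Finset.mem_val, ← h.map_fst_deletions, Multiset.mem_coe, List.mem_map] at hγ
  obtain ⟨p, hp, rfl⟩ := hγ
  exact ⟨p.2, hp⟩

/-- If `γ` is an inversion of `w`, then `w s_γ` is an element of `W` of smaller length. -/
theorem exists_refl_lt {w : W n} {γ : V n} (hγ : γ ∈ Inv w) :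
    ∃ u : W n, (∀ x, u.1 x = w.1 (refl γ x)) ∧ inv u < inv w := by
  obtain ⟨L, hL1, rfl⟩ := exists_word w
  obtain ⟨M, hM⟩ := exists_deletion hL1.symm hγ
  obtain ⟨-, h2, h3⟩ := deletions_spec hM
  refine ⟨wprod M, h3, ?_⟩
  have := inv_wprod_le M
  rw [← hL1]; simp only at h2; omega

/-- The divided difference operators of reduced words of length `d` with a given product,
and zero if there are no such words. -/
noncomputable def Dfun (d : ℕ) (g : V n → V n) (f : Sym n) : Sym n :=
  open Classical in
  if h : ∃ L : List (Fin n), Reduced L ∧ L.length = d ∧ ⇑(wprod L).1 = g then D h.choose f else 0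

/-- Linear forms generate the algebra, so an operator that intertwines multiplication by them in
this twisted way is determined by its value at `1`. -/
theorem eq_zero_of_commutes {X : Sym n →ₗ[ℚ] Sym n} (w : W n)
    (h : ∀ v f, X (linForm v * f) = linForm (w.1 v) * X f) (h1 : X 1 = 0) : X = 0 := by
  refine LinearMap.ext fun f => ?_
  induction f using MvPolynomial.induction_on with
  | C a =>
    rw [← mul_one (C a), ← MvPolynomial.smul_eq_C_mul, map_smul, h1]; simp
  | add p q hp hq => rw [map_add, hp, hq]; simp
  | mul_X p a hp => rw [mul_comm, ← linForm_single, h, hp]; simp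

theorem D_one_of_ne_nil {L : List (Fin n)} (h : L ≠ []) : D L (1 : Sym n) = 0 := by
  induction L with
  | nil => exact absurd rfl h
  | cons i L ih =>
    rw [D_cons]
    by_cases hL : L = []
    · subst hL; rw [D_nil, ← C_1, dd_C]
    · rw [ih hL, map_zero]

/-- This takes the place of the braid relations. By the Leibniz rule, the operators of two reduced
words for `w` have correction terms indexed by the same inversions of `w`, built from words one
letter shorter, which agree by induction. Hence the difference of the operators intertwines
multiplication by linear forms, and it kills `1`. The vanishing for words that are not reduced is
needed in the same induction, because a deletion may fail to be reduced. -/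
theorem D_reduced_aux (d : ℕ) :
    (∀ L M : List (Fin n), Reduced L → Reduced M → L.length = d → wprod L = wprod M →
      D L = D M) ∧
    (∀ L : List (Fin n), ¬ Reduced L → L.length = d → D L = 0) := by
  induction d with
  | zero =>
    refine ⟨fun L M hL hM h0 h => ?_, fun L hL h0 => ?_⟩
    · have : M.length = 0 := by rw [← hM, ← h, hL, h0]
      rw [List.length_eq_zero_iff] at this h0
      rw [this, h0]
    · rw [List.length_eq_zero_iff] at h0
      subst h0
      exact absurd inv_one hL
  | succ d ih =>
    obtain ⟨ih1, ih2⟩ := ih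
    constructor
    · intro L M hL hM hd h
      have hMd : M.length = d + 1 := by rw [← hM, ← h, hL, hd]
      -- By induction the operator of a word of length `d` depends only on its product as a map. The
      -- correction terms can then be indexed by the root `γ` alone.
      have hDfun : ∀ L' : List (Fin n), L'.length = d → ∀ f, D L' f = Dfun d (wprod L').1 f := by
        intro L' hL' f
        rw [Dfun]
        by_cases hr : Reduced L'
        · have hex : ∃ N : List (Fin n), Reduced N ∧ N.length = d ∧
              ⇑(wprod N).1 = (wprod L').1 := ⟨L', hr, hL', rfl⟩
          rw [dif_pos hex]
          obtain ⟨h1, h2, h3⟩ := hex.choose_spec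
          rw [ih1 L' _ hr h1 hL' (Subtype.ext (DFunLike.coe_injective h3.symm))]
        · rw [ih2 L' hr hL', LinearMap.zero_apply, dif_neg]
          rintro ⟨N, h1, h2, h3⟩
          have : wprod N = wprod L' := Subtype.ext (DFunLike.coe_injective h3)
          exact hr (by rw [Reduced, ← this, h1, h2, hL'])
      have key : ∀ K : List (Fin n), Reduced K → K.length = d + 1 → ∀ v f,
          D K (linForm v * f) = linForm ((wprod K).1 v) * D K f +
            ∑ γ ∈ Inv (wprod K), cor γ v • Dfun d (fun x => (wprod K).1 (refl γ x)) f := by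
        intro K hK hKd v f
        rw [D_linForm_mul]
        congr 1
        rw [Finset.sum, ← hK.map_fst_deletions, Multiset.map_coe, Multiset.sum_coe, List.map_map]
        congr 1
        refine List.map_congr_left fun p hp => ?_
        obtain ⟨-, h2, h3⟩ := deletions_spec hp
        rw [Function.comp_apply, hDfun p.2 (by omega), funext h3]
      refine sub_eq_zero.1 (eq_zero_of_commutes (wprod L) (fun v f => ?_) ?_)
      · rw [LinearMap.sub_apply, LinearMap.sub_apply, key L hL hd, key M hM hMd, h]; ring
      · rw [LinearMap.sub_apply, D_one_of_ne_nil, D_one_of_ne_nil, sub_zero]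
        · rintro rfl; simp at hMd
        · rintro rfl; simp at hd
    · intro L hL hd
      cases L with
      | nil => simp at hd
      | cons i L =>
        have hd' : L.length = d := by simpa using hd
        refine LinearMap.ext fun f => ?_
        rw [D_cons]
        by_cases hr : Reduced L
        · rcases hgt_W_simpleRoot_cases (wprod L)⁻¹ i with h2 | h2
          · exact absurd (by rw [Reduced, wprod_cons, inv_sFin_mul h2, hr]; rfl) hL
          -- Here `s_i` shortens the product of the reduced word `L`, so `L` may be replaced by a
          -- reduced word that starts with `i`, and `∂_i ∂_i = 0` applies.
          · have h3 := inv_sFin_mul' h2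
            obtain ⟨M, hM1, hM2⟩ := exists_word (sFin n i * wprod L)
            have h4 : wprod (i :: M) = wprod L := by
              rw [wprod_cons, hM2, ← mul_assoc, sFin_mul_self, one_mul]
            have h5 : Reduced (i :: M) := by rw [Reduced, h4, h3, List.length_cons, hM1]
            rw [ih1 L (i :: M) hr h5 hd' h4.symm, D_cons, dd_dd]; rfl
        · rw [ih2 L hr hd']; simp

theorem D_eq_of_reduced {L M : List (Fin n)} (hL : Reduced L) (hM : Reduced M)
    (h : wprod L = wprod M) : D L = D M := (D_reduced_aux L.length).1 L M hL hM rfl h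

theorem D_eq_zero {L : List (Fin n)} (hL : ¬ Reduced L) : D L = 0 :=
  (D_reduced_aux L.length).2 L hL rfl

theorem reduced_reducedWord (w : W n) : Reduced (reducedWord w) := by
  obtain ⟨h1, h2⟩ := reducedWord_spec w
  rw [Reduced, h1, h2]

/-- The divided difference operator of a Weyl group element. -/
noncomputable def DW (w : W n) : Sym n →ₗ[ℚ] Sym n := D (reducedWord w)

theorem D_eq_DW {L : List (Fin n)} (hL : Reduced L) : D L = DW (wprod L) :=
  D_eq_of_reduced hL (reduced_reducedWord _) (reducedWord_spec _).1.symm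

theorem D_eq_ite (L : List (Fin n)) :
    D L = open Classical in if inv (wprod L) = L.length then DW (wprod L) else 0 := by
  split_ifs with h
  · exact D_eq_DW h
  · exact D_eq_zero h

theorem DW_mul_of_inv_add {u w : W n} (h : inv (u * w) = inv u + inv w) (f : Sym n) :
    DW u (DW w f) = DW (u * w) f := by
  obtain ⟨h1, h2⟩ := reducedWord_spec u
  obtain ⟨h3, h4⟩ := reducedWord_spec w
  have h5 : wprod (reducedWord u ++ reducedWord w) = u * w := by rw [wprod_append, h1, h3]
  rw [DW, DW, ← D_append, D_eq_DW, h5]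
  rw [Reduced, h5, h, List.length_append, h2, h4]

theorem DW_mul_of_ne {u w : W n} (h : inv (u * w) ≠ inv u + inv w) (f : Sym n) :
    DW u (DW w f) = 0 := by
  obtain ⟨h1, h2⟩ := reducedWord_spec u
  obtain ⟨h3, h4⟩ := reducedWord_spec w
  have h5 : wprod (reducedWord u ++ reducedWord w) = u * w := by rw [wprod_append, h1, h3]
  rw [DW, DW, ← D_append, D_eq_zero]
  · rfl
  · rwa [Reduced, h5, List.length_append, h2, h4]

theorem dd_eq_DW (i : Fin n) : dd i = DW (sFin n i) := by
  have h1 : wprod [i] = sFin n i := by simp [wprod]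
  have h : Reduced [i] := by
    rw [Reduced, h1, ← mul_one (sFin n i), inv_sFin_mul, inv_one]; · rfl
    rw [_root_.inv_one, one_coe_apply, hgt_simpleRoot]; exact one_pos
  have := D_eq_DW h
  rw [h1] at this
  rw [← this]; rfl

theorem DW_one : DW (1 : W n) = LinearMap.id := by
  have : Reduced ([] : List (Fin n)) := inv_one
  have := D_eq_DW this
  rw [wprod_nil] at this
  rw [← this]; rfl

/-- The Leibniz rule for the product with a linear form. -/
theorem DW_linForm_mul (w : W n) (v : V n) (f : Sym n) :
    DW w (linForm v * f) = linForm (w.1 v) * DW w f +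
      ∑ γ ∈ Inv w, cor γ v • ∑ u : W n,
        open Classical in
        if (∀ x, u.1 x = w.1 (refl γ x)) ∧ inv u + 1 = inv w then DW u f else 0 := by
  obtain ⟨L, hL, rfl⟩ := exists_word w
  have hr : Reduced L := hL.symm
  rw [← D_eq_DW hr, D_linForm_mul]
  congr 1
  rw [Finset.sum, ← hr.map_fst_deletions, Multiset.map_coe, Multiset.sum_coe, List.map_map]
  congr 1
  refine List.map_congr_left fun p hp => ?_
  obtain ⟨-, h4, h5⟩ := deletions_spec hp
  rw [Function.comp_apply, D_eq_ite, Finset.sum_eq_single (wprod p.2)]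
  · simp only [h5, implies_true, true_and]
    congr 1
    rw [hr]
    by_cases h6 : inv (wprod p.2) = p.2.length
    · rw [if_pos h6, if_pos (by omega)]
    · rw [if_neg h6, if_neg (by omega)]; rfl
  · intro u _ hu
    rw [if_neg]
    rintro ⟨h6, -⟩
    exact hu (W_ext fun i _ _ => by rw [h6, h5])
  · intro h; exact absurd (Finset.mem_univ _) h

end TypeB

/-! ### Normalisation of the point class. -/

namespace TypeB

open MvPolynomial

variable {n : ℕ}

/-! ### The class of a point -/

/-- Evaluation of `u f` at the point whose linear form is the height. -/
noncomputable def ev (u : W n) : Sym n →ₐ[ℚ] ℚ :=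
  (aeval fun a : Fin n => (n : ℚ) - a).comp (act u.1)

theorem ev_linForm (u : W n) (v : V n) : ev u (linForm v) = hgt n (u.1 v) := by
  rw [ev, AlgHom.comp_apply, act_linForm, linForm, hgt, dotProductBilin_apply_apply, dotProduct]
  simp [mul_comm]

theorem ev_act (u w : W n) (f : Sym n) : ev u (act w.1 f) = ev (u * w) f := by
  rw [ev, ev, AlgHom.comp_apply, AlgHom.comp_apply, ← act_mul]; rfl

theorem ev_dd (u : W n) (i : Fin n) (f : Sym n) :
    hgt n (u.1 (simpleRoot n i)) * ev u (dd i f) = ev u f - ev (u * sFin n i) f := by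
  rw [← ev_linForm, ← map_mul, mul_dd, map_sub, ← ev_act]; rfl

/-- Dedekind's independence of characters. The characters are distinct because the heights of the
vectors `u ε_i` determine `u`. -/
theorem linearIndependent_ev : LinearIndependent ℚ fun (u : W n) (f : Sym n) => ev u f := by
  refine (linearIndependent_monoidHom (Sym n) ℚ).comp
    (fun u : W n => ((ev u : Sym n →ₐ[ℚ] ℚ) : Sym n →* ℚ)) fun u w h => ?_
  refine W_ext_wt fun i h1 h2 => ?_
  have := DFunLike.congr_fun h (linForm (ε n i))
  simp only [MonoidHom.coe_coe, ev_linForm] at this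
  rw [wt_cast u h1 h2, wt_cast w h1 h2] at this
  exact_mod_cast this

theorem inv_sFin_mul_le (i : Fin n) (w : W n) : inv (sFin n i * w) ≤ inv w + 1 := by
  rcases hgt_W_simpleRoot_cases w⁻¹ i with h | h
  · rw [inv_sFin_mul h]
  · have := inv_sFin_mul' h; omega

/-- Evaluating `∂_i f` at `u` divides the difference of the values of `f` at `u` and `u s_i` by the
height of `u α_i`. Iterating gives a combination of evaluations, triangular with respect to length;
its leading coefficient is a sign over a product of heights of roots. Only that coefficient is
needed later, for the longest element. -/
theorem ev_D_expansion {L : List (Fin n)} (hL : Reduced L) (u : W n) :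
    ∃ c : W n → ℚ, (∀ f, ev u (D L f) = ∑ v, c v * ev v f) ∧
      c (u * wprod L) * ∏ β ∈ Inv (wprod L)⁻¹, hgt n (u.1 β) = (-1) ^ L.length ∧
      ∀ v, c (u * v) ≠ 0 → v = wprod L ∨ inv v < L.length := by
  classical
  induction L generalizing u with
  | nil =>
    have h0 : Inv (1 : W n) = ∅ := Finset.card_eq_zero.1 inv_one
    refine ⟨fun v => if v = u then 1 else 0, fun f => ?_, ?_, fun v hv => ?_⟩
    · simp [D_nil]
    · rw [wprod_nil, _root_.inv_one, h0]; simp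
    · left
      by_contra h
      exact hv (if_neg fun h' => h (by rw [wprod_nil]; exact mul_eq_left.1 h'))
  | cons i L ih =>
    obtain ⟨hr, hpos⟩ := hL.of_cons
    obtain ⟨c₁, h11, -, h13⟩ := ih hr u
    obtain ⟨c₂, h21, h22, h23⟩ := ih hr (u * sFin n i)
    have hne := hgt_W_ne_zero u (isRoot_simpleRoot i)
    refine ⟨fun v => (c₁ v - c₂ v) / hgt n (u.1 (simpleRoot n i)), fun f => ?_, ?_,
      fun v hv => ?_⟩
    · apply mul_left_cancel₀ hne
      rw [D_cons, ev_dd, h11, h21, ← Finset.sum_sub_distrib, Finset.mul_sum]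
      refine Finset.sum_congr rfl fun v _ => ?_
      field_simp
    -- The evaluations in the expansion at `u` are too short to reach `u * wprod (i :: L)`, so the
    -- leading coefficient comes entirely from the expansion at `u s_i`.
    · have h0 : c₁ (u * wprod (i :: L)) = 0 := by
        by_contra h
        have h5 : inv (wprod (i :: L)) = L.length + 1 := hL
        have h6 : inv (wprod L) = L.length := hr
        rcases h13 _ h with h | h
        · rw [h] at h5; omega
        · omega
      have h7 : Inv (wprod (i :: L))⁻¹ =
          insert (simpleRoot n i) ((Inv (wprod L)⁻¹).image (sFin n i).1) := by
        rw [wprod_cons, mul_inv_rev, sFin_inv, Inv_mul_sFin hpos]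
      have h8 : simpleRoot n i ∉ (Inv (wprod L)⁻¹).image (sFin n i).1 := by
        rw [Finset.mem_image]
        rintro ⟨β, hβ, h⟩
        have h9 := hgt_pos (mem_Inv.1 hβ).1
        rw [← sFin_apply_twice i β, h, sFin_simpleRoot, map_neg, hgt_simpleRoot] at h9
        norm_num at h9
      beta_reduce
      rw [h0, h7, Finset.prod_insert h8, Finset.prod_image fun x _ y _ h => (sFin n i).1.injective h,
        List.length_cons, pow_succ, ← h22, wprod_cons, mul_assoc u]
      simp only [mul_coe_apply]
      field_simp
      ring
    · have h : c₁ (u * v) ≠ 0 ∨ c₂ (u * v) ≠ 0 := by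
        by_contra! h
        exact hv (by simp [h.1, h.2])
      have h6 : inv (wprod L) = L.length := hr
      rw [List.length_cons]
      rcases h with h | h
      · right
        rcases h13 v h with h | h
        · rw [h]; omega
        · omega
      · have h' : u * v = u * sFin n i * (sFin n i * v) := by
          rw [mul_assoc, ← mul_assoc (sFin n i), sFin_mul_self, one_mul]
        rw [h'] at h
        have h9 : sFin n i * (sFin n i * v) = v := by rw [← mul_assoc, sFin_mul_self, one_mul]
        rcases h23 _ h with h | h
        · left; rw [wprod_cons, ← h, h9]
        · right
          have := inv_sFin_mul_le i (sFin n i * v)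
          rw [h9] at this; omega

/-- The product of the positive roots. -/
noncomputable def Δ (n : ℕ) : Sym n := ∏ β ∈ posRoots n, linForm β

/-- `s_i` permutes the positive roots other than `α_i` and negates `α_i`. -/
theorem act_Δ (i : Fin n) : act (sFin n i).1 (Δ n) = - Δ n := by
  have h1 := Finset.insert_erase (simpleRoot_mem i)
  have h2 := Finset.notMem_erase (simpleRoot n i) (posRoots n)
  have h3 : ∀ β ∈ (posRoots n).erase (simpleRoot n i),
      (sFin n i).1 β ∈ (posRoots n).erase (simpleRoot n i) := by
    intro β hβ
    obtain ⟨h4, h5⟩ := Finset.mem_erase.1 hβ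
    refine Finset.mem_erase.2 ⟨fun h => ?_, sFin_mem_posRoots i h5 h4⟩
    have h9 := hgt_pos h5
    rw [← sFin_apply_twice i β, h, sFin_simpleRoot, map_neg, hgt_simpleRoot] at h9
    norm_num at h9
  rw [Δ, ← h1, Finset.prod_insert h2, map_mul, act_linForm, sFin_simpleRoot, linForm_neg, neg_mul,
    map_prod]
  congr 2
  refine Finset.prod_nbij' (sFin n i).1 (sFin n i).1 h3 h3 (fun β _ => sFin_apply_twice i β)
    (fun β _ => sFin_apply_twice i β) fun β _ => act_linForm _ _

theorem inv_sFin (i : Fin n) : inv (sFin n i) = 1 := by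
  rw [← mul_one (sFin n i), inv_sFin_mul, inv_one]
  rw [_root_.inv_one, one_coe_apply, hgt_simpleRoot]; exact one_pos

/-- A reduced word of `w₀` can be chosen to end in `i`, and `∂_i s_i = -∂_i`. -/
theorem DW_longest_act (i : Fin n) (f : Sym n) :
    DW (longest n) (act (sFin n i).1 f) = - DW (longest n) f := by
  have h : longest n = longest n * sFin n i * sFin n i := by
    rw [mul_assoc, sFin_mul_self, mul_one]
  have h1 : hgt n ((longest n).1 (simpleRoot n i)) < 0 := by
    rw [longest_apply, map_neg, hgt_simpleRoot]; norm_num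
  have h2 := inv_mul_sFin' h1
  have h3 : ∀ f, DW (longest n) f = DW (longest n * sFin n i) (dd i f) := by
    intro f
    rw [dd_eq_DW, DW_mul_of_inv_add, ← h]
    rw [← h, inv_sFin, h2]
  rw [h3, h3 f, ← map_neg]
  congr 1
  exact dd_act i f

theorem Δ_mem_homog : Δ n ∈ homog n (n * n) := by
  rw [← card_posRoots]; exact prod_mem_homog _ _

theorem DW_mem_homog (w : W n) {d : ℕ} {f : Sym n} (hf : f ∈ homog n (d + inv w)) :
    DW w f ∈ homog n d := by
  refine D_mem_homog _ ?_
  rwa [(reducedWord_spec w).2]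

theorem ev_C (u : W n) (c : ℚ) : ev u (C c) = c := by
  simp [ev]

/-- Write the value at `1` of `∂_{w₀} f` as `∑ c_v ev_v f`. The coefficients `c_v` are antisymmetric
because `∂_{w₀}` is, and so are the values `ev_v Δ`; hence all `|W|` summands for `f = Δ` are equal.
The leading coefficient shows that each is `1`. Finally `∂_{w₀} Δ` has degree `0`, so it is a
constant and one value determines it. -/
theorem DW_longest_Δ : DW (longest n) (Δ n) = C (Nat.card (W n) : ℚ) := by
  have hr := reduced_reducedWord (longest n)
  obtain ⟨h1, h2⟩ := reducedWord_spec (longest n)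
  obtain ⟨c, hc1, hc2, -⟩ := ev_D_expansion hr 1
  rw [h1, one_mul, longest_inv, h2, inv_longest, Inv_longest] at hc2
  have hneg : ∀ i v, c (v * sFin n i) = - c v := by
    intro i
    have h3 : ∀ f, ∑ v, (c (v * sFin n i) + c v) * ev v f = 0 := by
      intro f
      have h4 := congrArg (ev 1) (DW_longest_act i f)
      rw [map_neg] at h4
      change ev 1 (D _ _) = - ev 1 (D _ _) at h4
      rw [hc1, hc1] at h4
      have h5 : ∑ v, c v * ev v (act (sFin n i).1 f) = ∑ v, c (v * sFin n i) * ev v f := by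
        refine Fintype.sum_equiv (Equiv.mulRight (sFin n i)) _ _ fun v => ?_
        rw [Equiv.coe_mulRight, mul_assoc, sFin_mul_self, mul_one, ev_act]
      rw [h5] at h4
      simp only [add_mul, Finset.sum_add_distrib, h4, neg_add_cancel]
    -- Independence of the evaluations turns antisymmetry of the operator into antisymmetry of its
    -- coefficients.
    have h6 := Fintype.linearIndependent_iff.1 (linearIndependent_ev (n := n))
      (fun v => c (v * sFin n i) + c v) (funext fun f => by
        simpa [Finset.sum_apply] using h3 f)
    intro v
    linarith [h6 v]
  have hconst : ∀ v, c v * ev v (Δ n) = c 1 * ev 1 (Δ n) := by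
    have : ∀ v, c v⁻¹ * ev v⁻¹ (Δ n) = c 1 * ev 1 (Δ n) := by
      intro v
      induction v using W_induction with
      | h1 => rw [_root_.inv_one]
      | hs i w ih =>
        rw [mul_inv_rev, sFin_inv, hneg, ← ev_act, act_Δ, map_neg, neg_mul_neg, ih]
    intro v
    have := this v⁻¹
    rwa [inv_inv] at this
  -- The common summand is computed at `w₀ = -1`, where the `n * n` signs of the roots cancel the
  -- sign of the leading coefficient.
  have hone : c 1 * ev 1 (Δ n) = 1 := by
    rw [← hconst (longest n), Δ, map_prod]
    simp only [ev_linForm, longest_apply, map_neg, Finset.prod_neg, card_posRoots]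
    simp only [one_coe_apply] at hc2
    rw [mul_left_comm, hc2, ← mul_pow]; norm_num
  have hval : ev 1 (DW (longest n) (Δ n)) = (Nat.card (W n) : ℚ) := by
    change ev 1 (D _ _) = _
    rw [hc1]
    simp only [hconst, hone]
    simp [Nat.card_eq_fintype_card]
  have h0 : DW (longest n) (Δ n) ∈ homog n 0 := by
    refine DW_mem_homog _ ?_
    rw [inv_longest, zero_add]; exact Δ_mem_homog
  have h7 := eq_C_of_mem_homog_zero h0
  rw [h7, ev_C] at hval
  rw [h7, hval]

theorem topPoly_eq : topPoly n = (1 / (Nat.card (W n) : ℚ)) • Δ n := by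
  rw [topPoly, MvPolynomial.smul_eq_C_mul]
  congr 1
  have h0 : Δ n = ∏ a : Fin n, ∏ b : Fin n, linForm (rt n (a + 1) (b + 1)) := by
    rw [Δ, posRoots, Finset.prod_image rt_injOn, Finset.prod_product]
    have h : ∀ F : ℕ → Sym n, ∏ p ∈ Finset.Icc 1 n, F p = ∏ a : Fin n, F (a + 1) := by
      intro F
      rw [← Finset.prod_range fun i => F (i + 1), Finset.range_eq_Ico,
        Finset.prod_Ico_add' F 0 n 1, zero_add]
      rfl
    rw [h]
    exact Finset.prod_congr rfl fun a _ => h _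
  have h1 : ∀ a b : Fin n, linForm (rt n (a + 1) (b + 1)) =
      (if a = b then X a else 1) * ((if a < b then X a - X b else 1) *
        (if b < a then X b + X a else 1)) := by
    intro a b
    rw [rt]
    rcases lt_trichotomy a b with h | h | h
    · rw [if_pos (by simpa using h), if_neg h.ne, if_pos h, if_neg h.not_gt, linForm_sub, ε_succ,
        ε_succ, linForm_single, linForm_single]; ring
    · subst h; simp [ε_succ, linForm_single]
    · rw [if_neg (by simpa using h.le), if_pos (by simpa using h), if_neg h.ne', if_neg h.not_gt,
        if_pos h, linForm_add, ε_succ, ε_succ, linForm_single, linForm_single]; ring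
  simp only [h0, h1, Finset.prod_mul_distrib]
  congr 1
  · simp
  · congr 1
    · refine Finset.prod_congr rfl fun a _ => ?_
      rw [← Finset.prod_filter]; congr 1; ext b; simp
    · rw [Finset.prod_comm]
      refine Finset.prod_congr rfl fun a _ => ?_
      rw [← Finset.prod_filter]; congr 1; ext b; simp

theorem topPoly_mem_homog : topPoly n ∈ homog n (n * n) := by
  rw [topPoly_eq]; exact Submodule.smul_mem _ _ Δ_mem_homog

theorem DW_longest_topPoly : DW (longest n) (topPoly n) = 1 := by
  have h : (Nat.card (W n) : ℚ) ≠ 0 := Nat.cast_ne_zero.2 Nat.card_pos.ne'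
  rw [topPoly_eq, map_smul, DW_longest_Δ, MvPolynomial.smul_eq_C_mul, ← C_mul,
    one_div_mul_cancel h, C_1]

end TypeB

/-! ### The coinvariant ring, its Schubert basis and Chevalley's formula. -/

namespace TypeB

open MvPolynomial

variable {n : ℕ}

/-! ### The Schubert basis -/

/-- The coefficient of `σ^w` in the class of a polynomial. -/
noncomputable def coef (w : W n) : Sym n →ₗ[ℚ] ℚ :=
  (MvPolynomial.aeval (R := ℚ) (0 : Fin n → ℚ)).toLinearMap ∘ₗ DW w

theorem coef_apply (w : W n) (f : Sym n) : coef w f = constantCoeff (DW w f) := by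
  rw [coef, LinearMap.comp_apply, AlgHom.toLinearMap_apply, MvPolynomial.aeval_zero]
  simp

theorem coef_one (f : Sym n) : coef 1 f = constantCoeff f := by
  rw [coef_apply, DW_one]; rfl

/-- An invariant generator passes through `∂_w`, and then its constant term, which is zero, is a
factor. -/
theorem coef_mul_of_mem_coinvIdeal {f : Sym n} (hf : f ∈ coinvIdeal n) (w : W n) (g : Sym n) :
    coef w (g * f) = 0 := by
  induction hf using Submodule.span_induction generalizing g with
  | mem f hf => rw [coef_apply, DW, D_mul_of_invariant hf.1, map_mul, hf.2, mul_zero]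
  | zero => rw [mul_zero, map_zero]
  | add x y _ _ hx hy => rw [mul_add, map_add, hx, hy, add_zero]
  | smul a x _ hx => rw [smul_eq_mul, ← mul_assoc, hx]

theorem coef_of_mem_coinvIdeal {f : Sym n} (hf : f ∈ coinvIdeal n) (w : W n) : coef w f = 0 := by
  have := coef_mul_of_mem_coinvIdeal hf w 1
  rwa [one_mul] at this

theorem act_mem_coinvIdeal (w : W n) {f : Sym n} (hf : f ∈ coinvIdeal n) :
    act w.1 f ∈ coinvIdeal n := by
  induction hf using Submodule.span_induction with
  | mem f hf => rw [hf.1 _ w.2]; exact Ideal.subset_span hf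
  | zero => rw [map_zero]; exact Ideal.zero_mem _
  | add x y _ _ hx hy => rw [map_add]; exact Ideal.add_mem _ hx hy
  | smul a x _ hx => rw [smul_eq_mul, map_mul]; exact Ideal.mul_mem_left _ _ hx

/-- Since `f - s_i w f = α_i ∂_i f + s_i (f - w f)`, every `f - w f` lies in the ideal. Hence `f` is
congruent to its average over `W`, an invariant without constant term. -/
theorem mem_coinvIdeal_of_dd_mem {f : Sym n} (h : ∀ i, dd i f ∈ coinvIdeal n)
    (h0 : constantCoeff f = 0) : f ∈ coinvIdeal n := by
  have h1 : ∀ w : W n, f - act w.1 f ∈ coinvIdeal n := by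
    intro w
    induction w using W_induction with
    | h1 =>
      have : act (1 : W n).1 f = f := act_one f
      rw [this, sub_self]; exact Ideal.zero_mem _
    | hs i w ih =>
      have h2 : f - act (sFin n i * w).1 f =
          linForm (simpleRoot n i) * dd i f + act (sFin n i).1 (f - act w.1 f) := by
        rw [mul_dd, map_sub, ← act_mul]
        change _ = f - act (sFin n i).1 f + (act (sFin n i).1 f - act (sFin n i * w).1 f)
        abel
      rw [h2]
      exact Ideal.add_mem _ (Ideal.mul_mem_left _ _ (h i)) (act_mem_coinvIdeal _ ih)
  have hcard : (Nat.card (W n) : ℚ) ≠ 0 := Nat.cast_ne_zero.2 Nat.card_pos.ne'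
  have h2 : ∑ w : W n, act w.1 f ∈ coinvIdeal n := by
    refine Ideal.subset_span ⟨fun u hu => ?_, ?_⟩
    · rw [map_sum]
      refine Fintype.sum_equiv (Equiv.mulLeft (⟨u, hu⟩ : W n)) _ _ fun w => ?_
      rw [← act_mul]; rfl
    · rw [map_sum]
      exact Finset.sum_eq_zero fun w _ => by rw [constantCoeff_act, h0]
  have h3 : ∑ w : W n, (f - act w.1 f) ∈ coinvIdeal n := Ideal.sum_mem _ fun w _ => h1 w
  have h4 := Ideal.add_mem _ h3 h2
  rw [← Finset.sum_add_distrib] at h4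
  simp only [sub_add_cancel, Finset.sum_const, Finset.card_univ, ← Nat.card_eq_fintype_card] at h4
  have h5 : f = C (Nat.card (W n) : ℚ)⁻¹ * (Nat.card (W n) • f) := by
    rw [← MvPolynomial.smul_eq_C_mul, ← Nat.cast_smul_eq_nsmul ℚ, smul_smul,
      inv_mul_cancel₀ hcard, one_smul]
  rw [h5]
  exact Ideal.mul_mem_left _ _ h4

theorem coef_dd (w : W n) (i : Fin n) (f : Sym n) :
    coef w (dd i f) = coef (w * sFin n i) f ∨ coef w (dd i f) = 0 := by
  simp only [coef_apply, dd_eq_DW]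
  by_cases h : inv (w * sFin n i) = inv w + inv (sFin n i)
  · left; rw [DW_mul_of_inv_add h]
  · right; rw [DW_mul_of_ne h, map_zero]

/-- Induction on the length from which all words kill `f`. Applying `∂_i` lowers this bound by one,
and the coefficients of `∂_i f` are coefficients of `f` or zero. -/
theorem mem_coinvIdeal_of_D_eq_zero (d : ℕ) {f : Sym n}
    (h : ∀ L : List (Fin n), d ≤ L.length → D L f = 0) (h0 : ∀ w, coef w f = 0) :
    f ∈ coinvIdeal n := by
  induction d generalizing f with
  | zero =>
    have := h [] le_rfl
    rw [D_nil] at this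
    rw [this]; exact Ideal.zero_mem _
  | succ d ih =>
    refine mem_coinvIdeal_of_dd_mem (fun i => ih (fun L hL => ?_) fun w => ?_) ?_
    · have := h (L ++ [i]) (by simpa using hL)
      rwa [D_append, D_cons, D_nil] at this
    · rcases coef_dd w i f with h1 | h1
      · rw [h1, h0]
      · exact h1
    · rw [← coef_one, h0]

/-- Words with more than `n * n` letters cannot be reduced, so they kill everything and the
preceding induction can start. -/
theorem mem_coinvIdeal_iff {f : Sym n} : f ∈ coinvIdeal n ↔ ∀ w, coef w f = 0 := by
  refine ⟨fun h w => coef_of_mem_coinvIdeal h w, fun h => ?_⟩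
  refine mem_coinvIdeal_of_D_eq_zero (n * n + 1) (fun L hL => ?_) h
  rw [D_eq_zero]; · rfl
  intro hr
  have := inv_le (wprod L)
  rw [hr] at this; omega

/-- A polynomial that represents the Schubert class of `w`. -/
noncomputable def schubertPoly (w : W n) : Sym n := DW (w⁻¹ * longest n) (topPoly n)

theorem schubert_eq (w : W n) :
    schubert w = Ideal.Quotient.mk (coinvIdeal n) (schubertPoly w) := by
  rw [schubert, divDiffW_eq]; rfl

/-- If lengths add, `∂_u ∂_{w⁻¹w₀}` is `∂_{u w⁻¹ w₀}`. Applied to the point class, of degree `n *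
n`, it leaves positive degree unless `u w⁻¹ w₀ = w₀`, that is `u = w`. If lengths do not add, the
operator is zero, and then `u ≠ w`. -/
theorem coef_schubertPoly (u w : W n) :
    coef u (schubertPoly w) = open Classical in if u = w then 1 else 0 := by
  have h1 := inv_mul_longest_add w⁻¹
  rw [inv_inverse] at h1
  rw [coef_apply, schubertPoly]
  by_cases h : inv (u * (w⁻¹ * longest n)) = inv u + inv (w⁻¹ * longest n)
  · rw [DW_mul_of_inv_add h]
    by_cases h2 : inv (u * (w⁻¹ * longest n)) = n * n
    · have h3 := eq_longest h2
      rw [← mul_assoc, mul_eq_right, mul_inv_eq_one] at h3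
      rw [if_pos h3, h3, mul_inv_cancel_left, DW_longest_topPoly, map_one]
    · have h3 := inv_le (u * (w⁻¹ * longest n))
      rw [if_neg]
      · refine constantCoeff_of_mem_homog (d := n * n - inv (u * (w⁻¹ * longest n))) (by omega)
          (DW_mem_homog _ ?_)
        rw [Nat.sub_add_cancel h3]; exact topPoly_mem_homog
      · rintro rfl
        exact h2 (by rw [mul_inv_cancel_left, inv_longest])
  · rw [DW_mul_of_ne h, map_zero, if_neg]
    rintro rfl
    rw [mul_inv_cancel_left, inv_longest] at h
    omega

theorem mk_eq_sum (f : Sym n) :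
    Ideal.Quotient.mk (coinvIdeal n) f = ∑ w : W n, coef w f • schubert w := by
  have h : f - ∑ w : W n, coef w f • schubertPoly w ∈ coinvIdeal n := by
    refine mem_coinvIdeal_iff.2 fun u => ?_
    simp [coef_schubertPoly]
  rw [← Ideal.Quotient.eq] at h
  rw [h, ← Ideal.Quotient.mkₐ_eq_mk ℚ, map_sum]
  simp only [map_smul, schubert_eq]
  rfl

theorem linearIndependent_schubert : LinearIndependent ℚ (schubert (n := n)) := by
  rw [Fintype.linearIndependent_iff]
  intro g hg u
  have h : ∑ w : W n, g w • schubertPoly w ∈ coinvIdeal n := by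
    rw [← Ideal.Quotient.eq_zero_iff_mem, ← hg, ← Ideal.Quotient.mkₐ_eq_mk ℚ, map_sum]
    simp only [map_smul, schubert_eq]
    rfl
  have := coef_of_mem_coinvIdeal h u
  simpa [coef_schubertPoly] using this

theorem span_schubert : ⊤ ≤ Submodule.span ℚ (Set.range (schubert (n := n))) := by
  intro x _
  obtain ⟨f, rfl⟩ := Ideal.Quotient.mk_surjective x
  rw [mk_eq_sum]
  exact Submodule.sum_mem _ fun w _ => Submodule.smul_mem _ _ (Submodule.subset_span ⟨w, rfl⟩)

theorem N_eq_coef (u v w : W n) : N u v w = coef w (schubertPoly u * schubertPoly v) := by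
  rw [N, dif_pos ⟨linearIndependent_schubert, span_schubert⟩, schubert_eq, schubert_eq, ← map_mul,
    mk_eq_sum, map_sum, Finsupp.finsetSum_apply, Finset.sum_eq_single w]
  · rw [map_smul, ← Module.Basis.mk_apply linearIndependent_schubert span_schubert,
      Module.Basis.repr_self]
    simp
  · intro u _ hu
    rw [map_smul, ← Module.Basis.mk_apply linearIndependent_schubert span_schubert,
      Module.Basis.repr_self]
    simp [hu]
  · intro h; exact absurd (Finset.mem_univ _) h

/-! ### The Chevalley formula -/

theorem dot_rt {i p q : ℕ} (h1 : 1 ≤ i) (h2 : i ≤ n) :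
    ε n i ⬝ᵥ rt n p q = (if i = p then 1 else 0) +
      (if p < q then -1 else if q < p then 1 else 0) * (if i = q then 1 else 0) := by
  rw [rt]
  by_cases h5 : p < q
  · simp only [if_pos h5, dotProduct_sub, dot_ε h1 h2]; ring
  · by_cases h6 : q < p
    · simp only [if_neg h5, if_pos h6, dotProduct_add, dot_ε h1 h2]; ring
    · simp only [if_neg h5, if_neg h6, dot_ε h1 h2]; ring

/-- Equal reflections give `γ = c γ'`, and `c > 0` by heights. For `γ' = rt n p' q'` the coordinate
of `γ'` at `p'` is `1`, so `c` is a coordinate of `γ`; these are `0` or `±1`, whence `c = 1`. -/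
theorem eq_of_refl_eq {γ γ' : V n} (h : γ ∈ posRoots n) (h' : γ' ∈ posRoots n)
    (hr : ∀ x, refl γ x = refl γ' x) : γ = γ' := by
  have h0 : γ ⬝ᵥ γ ≠ 0 := by
    rw [Ne, dotProduct_self_eq_zero]
    rintro rfl
    have := hgt_pos h
    rw [map_zero] at this; exact lt_irrefl _ this
  have h1 : cor γ γ = 2 := by rw [cor, mul_div_assoc, div_self h0, mul_one]
  have h2 : γ = (cor γ' γ / 2) • γ' := by
    have := hr γ
    rw [refl, refl, h1, sub_right_inj] at this
    rw [div_eq_inv_mul, ← smul_smul, ← this, smul_smul]; norm_num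
  set c := cor γ' γ / 2
  have hc : 0 < c := by
    have h3 := hgt_pos h
    rw [h2, map_smul, smul_eq_mul] at h3
    exact pos_of_mul_pos_left h3 (hgt_pos h').le
  obtain ⟨p', q', hp1, hp2, hq1, hq2, rfl⟩ := mem_posRoots.1 h'
  obtain ⟨p, q, -, -, -, -, rfl⟩ := mem_posRoots.1 h
  have h4 := congrArg (ε n p' ⬝ᵥ ·) h2
  simp only [dotProduct_smul, dot_rt hp1 hp2, smul_eq_mul] at h4
  suffices c = 1 by rw [h2, this, one_smul]
  have h5 : c = (if p' = p then 1 else 0) +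
      (if p < q then -1 else if q < p then 1 else 0) * (if p' = q then 1 else 0) := by
    rw [h4]
    by_cases h6 : p' = q'
    · subst h6; simp
    · simp [h6]
  split_ifs at h5 <;> first | omega | linarith

theorem simpleRoot_injective : Function.Injective (simpleRoot n) := by
  intro i j h
  have h1 := congrFun h i
  have hi := i.isLt
  have hj := j.isLt
  by_contra hne
  have hne' : (i : ℕ) ≠ j := fun h => hne (Fin.ext h)
  unfold simpleRoot ε at h1
  split_ifs at h1 with h2 h3 h3 <;> simp only [Pi.sub_apply] at h1 <;>
    first | omega | (split_ifs at h1 <;> first | omega | norm_num at h1)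

theorem sFin_injective : Function.Injective (sFin n) := by
  intro i j h
  refine simpleRoot_injective (eq_of_refl_eq (simpleRoot_mem i) (simpleRoot_mem j) fun x => ?_)
  rw [← simpleReflection_eq, ← simpleReflection_eq]
  exact congrArg (fun w : W n => w.1 x) h

/-- The fundamental weight `ω_k = ε_1 + ⋯ + ε_k` for `k < n`. -/
def fundWeight (n k : ℕ) : V n := ∑ j ∈ Finset.Icc 1 k, ε n j

theorem D_linForm_eq_C {L : List (Fin n)} (h : L ≠ []) (v : V n) :
    ∃ c, D L (linForm v) = C c := by
  induction L with
  | nil => exact absurd rfl h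
  | cons i L ih =>
    by_cases hL : L = []
    · subst hL; exact ⟨_, dd_linForm i v⟩
    · obtain ⟨c, hc⟩ := ih hL
      exact ⟨0, by rw [D_cons, hc, dd_C, C_0]⟩

/-- A linear form has no constant term, becomes a constant after one divided difference and vanishes
after two, so only elements of length one contribute. -/
theorem coef_linForm (w : W n) (v : V n) :
    coef w (linForm v) = ∑ i : Fin n, open Classical in
      if w = sFin n i then simpleCoroot n i v else 0 := by
  obtain ⟨L, hL, rfl⟩ := exists_word w
  rw [coef_apply, ← D_eq_DW hL.symm]
  match L, hL with
  | [], hL =>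
    rw [D_nil, Finset.sum_eq_zero]
    · simp [linForm]
    · intro i _
      rw [if_neg]
      intro h
      have := inv_sFin i
      rw [← h, ← hL] at this
      simp at this
  | [i], hL =>
    have h1 : wprod [i] = sFin n i := by simp [wprod]
    rw [D_cons, D_nil, dd_linForm, constantCoeff_C, Finset.sum_eq_single i]
    · rw [if_pos h1]
    · intro j _ hj
      rw [if_neg]
      intro h
      rw [h1] at h
      exact hj (sFin_injective h).symm
    · intro h; exact absurd (Finset.mem_univ _) h
  | i :: j :: L, hL =>
    obtain ⟨c, hc⟩ := D_linForm_eq_C (L := j :: L) (by simp) v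
    rw [D_cons, hc, dd_C, map_zero, Finset.sum_eq_zero]
    intro i' _
    rw [if_neg]
    intro h
    have := inv_sFin i'
    rw [← h, ← hL] at this
    simp at this

theorem simpleCoroot_fundWeight {k : ℕ} (hk : 1 ≤ k) (hkn : k < n) (i : Fin n) :
    simpleCoroot n i (fundWeight n k) = if (i : ℕ) + 1 = k then 1 else 0 := by
  have h1 : simpleCoroot n i (fundWeight n k) =
      ((∑ j ∈ Finset.Icc 1 k, cartan n (i + 1) j : ℤ) : ℚ) := by
    rw [fundWeight, map_sum, Int.cast_sum]
    refine Finset.sum_congr rfl fun j hj => ?_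
    rw [Finset.mem_Icc] at hj
    exact simpleCoroot_ε i hj.1 (by omega)
  rw [h1]
  have hi := i.isLt
  by_cases h2 : (i : ℕ) + 1 < n
  · simp only [cartan, if_pos h2, Finset.sum_sub_distrib, Finset.sum_ite_eq', Finset.mem_Icc]
    split_ifs <;> first | omega | simp
  · simp only [cartan, if_neg h2, ← Finset.mul_sum, Finset.sum_ite_eq', Finset.mem_Icc]
    split_ifs <;> first | omega | simp

/-- Both polynomials have coefficient `1` at `s_k` and `0` elsewhere: for `k < n` the sum `ε_1 + ⋯ +
ε_k` pairs to `1` with the coroot `α_k^∨` and to `0` with the other simple coroots. -/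
theorem schubertPoly_s_sub_mem {k : ℕ} (hk : 1 ≤ k) (hkn : k < n) :
    schubertPoly (s n k) - linForm (fundWeight n k) ∈ coinvIdeal n := by
  refine mem_coinvIdeal_iff.2 fun w => ?_
  have hs : s n k = sFin n ⟨k - 1, by omega⟩ := dif_pos ⟨hk, hkn.le⟩
  rw [map_sub, coef_schubertPoly, coef_linForm, Finset.sum_eq_single ⟨k - 1, by omega⟩, ← hs,
    simpleCoroot_fundWeight hk hkn, if_pos (Nat.sub_add_cancel hk), sub_self]
  · intro i _ hi
    have h0 : (i : ℕ) + 1 ≠ k := fun h => hi (Fin.ext (by simp only; omega))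
    rw [simpleCoroot_fundWeight hk hkn, if_neg h0, ite_self]
  · intro h; exact absurd (Finset.mem_univ _) h

/-- The elements `v` and `w` are joined by the reflection in `γ`, and `v` is one shorter. -/
def Covers (w v : W n) (γ : V n) : Prop :=
  γ ∈ Inv w ∧ (∀ x, v.1 x = w.1 (refl γ x)) ∧ inv v + 1 = inv w

/-- Replace `σ^{s_k}` by `ω_k` and apply the Leibniz rule. The leading term has the factor `w ω_k`,
which has no constant term; in the others duality keeps only those roots with `w s_γ = v`. -/
theorem chevalley {k : ℕ} (hk : 1 ≤ k) (hkn : k < n) (v w : W n) :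
    N (s n k) v w = ∑ γ ∈ Inv w, cor γ (fundWeight n k) *
      open Classical in if Covers w v γ then 1 else 0 := by
  have h1 : schubertPoly (s n k) * schubertPoly v = linForm (fundWeight n k) * schubertPoly v +
      schubertPoly v * (schubertPoly (s n k) - linForm (fundWeight n k)) := by ring
  rw [N_eq_coef, h1, map_add, coef_mul_of_mem_coinvIdeal (schubertPoly_s_sub_mem hk hkn), add_zero,
    coef_apply, DW_linForm_mul, map_add, map_mul, map_sum]
  have h2 : constantCoeff (linForm (w.1 (fundWeight n k))) = 0 := by simp [linForm]
  rw [h2, zero_mul, zero_add]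
  refine Finset.sum_congr rfl fun γ hγ => ?_
  rw [MvPolynomial.smul_eq_C_mul, map_mul, constantCoeff_C, map_sum, Finset.sum_eq_single v]
  · congr 1
    by_cases h : Covers w v γ
    · rw [if_pos h, if_pos h.2, ← coef_apply, coef_schubertPoly, if_pos rfl]
    · rw [if_neg h, if_neg fun h' => h ⟨hγ, h'⟩, map_zero]
  · intro u _ hu
    split_ifs
    · rw [← coef_apply, coef_schubertPoly, if_neg hu]
    · rw [map_zero]
  · intro h; exact absurd (Finset.mem_univ _) h

theorem N_eq_cor {k : ℕ} (hk : 1 ≤ k) (hkn : k < n) {v w : W n} {γ : V n} (h : Covers w v γ) :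
    N (s n k) v w = cor γ (fundWeight n k) := by
  rw [chevalley hk hkn, Finset.sum_eq_single γ]
  · rw [if_pos h, mul_one]
  · intro γ' hγ' hne
    rw [if_neg, mul_zero]
    rintro ⟨-, h1, -⟩
    refine hne (eq_of_refl_eq (mem_Inv.1 hγ').1 (mem_Inv.1 h.1).1 fun x => w.1.injective ?_)
    rw [← h1, ← h.2.1]
  · intro h'; exact absurd h.1 h'

theorem exists_covers {k : ℕ} (hk : 1 ≤ k) (hkn : k < n) {v w : W n} (h : N (s n k) v w ≠ 0) :
    ∃ γ, Covers w v γ ∧ cor γ (fundWeight n k) ≠ 0 := by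
  rw [chevalley hk hkn] at h
  obtain ⟨γ, -, hγ⟩ := Finset.exists_ne_zero_of_sum_ne_zero h
  refine ⟨γ, ?_, left_ne_zero_of_mul hγ⟩
  by_contra hc
  rw [if_neg hc, mul_zero] at hγ
  exact hγ rfl

end TypeB

/-! ### Reflections, inversions and cosets in terms of weights. -/

namespace TypeB

variable {n : ℕ}

/-! ### Reflections in terms of weights -/

theorem refl_single {a i : ℕ} (ha : 1 ≤ a) (ha' : a ≤ n) (hi : 1 ≤ i) (hi' : i ≤ n) :
    refl (ε n a) (ε n i) = if i = a then - ε n a else ε n i := by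
  rw [refl, cor_single ha ha', dot_ε hi hi']
  split_ifs with h
  · rw [h, mul_one, two_smul]; abel
  · simp

theorem refl_sub {a b i : ℕ} (ha : 1 ≤ a) (ha' : a ≤ n) (hb : 1 ≤ b) (hb' : b ≤ n) (hab : a ≠ b)
    (hi : 1 ≤ i) (hi' : i ≤ n) :
    refl (ε n a - ε n b) (ε n i) = if i = a then ε n b else if i = b then ε n a else ε n i := by
  rw [refl, cor_sub ha ha' hb hb' hab, dot_ε hi hi', dot_ε hi hi']
  by_cases h1 : i = a
  · subst h1; simp [hab]
  · by_cases h2 : i = b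
    · subst h2; simp [h1]
    · simp [h1, h2]

theorem refl_add {a b i : ℕ} (ha : 1 ≤ a) (ha' : a ≤ n) (hb : 1 ≤ b) (hb' : b ≤ n) (hab : a ≠ b)
    (hi : 1 ≤ i) (hi' : i ≤ n) :
    refl (ε n a + ε n b) (ε n i) =
      if i = a then - ε n b else if i = b then - ε n a else ε n i := by
  rw [refl, cor_add ha ha' hb hb' hab, dot_ε hi hi', dot_ε hi hi']
  by_cases h1 : i = a
  · subst h1; simp [hab]
  · by_cases h2 : i = b
    · subst h2; simp [h1]
    · simp [h1, h2]

theorem wt_of_W_eq {w u : W n} {i j : ℕ} (h : u.1 (ε n i) = w.1 (ε n j)) : wt u i = wt w j := by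
  rw [wt, h, wt]

theorem wt_of_W_eq_neg {w u : W n} {i j : ℕ} (hj : 1 ≤ j) (hj' : j ≤ n)
    (h : u.1 (ε n i) = w.1 (- ε n j)) : wt u i = - wt w j := by
  rw [wt, h, map_neg, map_neg, wt_cast w hj hj', ← Int.cast_neg, Int.floor_intCast]

theorem wt_refl_single {w u : W n} {a i : ℕ} (ha : 1 ≤ a) (ha' : a ≤ n)
    (h : ∀ x, u.1 x = w.1 (refl (ε n a) x)) (hi : 1 ≤ i) (hi' : i ≤ n) :
    wt u i = if i = a then - wt w a else wt w i := by
  have h1 := h (ε n i)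
  rw [refl_single ha ha' hi hi'] at h1
  split_ifs at h1 ⊢
  · exact wt_of_W_eq_neg ha ha' h1
  · exact wt_of_W_eq h1

theorem wt_refl_sub {w u : W n} {a b i : ℕ} (ha : 1 ≤ a) (ha' : a ≤ n) (hb : 1 ≤ b) (hb' : b ≤ n)
    (hab : a ≠ b) (h : ∀ x, u.1 x = w.1 (refl (ε n a - ε n b) x)) (hi : 1 ≤ i) (hi' : i ≤ n) :
    wt u i = if i = a then wt w b else if i = b then wt w a else wt w i := by
  have h1 := h (ε n i)
  rw [refl_sub ha ha' hb hb' hab hi hi'] at h1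
  split_ifs at h1 ⊢ <;> exact wt_of_W_eq h1

theorem wt_refl_add {w u : W n} {a b i : ℕ} (ha : 1 ≤ a) (ha' : a ≤ n) (hb : 1 ≤ b) (hb' : b ≤ n)
    (hab : a ≠ b) (h : ∀ x, u.1 x = w.1 (refl (ε n a + ε n b) x)) (hi : 1 ≤ i) (hi' : i ≤ n) :
    wt u i = if i = a then - wt w b else if i = b then - wt w a else wt w i := by
  have h1 := h (ε n i)
  rw [refl_add ha ha' hb hb' hab hi hi'] at h1
  split_ifs at h1 ⊢
  · exact wt_of_W_eq_neg hb hb' h1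
  · exact wt_of_W_eq_neg ha ha' h1
  · exact wt_of_W_eq h1

theorem hgt_W_sub (w : W n) {a b : ℕ} (ha : 1 ≤ a) (ha' : a ≤ n) (hb : 1 ≤ b) (hb' : b ≤ n) :
    hgt n (w.1 (ε n a - ε n b)) < 0 ↔ wt w a < wt w b := by
  rw [map_sub, map_sub, wt_cast w ha ha', wt_cast w hb hb', sub_neg, Int.cast_lt]

theorem hgt_W_add (w : W n) {a b : ℕ} (ha : 1 ≤ a) (ha' : a ≤ n) (hb : 1 ≤ b) (hb' : b ≤ n) :
    hgt n (w.1 (ε n a + ε n b)) < 0 ↔ wt w a + wt w b < 0 := by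
  rw [map_add, map_add, wt_cast w ha ha', wt_cast w hb hb', ← Int.cast_add, Int.cast_lt_zero]

theorem hgt_W_single (w : W n) {a : ℕ} (ha : 1 ≤ a) (ha' : a ≤ n) :
    hgt n (w.1 (ε n a)) < 0 ↔ wt w a < 0 := by
  rw [wt_cast w ha ha', Int.cast_lt_zero]

theorem hgt_W_rt (w : W n) {p q : ℕ} (hp : 1 ≤ p) (hp' : p ≤ n) (hq : 1 ≤ q) (hq' : q ≤ n) :
    hgt n (w.1 (rt n p q)) < 0 ↔ (p < q ∧ wt w p < wt w q) ∨ (q < p ∧ wt w p + wt w q < 0) ∨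
      (p = q ∧ wt w p < 0) := by
  rw [rt]
  split_ifs with h1 h2
  · rw [hgt_W_sub w hp hp' hq hq']; omega
  · rw [hgt_W_add w hp hp' hq hq']; omega
  · rw [hgt_W_single w hp hp']; omega

/-- The number of inversions as a sum over pairs of positions. -/
theorem inv_eq_sum (w : W n) :
    inv w = ∑ p ∈ Finset.Icc 1 n, ∑ q ∈ Finset.Icc 1 n,
      if (p < q ∧ wt w p < wt w q) ∨ (q < p ∧ wt w p + wt w q < 0) ∨ (p = q ∧ wt w p < 0)
        then 1 else 0 := by
  rw [inv, Inv, posRoots, Finset.filter_image, Finset.card_image_of_injOn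
    (rt_injOn.mono (Finset.coe_subset.2 (Finset.filter_subset _ _))), Finset.card_filter,
    Finset.sum_product]
  refine Finset.sum_congr rfl fun p hp => Finset.sum_congr rfl fun q hq => ?_
  rw [Finset.mem_Icc] at hp hq
  exact if_congr (hgt_W_rt w hp.1 hp.2 hq.1 hq.2) rfl rfl

theorem fundWeight_dot {k i : ℕ} (hkn : k ≤ n) (hi : 1 ≤ i) :
    fundWeight n k ⬝ᵥ ε n i = if i ≤ k then 1 else 0 := by
  rw [fundWeight, sum_dotProduct, Finset.sum_congr rfl fun j hj => dot_ε (j := i)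
    (Finset.mem_Icc.1 hj).1 ((Finset.mem_Icc.1 hj).2.trans hkn), Finset.sum_ite_eq']
  simp [hi]

/-! ### Weight functions as signed permutations -/

/-- `P` takes each of the values `1, …, n` exactly once on `1, …, n`, up to signs. -/
structure IsSignedPerm (n : ℕ) (P : ℕ → ℤ) : Prop where
  ne_zero : ∀ i, 1 ≤ i → i ≤ n → P i ≠ 0
  natAbs_le : ∀ i, 1 ≤ i → i ≤ n → (P i).natAbs ≤ n
  inj : ∀ i j, 1 ≤ i → i ≤ n → 1 ≤ j → j ≤ n → (P i).natAbs = (P j).natAbs → i = j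

theorem isSignedPerm_wt (w : W n) : IsSignedPerm n (wt w) where
  ne_zero i h1 h2 := (wt_bounds w h1 h2).1
  natAbs_le i h1 h2 := by have := (wt_bounds w h1 h2).2; omega
  inj i j h1 h2 h3 h4 h := by
    by_contra hij
    have := wt_ne w h1 h2 h3 h4 hij
    omega

theorem IsSignedPerm.image {P : ℕ → ℤ} (hP : IsSignedPerm n P) :
    (Finset.Icc 1 n).image (fun p => (P p).natAbs) = Finset.Icc 1 n := by
  refine Finset.eq_of_subset_of_card_le ?_ ?_
  · intro t ht
    obtain ⟨p, hp, rfl⟩ := Finset.mem_image.1 ht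
    rw [Finset.mem_Icc] at hp ⊢
    have := hP.ne_zero p hp.1 hp.2
    have := hP.natAbs_le p hp.1 hp.2
    omega
  · rw [Finset.card_image_of_injOn]
    intro p hp q hq h
    rw [Finset.coe_Icc, Set.mem_Icc] at hp hq
    exact hP.inj p q hp.1 hp.2 hq.1 hq.2 h

theorem IsSignedPerm.surj {P : ℕ → ℤ} (hP : IsSignedPerm n P) {t : ℕ} (h1 : 1 ≤ t) (h2 : t ≤ n) :
    ∃ p, 1 ≤ p ∧ p ≤ n ∧ (P p).natAbs = t := by
  have : t ∈ (Finset.Icc 1 n).image (fun p => (P p).natAbs) := by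
    rw [hP.image, Finset.mem_Icc]; exact ⟨h1, h2⟩
  obtain ⟨p, hp, h⟩ := Finset.mem_image.1 this
  rw [Finset.mem_Icc] at hp
  exact ⟨p, hp.1, hp.2, h⟩

theorem IsSignedPerm.card_le {P : ℕ → ℤ} (hP : IsSignedPerm n P) {t : ℕ} (ht : t ≤ n) :
    ((Finset.Icc 1 n).filter fun p => (P p).natAbs ≤ t).card = t := by
  have h : ((Finset.Icc 1 n).filter fun p => (P p).natAbs ≤ t).image (fun p => (P p).natAbs) =
      Finset.Icc 1 t := by
    ext s
    rw [Finset.mem_image, Finset.mem_Icc]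
    constructor
    · rintro ⟨p, hp, rfl⟩
      rw [Finset.mem_filter, Finset.mem_Icc] at hp
      have := hP.ne_zero p hp.1.1 hp.1.2
      omega
    · rintro ⟨h1, h2⟩
      obtain ⟨p, hp, hp', rfl⟩ := hP.surj h1 (h2.trans ht)
      exact ⟨p, by simp [hp, hp', h2], rfl⟩
  rw [← Finset.card_image_of_injOn (f := fun p => (P p).natAbs), h]
  · simp
  · intro p hp q hq h
    rw [Finset.mem_coe, Finset.mem_filter, Finset.mem_Icc] at hp hq
    exact hP.inj p q hp.1.1 hp.1.2 hq.1.1 hq.1.2 h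

/-! ### Minimal coset representatives -/

/-- `P` decreases on `1, …, K` and on `K + 1, …, n`, and is positive on the latter. -/
structure Sorted (n K : ℕ) (P : ℕ → ℤ) : Prop where
  step : ∀ j, 1 ≤ j → j < n → j ≠ K → P (j + 1) < P j
  last : 0 < P n

theorem Sorted.anti {K : ℕ} {P : ℕ → ℤ} (h : Sorted n K P) {i j : ℕ} (hi : 1 ≤ i) (hij : i < j)
    (hj : j ≤ n) (hK : j ≤ K ∨ K < i) : P j < P i := by
  induction j, hij using Nat.le_induction with
  | base => exact h.step i hi (by omega) (by omega)
  | succ j hij ih =>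
    exact (h.step j (by omega) (by omega) (by omega)).trans (ih (by omega) (by omega))

theorem Sorted.pos {K : ℕ} {P : ℕ → ℤ} (h : Sorted n K P) {i : ℕ} (hi : K < i)
    (hin : i ≤ n) : 0 < P i := by
  rcases hin.lt_or_eq with h1 | h1
  · exact h.last.trans (h.anti (by omega) h1 le_rfl (Or.inr hi))
  · rw [h1]; exact h.last

/-- The set of the first `K` values. -/
def head (K : ℕ) (P : ℕ → ℤ) : Finset ℤ := (Finset.Icc 1 K).image P

theorem mem_head {K : ℕ} {P : ℕ → ℤ} {x : ℤ} :
    x ∈ head K P ↔ ∃ i, 1 ≤ i ∧ i ≤ K ∧ P i = x := by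
  simp only [head, Finset.mem_image, Finset.mem_Icc, and_assoc]

theorem eq_of_anti_of_image {a b : ℕ} {f g : ℕ → ℤ}
    (hf : ∀ i j, a ≤ i → i < j → j ≤ b → f j < f i)
    (hg : ∀ i j, a ≤ i → i < j → j ≤ b → g j < g i)
    (h : ∀ x, (∃ i, a ≤ i ∧ i ≤ b ∧ f i = x) ↔ ∃ i, a ≤ i ∧ i ≤ b ∧ g i = x)
    {i : ℕ} (hi : a ≤ i) (hi' : i ≤ b) : f i = g i := by
  induction i using Nat.strong_induction_on with
  | _ i ih =>
    obtain ⟨j, hj, hj', e⟩ := (h (f i)).1 ⟨i, hi, hi', rfl⟩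
    obtain ⟨l, hl, hl', e'⟩ := (h (g i)).2 ⟨i, hi, hi', rfl⟩
    have h1 : f i ≤ g i := by
      rcases lt_trichotomy j i with h1 | h1 | h1
      · have := ih j h1 hj hj'
        have := hf j i hj h1 hi'
        omega
      · rw [← e, h1]
      · have := hg i j hi h1 hj'
        omega
    have h2 : g i ≤ f i := by
      rcases lt_trichotomy l i with h1 | h1 | h1
      · have := ih l h1 hl hl'
        have := hg l i hl h1 hi'
        omega
      · rw [← e', h1]
      · have := hf i l hi h1 hl'
        omega
    omega

theorem mem_tail_iff {K : ℕ} {P : ℕ → ℤ} (hP : IsSignedPerm n P) (hs : Sorted n K P)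
    (x : ℤ) : (∃ i, K + 1 ≤ i ∧ i ≤ n ∧ P i = x) ↔
      1 ≤ x ∧ x ≤ n ∧ x ∉ head K P ∧ -x ∉ head K P := by
  simp only [mem_head]
  constructor
  · rintro ⟨i, h1, h2, rfl⟩
    have h3 := hs.pos h1 h2
    have h4 := hP.natAbs_le i (by omega) h2
    refine ⟨by omega, by omega, ?_, ?_⟩
    · rintro ⟨j, h5, h6, h7⟩
      have := hP.inj i j (by omega) h2 h5 (by omega) (by omega)
      omega
    · rintro ⟨j, h5, h6, h7⟩
      have := hP.inj i j (by omega) h2 h5 (by omega) (by omega)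
      omega
  · rintro ⟨h1, h2, h3, h4⟩
    obtain ⟨p, hp, hp', h⟩ := hP.surj (t := x.toNat) (by omega) (by omega)
    have h5 : ¬ p ≤ K := by
      intro h6
      rcases Int.natAbs_eq (P p) with h7 | h7
      · exact h3 ⟨p, hp, h6, by omega⟩
      · exact h4 ⟨p, hp, h6, by omega⟩
    have := hs.pos (by omega) hp'
    exact ⟨p, by omega, hp', by omega⟩

/-- The set of head values determines the head, which is decreasing. It also determines the tail,
which lists in decreasing order the numbers in `1, …, n` that do not occur up to sign in the head.
-/
theorem eq_of_sorted {K : ℕ} (hK : K < n) {u v : W n} (hu : Sorted n K (wt u))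
    (hv : Sorted n K (wt v)) (h : head K (wt u) = head K (wt v)) : u = v := by
  refine W_ext_wt fun i hi hi' => ?_
  by_cases hiK : i ≤ K
  · refine eq_of_anti_of_image (a := 1) (b := K) (fun i j h1 h2 h3 => ?_)
      (fun i j h1 h2 h3 => ?_) (fun x => ?_) hi hiK
    · exact hu.anti h1 h2 (by omega) (Or.inl h3)
    · exact hv.anti h1 h2 (by omega) (Or.inl h3)
    · rw [← mem_head, h, mem_head]
  · refine eq_of_anti_of_image (a := K + 1) (b := n) (fun i j h1 h2 h3 => ?_)
      (fun i j h1 h2 h3 => ?_) (fun x => ?_) (by omega) hi'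
    · exact hu.anti (by omega) h2 h3 (Or.inr h1)
    · exact hv.anti (by omega) h2 h3 (Or.inr h1)
    · rw [mem_tail_iff (isSignedPerm_wt u) hu, mem_tail_iff (isSignedPerm_wt v) hv, h]

theorem wt_mul_sFin_of_lt (u : W n) {j : ℕ} (h1 : 1 ≤ j) (h2 : j < n) {i : ℕ} (hi : 1 ≤ i)
    (hi' : i ≤ n) : wt (u * sFin n ⟨j - 1, by omega⟩) i =
      if i = j then wt u (j + 1) else if i = j + 1 then wt u j else wt u i := by
  refine wt_refl_sub h1 h2.le (by omega) (by omega) (by omega) (fun x => ?_) hi hi'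
  rw [← simpleRoot_of_lt h1 h2, ← simpleReflection_eq]; rfl

theorem wt_mul_sFin_last (u : W n) (h : 1 ≤ n) {i : ℕ} (hi : 1 ≤ i)
    (hi' : i ≤ n) : wt (u * sFin n ⟨n - 1, by omega⟩) i =
      if i = n then - wt u n else wt u i := by
  refine wt_refl_single h le_rfl (fun x => ?_) hi hi'
  rw [← simpleRoot_last h, ← simpleReflection_eq]; rfl

/-- Elements with the same set of head values form a coset of the parabolic subgroup. Sorting by
simple reflections other than `s_K` shortens an element within its coset until it is sorted, so the
sorted element is the unique shortest one. -/
theorem inv_le_of_head_eq {K : ℕ} (hK : K < n) {v : W n} (hv : Sorted n K (wt v)) (u : W n)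
    (h : head K (wt u) = head K (wt v)) : inv v ≤ inv u ∧ (inv u ≤ inv v → u = v) := by
  induction hd : inv u using Nat.strong_induction_on generalizing u with
  | _ d ih =>
    by_cases hu : Sorted n K (wt u)
    · have := eq_of_sorted hK hu hv h
      subst this
      exact ⟨by omega, fun _ => rfl⟩
    -- A failure of sortedness is either a negative last entry, cured by `s_n`, or an ascent at some
    -- `j ≠ K`, cured by `s_j`. Both leave the set of head values alone.
    · suffices ∃ u', inv u = inv u' + 1 ∧ head K (wt u') = head K (wt u) by
        obtain ⟨u', h1, h2⟩ := this
        have := (ih (inv u') (by omega) u' (h2.trans h) rfl).1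
        exact ⟨by omega, by omega⟩
      by_cases h1 : ∀ j, 1 ≤ j → j < n → j ≠ K → wt u (j + 1) < wt u j
      · have h2 : ¬ 0 < wt u n := fun h2 => hu ⟨h1, h2⟩
        have h3 := (wt_bounds u (i := n) (by omega) le_rfl).1
        refine ⟨u * sFin n ⟨n - 1, by omega⟩, inv_mul_sFin' ?_, ?_⟩
        · rw [hgt_W_simpleRoot_last u (by omega), Int.cast_lt_zero]; omega
        · refine Finset.image_congr fun i hi => ?_
          rw [Finset.coe_Icc, Set.mem_Icc] at hi
          rw [wt_mul_sFin_last u (by omega) hi.1 (by omega), if_neg (by omega)]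
      · push Not at h1
        obtain ⟨j, hj1, hj2, hj3, hj4⟩ := h1
        have h3 := (wt_ne u (i := j) (j := j + 1) hj1 (by omega) (by omega) (by omega)
          (by omega)).1
        refine ⟨u * sFin n ⟨j - 1, by omega⟩, inv_mul_sFin' ?_, ?_⟩
        · rw [hgt_W_simpleRoot_of_lt u hj1 hj2, Int.cast_lt_zero]; omega
        · have h5 := fun i h1 h2 => wt_mul_sFin_of_lt u hj1 hj2 (i := i) h1 h2
          ext x
          rw [mem_head, mem_head]
          constructor
          · rintro ⟨i, h6, h7, rfl⟩
            refine ⟨if i = j then j + 1 else if i = j + 1 then j else i, ?_, ?_, ?_⟩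
            · split_ifs <;> omega
            · split_ifs <;> omega
            · rw [h5 i h6 (by omega)]; split_ifs <;> rfl
          · rintro ⟨i, h6, h7, rfl⟩
            refine ⟨if i = j then j + 1 else if i = j + 1 then j else i, ?_, ?_, ?_⟩
            · split_ifs <;> omega
            · split_ifs <;> omega
            · rw [h5 _ (by split_ifs <;> omega) (by split_ifs <;> omega)]
              split_ifs <;> first | omega | (congr 1; omega)

end TypeB

/-! ### Shapes read from weights, and length as a number of boxes. -/

namespace TypeB

variable {n K : ℕ}

/-! ### Shapes and weight functions -/

/-- The number of parts of `μ^b` that exceed `t`. -/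
def cnt (μ : Shape n K) (t : ℤ) : ℕ := ((Finset.Icc 1 K).filter fun j => t < μ.bot j).card

/-- `P` is the weight function of the minimal length representative of the shape `μ`. -/
structure Std (P : ℕ → ℤ) (μ : Shape n K) : Prop where
  perm : IsSignedPerm n P
  sorted : Sorted n K P
  pos : ∀ i, 1 ≤ i → i ≤ K - μ.len → 0 < P i
  bot : ∀ j, 1 ≤ j → j ≤ μ.len → P (K + 1 - j) = - μ.bot j
  top : ∀ r, 1 ≤ r → r ≤ n - K → (μ.top r : ℤ) = P (K + r) + cnt μ (P (K + r))

/-- A descent at `j ≠ K` would make `w s_j` a shorter element of the same coset. -/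
theorem sorted_of_mem_minReps (hK : K < n) {w : W n} (hw : w ∈ minReps n K) :
    Sorted n K (wt w) := by
  have h : ∀ j (h1 : 1 ≤ j) (h2 : j ≤ n), j ≠ K →
      0 < hgt n (w.1 (simpleRoot n ⟨j - 1, by omega⟩)) := by
    intro j h1 h2 h3
    refine (hgt_W_simpleRoot_cases _ _).resolve_right fun h4 => ?_
    have h5 := hw (s n j) (Subgroup.subset_closure ⟨j, h1, h2, h3, rfl⟩)
    have h6 : s n j = sFin n ⟨j - 1, by omega⟩ := dif_pos ⟨h1, h2⟩
    rw [h6, length_eq_inv, length_eq_inv, inv_mul_sFin' h4] at h5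
    omega
  constructor
  · intro j h1 h2 h3
    have := h j h1 h2.le h3
    rw [hgt_W_simpleRoot_of_lt w h1 h2, Int.cast_pos] at this; omega
  · have := h n (by omega) le_rfl (by omega)
    rwa [hgt_W_simpleRoot_last w (by omega), Int.cast_pos] at this

theorem Shape.bot_eq_zero (μ : Shape n K) {j : ℕ} (h : ¬ (1 ≤ j ∧ j ≤ μ.len)) : μ.bot j = 0 := by
  have := μ.bot_pos_iff j
  omega

/-- Weights reverse the order of values, `c ↦ n + 1 - c`, so `z_i < v_r` says that the bottom part
`μ^b_i` exceeds the tail entry `n + 1 - v_r`. -/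
theorem Corresponds.std (hK : K < n) {w : W n} {μ : Shape n K} (h : Corresponds w μ) :
    Std (wt w) μ := by
  obtain ⟨hm, y, z, v, h1, h2, h3⟩ := h
  have hlen := μ.len_le
  refine ⟨isSignedPerm_wt w, sorted_of_mem_minReps hK hm, fun i hi hi' => ?_,
    fun j hj hj' => ?_, fun r hr hr' => ?_⟩
  · obtain ⟨a, b, c⟩ := h1 i hi hi'
    rw [wt_of_eq a b c]; omega
  · obtain ⟨a, b, c, d⟩ := h2 j hj hj'
    rw [wt_of_eq_neg a b c, d]; omega
  · obtain ⟨a, b, c, d⟩ := h3 r hr hr'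
    rw [wt_of_eq a b c, d, cnt]
    have : ((Finset.Icc 1 μ.len).filter fun i => z i < v r) =
        ((Finset.Icc 1 K).filter fun j => (n + 1 - v r : ℤ) < μ.bot j) := by
      ext j
      simp only [Finset.mem_filter, Finset.mem_Icc]
      by_cases hj : 1 ≤ j ∧ j ≤ μ.len
      · obtain ⟨a', b', -, d'⟩ := h2 j hj.1 hj.2
        rw [d']; omega
      · rw [μ.bot_eq_zero hj]; omega
    rw [this]; omega

theorem Std.neg_iff {P : ℕ → ℤ} {μ : Shape n K} (h : Std P μ) {i : ℕ} (h1 : 1 ≤ i) (h2 : i ≤ K) :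
    P i < 0 ↔ K + 1 - i ≤ μ.len := by
  have hlen := μ.len_le
  by_cases h3 : K + 1 - i ≤ μ.len
  · have := h.bot (K + 1 - i) (by omega) h3
    rw [show K + 1 - (K + 1 - i) = i by omega] at this
    have := (μ.bot_pos_iff (K + 1 - i)).2 ⟨by omega, h3⟩
    omega
  · have := h.pos i h1 (by omega)
    omega

theorem Std.bot_of_neg {P : ℕ → ℤ} {μ : Shape n K} (h : Std P μ) {i : ℕ} (h1 : 1 ≤ i)
    (h2 : i ≤ K) (h3 : P i < 0) : P i = - μ.bot (K + 1 - i) := by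
  have := h.bot (K + 1 - i) (by omega) ((h.neg_iff h1 h2).1 h3)
  rwa [show K + 1 - (K + 1 - i) = i by omega] at this

/-- The number of boxes of a shape. -/
def size (μ : Shape n K) : ℕ := ∑ r ∈ Finset.Icc 1 (n - K), μ.top r + ∑ j ∈ Finset.Icc 1 K, μ.bot j

/-- The indicator that is summed over all pairs of positions in the count of the boxes. -/
def boxes (K : ℕ) (P : ℕ → ℤ) (p q : ℕ) : ℕ :=
  if q ≤ K then (if P q < 0 ∧ (P p).natAbs ≤ (P q).natAbs then 1 else 0)
  else (if (P p).natAbs ≤ (P q).natAbs then 1 else 0) +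
    (if p ≤ K ∧ P p < 0 ∧ P q < (P p).natAbs then 1 else 0)

theorem Std.cnt_eq (hK : K < n) {P : ℕ → ℤ} {μ : Shape n K} (h : Std P μ) {t : ℤ} (ht : 0 ≤ t) :
    cnt μ t = ((Finset.Icc 1 n).filter fun p => p ≤ K ∧ P p < 0 ∧ t < (P p).natAbs).card := by
  refine Finset.card_nbij' (fun j => K + 1 - j) (fun p => K + 1 - p) ?_ ?_ ?_ ?_
  · intro j hj
    rw [Finset.mem_coe, Finset.mem_filter, Finset.mem_Icc] at hj ⊢
    have h1 := (μ.bot_pos_iff j).1 (by omega)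
    have h2 := h.bot j h1.1 h1.2
    beta_reduce
    rw [h2]; omega
  · intro p hp
    rw [Finset.mem_coe, Finset.mem_filter, Finset.mem_Icc] at hp ⊢
    have := h.bot_of_neg hp.1.1 hp.2.1 hp.2.2.1
    beta_reduce
    omega
  · intro j hj
    rw [Finset.mem_coe, Finset.mem_filter, Finset.mem_Icc] at hj
    simp only; omega
  · intro p hp
    rw [Finset.mem_coe, Finset.mem_filter, Finset.mem_Icc] at hp
    simp only; omega

theorem sum_Icc_split (hK : K < n) (F : ℕ → ℕ) :
    ∑ q ∈ Finset.Icc 1 n, F q =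
      ∑ r ∈ Finset.Icc 1 (n - K), F (K + r) + ∑ j ∈ Finset.Icc 1 K, F (K + 1 - j) := by
  have h1 : ∑ r ∈ Finset.Icc 1 (n - K), F (K + r) = ∑ q ∈ Finset.Icc (K + 1) n, F q := by
    refine Finset.sum_nbij' (fun r => K + r) (fun q => q - K) ?_ ?_ ?_ ?_ (fun _ _ => rfl) <;>
      intro x hx <;> simp only [Finset.mem_Icc] at hx ⊢ <;> omega
  have h2 : ∑ j ∈ Finset.Icc 1 K, F (K + 1 - j) = ∑ q ∈ Finset.Icc 1 K, F q := by
    refine Finset.sum_nbij' (fun j => K + 1 - j) (fun j => K + 1 - j) ?_ ?_ ?_ ?_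
      (fun _ _ => rfl) <;>
      intro x hx <;> simp only [Finset.mem_Icc] at hx ⊢ <;> omega
  rw [h1, h2, add_comm, ← Finset.sum_union]
  · congr 1; ext q; simp only [Finset.mem_Icc, Finset.mem_union]; omega
  · rw [Finset.disjoint_left]
    intro q h1 h2
    simp only [Finset.mem_Icc] at h1 h2; omega

/-- In a signed permutation `|P q|` is the number of `p` with `|P p| ≤ |P q|`. This turns each part
into a count of positions, and the size into a sum over pairs that can be compared with the
inversions. -/
theorem Std.size_eq (hK : K < n) {P : ℕ → ℤ} {μ : Shape n K} (h : Std P μ) :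
    size μ = ∑ p ∈ Finset.Icc 1 n, ∑ q ∈ Finset.Icc 1 n, boxes K P p q := by
  rw [Finset.sum_comm, sum_Icc_split hK, size]
  congr 1
  · refine Finset.sum_congr rfl fun r hr => ?_
    rw [Finset.mem_Icc] at hr
    have h1 := h.top r hr.1 hr.2
    have h2 := h.sorted.pos (i := K + r) (by omega) (by omega)
    have h3 := h.perm.card_le (h.perm.natAbs_le (K + r) (by omega) (by omega))
    simp only [boxes, if_neg (show ¬ K + r ≤ K by omega), Finset.sum_add_distrib,
      ← Finset.card_filter]
    rw [h3, ← h.cnt_eq hK h2.le]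
    omega
  · refine Finset.sum_congr rfl fun j hj => ?_
    rw [Finset.mem_Icc] at hj
    simp only [boxes, if_pos (show K + 1 - j ≤ K by omega)]
    have h1 := h.neg_iff (i := K + 1 - j) (by omega) (by omega)
    rw [show K + 1 - (K + 1 - j) = j by omega] at h1
    by_cases h2 : j ≤ μ.len
    · have h3 := h.perm.card_le (h.perm.natAbs_le (K + 1 - j) (by omega) (by omega))
      have h4 := h.bot j hj.1 h2
      simp only [h1.2 h2, true_and, ← Finset.card_filter]
      rw [h3]; omega
    · rw [μ.bot_eq_zero (by omega)]
      refine (Finset.sum_eq_zero fun p _ => if_neg fun h3 => h2 (h1.1 h3.1)).symm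

/-- Boxes and inversions cannot be matched for each ordered pair, only for `(p, q)` and `(q, p)`
together; this accounts for the factor `2`. -/
theorem two_mul_sum_add {s : Finset ℕ} {f g c : ℕ → ℕ → ℕ}
    (h : ∀ p ∈ s, ∀ q ∈ s, g p q + g q p + c p q = f p q + f q p) :
    2 * ∑ p ∈ s, ∑ q ∈ s, g p q + ∑ p ∈ s, ∑ q ∈ s, c p q = 2 * ∑ p ∈ s, ∑ q ∈ s, f p q := by
  have h1 := Finset.sum_congr rfl fun p hp => Finset.sum_congr rfl (h p hp)
  simp only [Finset.sum_add_distrib] at h1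
  rw [Finset.sum_comm (f := fun p q => g q p), Finset.sum_comm (f := fun p q => f q p)] at h1
  omega

/-- A finite check on the signs and the relative size of two entries, split by whether they lie in
the head or the tail. The extra term, for two tail positions, does not depend on `P`. -/
theorem inv_boxes_identity {P : ℕ → ℤ} (hP : IsSignedPerm n P) (hs : Sorted n K P) {p q : ℕ}
    (hp : 1 ≤ p) (hp' : p ≤ n) (hq : 1 ≤ q) (hq' : q ≤ n) (hpq : p < q) :
    (if P p < P q then 1 else 0) + (if P q + P p < 0 then 1 else 0) +
      (if K < p ∧ K < q then 1 else 0) = boxes K P p q + boxes K P q p := by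
  have hp0 := hP.ne_zero p hp hp'
  have hq0 := hP.ne_zero q hq hq'
  have hinj := hP.inj p q hp hp' hq hq'
  rw [boxes, boxes]
  rcases le_or_gt q K with a | a
  · have h1 := hs.anti hp hpq hq' (Or.inl a)
    rw [if_pos a, if_pos (by omega : p ≤ K)]
    generalize P p = x at *
    generalize P q = y at *
    split_ifs <;> omega
  · have h4 := hs.pos a hq'
    rcases le_or_gt p K with b | b
    · rw [if_neg (by omega : ¬ q ≤ K), if_pos b]
      generalize P p = x at *
      generalize P q = y at *
      split_ifs <;> omega
    · have h1 := hs.anti hp hpq hq' (Or.inr b)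
      have h3 := hs.pos b hp'
      rw [if_neg (by omega : ¬ q ≤ K), if_neg (by omega : ¬ p ≤ K)]
      generalize P p = x at *
      generalize P q = y at *
      split_ifs <;> omega

/-- The second sum depends only on `n` and `K`, so it cancels when two shapes are compared. The
entry `2` on its diagonal reflects that a diagonal pair is counted twice in the symmetrisation. -/
theorem Std.inv_add_eq (hK : K < n) {w : W n} {μ : Shape n K} (h : Std (wt w) μ) :
    2 * inv w + ∑ p ∈ Finset.Icc 1 n, ∑ q ∈ Finset.Icc 1 n,
      (if K < p ∧ K < q then (if p = q then 2 else 1) else 0) = 2 * size μ := by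
  rw [h.size_eq hK, inv_eq_sum]
  refine two_mul_sum_add fun p hp q hq => ?_
  rw [Finset.mem_Icc] at hp hq
  have key := fun p q hp hp' hq hq' => inv_boxes_identity h.perm h.sorted (p := p) (q := q)
    hp hp' hq hq'
  rcases lt_trichotomy p q with hpq | hpq | hpq
  · have := key p q hp.1 hp.2 hq.1 hq.2 hpq
    simpa [hpq, hpq.ne, hpq.ne', hpq.not_gt] using this
  · subst hpq
    have h3 : K < p → 0 < wt w p := fun h1 => h.sorted.pos h1 hp.2
    have h0 := h.perm.ne_zero p hp.1 hp.2
    simp only [boxes, lt_irrefl, false_and, false_or, true_and, le_refl, and_true, if_true]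
    split_ifs <;> omega
  · have := key q p hq.1 hq.2 hp.1 hp.2 hpq
    rw [add_comm (boxes K _ p q), ← this]
    simp [hpq, hpq.ne, hpq.ne', hpq.not_gt, and_comm, add_comm]

/-- The difference of lengths is the difference of the numbers of boxes. -/
theorem Std.inv_add_size (hK : K < n) {w v : W n} {μ ν : Shape n K} (hw : Std (wt w) μ)
    (hv : Std (wt v) ν) : inv w + size ν = inv v + size μ := by
  have h1 := hw.inv_add_eq hK
  have h2 := hv.inv_add_eq hK
  omega

end TypeB

/-! ### From a prescribed change of parts to a cover. -/

namespace TypeB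

variable {n K : ℕ}

/-! ### Shapes that differ in few parts -/

theorem Shape.bot_lt (μ : Shape n K) {i j : ℕ} (hi : 1 ≤ i) (hij : i < j) (hj : 0 < μ.bot j) :
    μ.bot j < μ.bot i :=
  μ.bot_strict i j hi hij ((μ.bot_pos_iff j).1 hj).2

theorem Shape.bot_injOn (μ : Shape n K) {i j : ℕ} (h : μ.bot i = μ.bot j) (hi : 0 < μ.bot i) :
    i = j := by
  have h1 := (μ.bot_pos_iff i).1 hi
  have h2 := (μ.bot_pos_iff j).1 (h ▸ hi)
  rcases lt_trichotomy i j with h3 | h3 | h3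
  · have := μ.bot_strict i j h1.1 h3 h2.2; omega
  · exact h3
  · have := μ.bot_strict j i h2.1 h3 h1.2; omega

theorem Std.tail_pos (hK : K < n) {P : ℕ → ℤ} {μ : Shape n K} (h : Std P μ) {r : ℕ} (h1 : 1 ≤ r)
    (h2 : r ≤ n - K) : 0 < P (K + r) := h.sorted.pos (by omega) (by omega)

theorem Std.bot_eq {P : ℕ → ℤ} {μ : Shape n K} (h : Std P μ) {j : ℕ} (h1 : 1 ≤ j)
    (h2 : j ≤ K) : (μ.bot j : ℤ) = max (- P (K + 1 - j)) 0 := by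
  have h3 := h.neg_iff (i := K + 1 - j) (by omega) (by omega)
  rw [show K + 1 - (K + 1 - j) = j by omega] at h3
  by_cases h4 : j ≤ μ.len
  · rw [h.bot j h1 h4]; omega
  · rw [μ.bot_eq_zero (by omega)]; omega

theorem Std.bot_ne (hK : K < n) {P : ℕ → ℤ} {μ : Shape n K} (h : Std P μ) {i : ℕ} (hi : 1 ≤ i)
    (hi' : i ≤ n) (hpos : 0 < P i) (j : ℕ) : P i ≠ μ.bot j := by
  intro e
  have h1 := (μ.bot_pos_iff j).1 (by omega)
  have h2 := μ.len_le
  have h3 := h.bot j h1.1 h1.2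
  have h4 := h.perm.inj i (K + 1 - j) hi hi' (by omega) (by omega) (by omega)
  rw [← h4] at h3; omega

theorem Std.mem_head_of_bot {P : ℕ → ℤ} {μ : Shape n K} (h : Std P μ) {j : ℕ}
    (hj : 0 < μ.bot j) : - (μ.bot j : ℤ) ∈ head K P := by
  have h1 := (μ.bot_pos_iff j).1 hj
  have h2 := μ.len_le
  exact mem_head.2 ⟨K + 1 - j, by omega, by omega, h.bot j h1.1 h1.2⟩

theorem Std.mem_head_of_pos (hK : K < n) {P : ℕ → ℤ} {μ : Shape n K} (h : Std P μ) {x : ℤ}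
    (h1 : 0 < x) (h2 : x ≤ n) (h3 : ∀ j, x ≠ μ.bot j)
    (h4 : ∀ r, 1 ≤ r → r ≤ n - K → x ≠ P (K + r)) : x ∈ head K P := by
  obtain ⟨p, hp, hp', e⟩ := h.perm.surj (t := x.toNat) (by omega) (by omega)
  by_cases hpK : p ≤ K
  · rcases lt_or_ge (P p) 0 with h5 | h5
    · have := h.bot_of_neg hp hpK h5
      exact absurd (by omega) (h3 (K + 1 - p))
    · exact mem_head.2 ⟨p, hp, hpK, by omega⟩
  · have h5 := h.sorted.pos (i := p) (by omega) hp'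
    refine absurd ?_ (h4 (p - K) (by omega) (by omega))
    rw [show K + (p - K) = p by omega]; omega

/-- The parts lost between `t` and `t'` are distinct integers strictly between them, as `t'` itself
is not a part, so there are at most `t' - t - 1`. -/
theorem cnt_lt (μ : Shape n K) {t t' : ℤ} (ht : 0 ≤ t) (htt' : t < t') (h : ∀ j, t' ≠ μ.bot j) :
    t + cnt μ t < t' + cnt μ t' := by
  have h1 : (Finset.Icc 1 K).filter (fun j => t < μ.bot j) ⊆
      (Finset.Icc 1 K).filter (fun j => t' < μ.bot j) ∪
        (Finset.Icc 1 K).filter (fun j => t < μ.bot j ∧ μ.bot j < t') := by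
    intro j hj
    have := h j
    simp only [Finset.mem_union, Finset.mem_filter, Finset.mem_Icc] at hj ⊢
    omega
  have h2 : ((Finset.Icc 1 K).filter (fun j => t < μ.bot j ∧ μ.bot j < t')).card ≤
      (Finset.Ioo t t').card := by
    refine Finset.card_le_card_of_injOn (fun j => (μ.bot j : ℤ)) ?_ ?_
    · intro j hj
      rw [Finset.mem_coe, Finset.mem_filter] at hj
      exact Finset.mem_coe.2 (Finset.mem_Ioo.2 hj.2)
    · intro i hi j hj e
      rw [Finset.mem_coe, Finset.mem_filter] at hi
      exact μ.bot_injOn (Nat.cast_injective (R := ℤ) e) (by omega)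
  have h3 := (Finset.card_le_card h1).trans (Finset.card_union_le _ _)
  rw [Int.card_Ioo] at h2
  rw [← cnt, ← cnt] at h3
  omega

/-- Tail entries are never bottom parts, so this recovers a tail entry from the corresponding top
part. -/
theorem eq_of_add_cnt_eq (μ : Shape n K) {t t' : ℤ} (ht : 0 ≤ t) (ht' : 0 ≤ t')
    (h : ∀ j, t ≠ μ.bot j) (h' : ∀ j, t' ≠ μ.bot j) (e : t + cnt μ t = t' + cnt μ t') :
    t = t' := by
  rcases lt_trichotomy t t' with h1 | h1 | h1
  · have := cnt_lt μ ht h1 h'; omega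
  · exact h1
  · have := cnt_lt μ ht' h1 h; omega

theorem cnt_congr {μ ν : Shape n K} (h : ∀ j, ν.bot j = μ.bot j) (t : ℤ) : cnt ν t = cnt μ t := by
  simp only [cnt, h]

theorem cnt_eq_of_iff (μ : Shape n K) {t : ℤ} {j : ℕ} (hj : j ≤ K)
    (h : ∀ i, 1 ≤ i → i ≤ K → (t < μ.bot i ↔ i ≤ j)) : cnt μ t = j := by
  have : (Finset.Icc 1 K).filter (fun i => t < μ.bot i) = Finset.Icc 1 j := by
    ext i
    simp only [Finset.mem_filter, Finset.mem_Icc]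
    constructor
    · rintro ⟨⟨h1, h2⟩, h3⟩
      exact ⟨h1, (h i h1 h2).1 h3⟩
    · rintro ⟨h1, h2⟩
      exact ⟨⟨h1, by omega⟩, (h i h1 (by omega)).2 h2⟩
  rw [cnt, this]; simp

theorem cnt_add_of_eq_of_ne {μ ν : Shape n K} {j₀ : ℕ} (h1 : 1 ≤ j₀) (h2 : j₀ ≤ K)
    (hb : ∀ j, j ≠ j₀ → ν.bot j = μ.bot j) (hlt : ν.bot j₀ < μ.bot j₀) (t : ℤ) :
    cnt ν t + (if ν.bot j₀ ≤ t ∧ t < μ.bot j₀ then 1 else 0) = cnt μ t := by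
  have hm : j₀ ∈ Finset.Icc 1 K := Finset.mem_Icc.2 ⟨h1, h2⟩
  simp only [cnt, Finset.card_filter]
  rw [← Finset.add_sum_erase _ _ hm, ← Finset.add_sum_erase _ _ hm,
    Finset.sum_congr rfl fun j hj => by rw [hb j (Finset.ne_of_mem_erase hj)]]
  split_ifs <;> omega

/-- If only the part `μ^b_j` changes, then this bounds the numbers of parts that exceed the old
and the new one. -/
theorem cnt_eq_of_between {μ ν : Shape n K} {j₀ : ℕ} (h1 : 1 ≤ j₀) (h2 : j₀ ≤ K)
    (hb : ∀ j, j ≠ j₀ → ν.bot j = μ.bot j) (h0 : 0 < ν.bot j₀) {t : ℤ} (ht : ν.bot j₀ ≤ t)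
    (ht' : t < μ.bot j₀) : cnt μ t = j₀ := by
  refine cnt_eq_of_iff μ h2 fun i hi hi' => ?_
  rcases lt_trichotomy i j₀ with h3 | h3 | h3
  · have := μ.bot_lt hi h3 (by omega); omega
  · subst h3; omega
  · rw [← hb i (by omega)]
    have := ν.bot_lt (i := j₀) (j := i) h1 h3
    omega

theorem cnt_old_part {μ ν : Shape n K} {j₀ : ℕ} (h1 : 1 ≤ j₀) (h2 : j₀ ≤ K)
    (hb : ∀ j, j ≠ j₀ → ν.bot j = μ.bot j) (hlt : ν.bot j₀ < μ.bot j₀) :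
    cnt ν (μ.bot j₀) + 1 = j₀ := by
  suffices cnt ν (μ.bot j₀) = j₀ - 1 by omega
  refine cnt_eq_of_iff ν (by omega) fun i hi hi' => ?_
  rcases lt_trichotomy i j₀ with h3 | h3 | h3
  · rw [hb i (by omega)]
    have := μ.bot_lt hi h3 (by omega); omega
  · subst h3; omega
  · rw [hb i (by omega)]
    have := μ.bot_lt (i := j₀) (j := i) h1 h3
    omega

theorem size_eq_of_bot {μ ν : Shape n K} {j₀ : ℕ} (h1 : 1 ≤ j₀) (h2 : j₀ ≤ K)
    (hb : ∀ j, j ≠ j₀ → ν.bot j = μ.bot j) :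
    ∑ j ∈ Finset.Icc 1 K, ν.bot j + μ.bot j₀ = ∑ j ∈ Finset.Icc 1 K, μ.bot j + ν.bot j₀ := by
  have hm : j₀ ∈ Finset.Icc 1 K := Finset.mem_Icc.2 ⟨h1, h2⟩
  have h3 : ∑ j ∈ (Finset.Icc 1 K).erase j₀, ν.bot j = ∑ j ∈ (Finset.Icc 1 K).erase j₀, μ.bot j :=
    Finset.sum_congr rfl fun j hj => hb j (Finset.ne_of_mem_erase hj)
  rw [← Finset.add_sum_erase _ _ hm, ← Finset.add_sum_erase (a := j₀) _ (fun j => μ.bot j) hm, h3]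
  omega

theorem size_eq_of_top {μ ν : Shape n K} {r₀ : ℕ} (h1 : 1 ≤ r₀) (h2 : r₀ ≤ n - K)
    (ht : ∀ r, 1 ≤ r → r ≤ n - K → r ≠ r₀ → ν.top r = μ.top r) :
    ∑ r ∈ Finset.Icc 1 (n - K), ν.top r + μ.top r₀ =
      ∑ r ∈ Finset.Icc 1 (n - K), μ.top r + ν.top r₀ := by
  have hm : r₀ ∈ Finset.Icc 1 (n - K) := Finset.mem_Icc.2 ⟨h1, h2⟩
  have h3 : ∑ r ∈ (Finset.Icc 1 (n - K)).erase r₀, ν.top r =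
      ∑ r ∈ (Finset.Icc 1 (n - K)).erase r₀, μ.top r :=
    Finset.sum_congr rfl fun r hr => by
      have h3 := Finset.mem_Icc.1 (Finset.mem_of_mem_erase hr)
      exact ht r h3.1 h3.2 (Finset.ne_of_mem_erase hr)
  rw [← Finset.add_sum_erase _ _ hm, ← Finset.add_sum_erase (a := r₀) _ (fun r => μ.top r) hm, h3]
  omega

/-! ### Sufficient conditions for a cover -/

theorem card_head (hK : K < n) {P : ℕ → ℤ} (hP : IsSignedPerm n P) : (head K P).card = K := by
  rw [head, Finset.card_image_of_injOn]
  · simp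
  · intro i hi j hj e
    rw [Finset.coe_Icc, Set.mem_Icc] at hi hj
    exact hP.inj i j hi.1 (by omega) hj.1 (by omega) (by rw [e])

/-- Let `u = w s_γ`. It is shorter than `w` because `γ` is an inversion, hence of length at most
that of `v`, which by the box count is one less than that of `w`. Since `u` has the head values of
`v` and `v` is the unique shortest such element, `u = v`. -/
theorem covers_of_head (hK : K < n) {w v : W n} {μ ν : Shape n K} (hw : Std (wt w) μ)
    (hv : Std (wt v) ν) (hsize : size ν + 1 = size μ) {γ : V n} (hγ : γ ∈ Inv w)
    (h : ∀ u : W n, (∀ x, u.1 x = w.1 (refl γ x)) →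
      ∀ i, 1 ≤ i → i ≤ K → wt u i ∈ head K (wt v)) : Covers w v γ := by
  obtain ⟨u, hu, hlt⟩ := exists_refl_lt hγ
  have hinv := hw.inv_add_size hK hv
  have hhead : head K (wt u) = head K (wt v) := by
    refine Finset.eq_of_subset_of_card_le (fun x hx => ?_) ?_
    · obtain ⟨i, h1, h2, rfl⟩ := mem_head.1 hx
      exact h u hu i h1 h2
    · rw [card_head hK (isSignedPerm_wt u), card_head hK (isSignedPerm_wt v)]
  have := (inv_le_of_head_eq hK hv.sorted u hhead).2 (by omega)
  subst this
  exact ⟨hγ, hu, by omega⟩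

/-- The root is `ε_p - ε_{K+r₀}`, where `p` is the head position of the new tail value. As `r₀ ≥ 2`,
only `ε_p` occurs in the weight `ε_1 + ⋯ + ε_{K+1}`, so the pairing is `1`. -/
theorem covers_of_top (hK : K < n) {w v : W n} {μ ν : Shape n K} (hw : Std (wt w) μ)
    (hv : Std (wt v) ν) {r₀ : ℕ} (hr : 2 ≤ r₀) (hr' : r₀ ≤ n - K)
    (hb : ∀ j, ν.bot j = μ.bot j)
    (ht : ∀ r, 1 ≤ r → r ≤ n - K → r ≠ r₀ → ν.top r = μ.top r)
    (ht₀ : ν.top r₀ + 1 = μ.top r₀) :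
    ∃ γ, Covers w v γ ∧ cor γ (fundWeight n (K + 1)) = 1 := by
  have hcnt := cnt_congr hb
  have htail : ∀ r, 1 ≤ r → r ≤ n - K → r ≠ r₀ → wt v (K + r) = wt w (K + r) := by
    intro r h1 h2 h3
    have e1 := hv.top r h1 h2
    have e2 := hw.top r h1 h2
    refine eq_of_add_cnt_eq μ (hv.tail_pos hK h1 h2).le (hw.tail_pos hK h1 h2).le (fun j => ?_)
      (hw.bot_ne hK (by omega) (by omega) (hw.tail_pos hK h1 h2)) ?_
    · rw [← hb]; exact hv.bot_ne hK (by omega) (by omega) (hv.tail_pos hK h1 h2) j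
    · rw [← e2, ← hcnt, ← e1, ht r h1 h2 h3]
  have hvpos := hv.tail_pos hK (r := r₀) (by omega) hr'
  have hwpos := hw.tail_pos hK (r := r₀) (by omega) hr'
  have hlt : wt v (K + r₀) < wt w (K + r₀) := by
    have e1 := hv.top r₀ (by omega) hr'
    have e2 := hw.top r₀ (by omega) hr'
    rw [hcnt] at e1
    rcases lt_trichotomy (wt v (K + r₀)) (wt w (K + r₀)) with h | h | h
    · exact h
    · rw [h] at e1; omega
    · have := cnt_lt μ hwpos.le h fun j => by
        rw [← hb]; exact hv.bot_ne hK (by omega) (by omega) hvpos j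
      omega
  have hvle := hv.perm.natAbs_le (K + r₀) (by omega) (by omega)
  have hwle := hw.perm.natAbs_le (K + r₀) (by omega) (by omega)
  -- The new tail value must sit, unsigned, in the head of `w`: the other tail entries do not move,
  -- and the bottom parts are the same for both shapes.
  obtain ⟨p, hp, hp', e⟩ := hw.perm.surj (t := (wt v (K + r₀)).natAbs) (by omega) hvle
  have hpK : p ≤ K := by
    by_contra h
    have h1 := hw.sorted.pos (i := p) (by omega) hp'
    have h2 : p ≠ K + r₀ := by rintro rfl; omega
    have h3 := htail (p - K) (by omega) (by omega) (by omega)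
    rw [show K + (p - K) = p by omega] at h3
    exact h2 (hv.perm.inj p (K + r₀) hp hp' (by omega) (by omega) (by omega))
  have hpp : wt w p = wt v (K + r₀) := by
    rcases lt_or_ge (wt w p) 0 with h | h
    · have h1 := hw.bot_of_neg hp hpK h
      rw [← hb] at h1
      exact absurd (by omega) (hv.bot_ne hK (by omega) (by omega) hvpos (K + 1 - p))
    · omega
  refine ⟨ε n p - ε n (K + r₀), covers_of_head hK hw hv ?_ ?_ fun u hu i hi hi' => ?_, ?_⟩
  · have := size_eq_of_top (by omega) hr' ht
    simp only [size, hb]; omega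
  · exact mem_Inv.2 ⟨sub_mem_posRoots hp (by omega) (by omega),
      (hgt_W_sub w hp hp' (by omega) (by omega)).2 (by omega)⟩
  · rw [wt_refl_sub hp hp' (by omega) (by omega) (by omega) hu hi (by omega),
      if_neg (show i ≠ K + r₀ by omega)]
    split_ifs with hip
    · refine hv.mem_head_of_pos hK hwpos (by omega) (fun j => ?_) fun r h1 h2 => ?_
      · rw [hb]; exact hw.bot_ne hK (by omega) (by omega) hwpos j
      · by_cases h3 : r = r₀
        · rw [h3]; omega
        · rw [htail r h1 h2 h3]
          intro h4
          have := hw.perm.inj (K + r₀) (K + r) (by omega) (by omega) (by omega) (by omega)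
            (by omega)
          omega
    · rcases lt_or_ge (wt w i) 0 with h | h
      · have h1 := hw.bot_of_neg hi hi' h
        rw [h1, ← hb]
        rw [← hb] at h1
        exact hv.mem_head_of_bot (by omega)
      · have h0 := hw.perm.ne_zero i hi (by omega)
        have h1 := hw.perm.natAbs_le i hi (by omega)
        refine hv.mem_head_of_pos hK (by omega) (by omega) (fun j => ?_) fun r h1 h2 h4 => ?_
        · rw [hb]; exact hw.bot_ne hK (by omega) (by omega) (by omega) j
        · by_cases h3 : r = r₀
          · rw [h3, ← hpp] at h4
            exact hip (hw.perm.inj i p hi (by omega) hp (by omega) (by omega))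
          · rw [htail r h1 h2 h3] at h4
            have := hw.perm.inj i (K + r) (by omega) (by omega) (by omega) (by omega) (by omega)
            omega
  · rw [cor_sub hp hp' (by omega) (by omega) (by omega), fundWeight_dot (by omega) (by omega),
      fundWeight_dot (by omega) (by omega), if_pos (by omega), if_neg (by omega), sub_zero]

/-- If no tail entry equals the decreased part, the tail is unchanged and the root lies in the head:
`ε_{K+1-j₀}` if the part disappears, and otherwise `ε_p + ε_{K+1-j₀}` with `p` the head position of
the new value. Both pair to `2`. -/
theorem covers_of_bot (hK : K < n) {w v : W n} {μ ν : Shape n K} (hw : Std (wt w) μ)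
    (hv : Std (wt v) ν) {j₀ : ℕ} (hj : 1 ≤ j₀) (hj' : j₀ ≤ μ.len)
    (hb : ∀ j, j ≠ j₀ → ν.bot j = μ.bot j) (hb₀ : ν.bot j₀ + 1 = μ.bot j₀)
    (ht : ∀ r, 1 ≤ r → r ≤ n - K → ν.top r = μ.top r)
    (hno : ∀ r, 1 ≤ r → r ≤ n - K → wt w (K + r) ≠ ν.bot j₀) :
    ∃ γ, Covers w v γ ∧ cor γ (fundWeight n (K + 1)) = 2 := by
  have hlen := μ.len_le
  have htail : ∀ r, 1 ≤ r → r ≤ n - K → wt v (K + r) = wt w (K + r) := by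
    intro r h1 h2
    have e1 := hv.top r h1 h2
    have e2 := hw.top r h1 h2
    have h3 := hno r h1 h2
    refine eq_of_add_cnt_eq ν (hv.tail_pos hK h1 h2).le (hw.tail_pos hK h1 h2).le
      (hv.bot_ne hK (by omega) (by omega) (hv.tail_pos hK h1 h2)) (fun j => ?_) ?_
    · by_cases h : j = j₀
      · rw [h]; exact h3
      · rw [hb j h]; exact hw.bot_ne hK (by omega) (by omega) (hw.tail_pos hK h1 h2) j
    · have := cnt_add_of_eq_of_ne hj (by omega) hb (by omega) (wt w (K + r))
      rw [if_neg (by omega)] at this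
      rw [← e1, ht r h1 h2, e2, ← this, add_zero]
  have hsize : size ν + 1 = size μ := by
    have h1 := size_eq_of_bot hj (by omega) hb
    have h2 : ∑ r ∈ Finset.Icc 1 (n - K), ν.top r = ∑ r ∈ Finset.Icc 1 (n - K), μ.top r :=
      Finset.sum_congr rfl fun r hr => by
        rw [Finset.mem_Icc] at hr; exact ht r hr.1 hr.2
    simp only [size]; omega
  have ha := hw.bot j₀ hj hj'
  have hbn := μ.bot_le j₀
  have hold : (μ.bot j₀ : ℤ) ∈ head K (wt v) := by
    refine hv.mem_head_of_pos hK (by omega) (by omega) (fun j e => ?_) fun r h1 h2 e => ?_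
    · by_cases h : j = j₀
      · subst h; omega
      · rw [hb j h] at e
        exact h (μ.bot_injOn (by exact_mod_cast e.symm) (by omega))
    · rw [htail r h1 h2] at e
      exact hw.bot_ne hK (by omega) (by omega) (hw.tail_pos hK h1 h2) j₀ e.symm
  have hother : ∀ i, 1 ≤ i → i ≤ K → i ≠ K + 1 - j₀ → wt w i ≠ ν.bot j₀ →
      wt w i ∈ head K (wt v) := by
    intro i hi hi' hij hne
    rcases lt_or_ge (wt w i) 0 with h | h
    · have h1 := hw.bot_of_neg hi hi' h
      have h2 := hb (K + 1 - i) (by omega)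
      rw [h1, ← h2]
      exact hv.mem_head_of_bot (by omega)
    · have h0 := hw.perm.ne_zero i hi (by omega)
      have h1 := hw.perm.natAbs_le i hi (by omega)
      refine hv.mem_head_of_pos hK (by omega) (by omega) (fun j => ?_) fun r h1 h2 h4 => ?_
      · by_cases h5 : j = j₀
        · rw [h5]; exact hne
        · rw [hb j h5]; exact hw.bot_ne hK (by omega) (by omega) (by omega) j
      · rw [htail r h1 h2] at h4
        have := hw.perm.inj i (K + r) (by omega) (by omega) (by omega) (by omega) (by omega)
        omega
  rcases Nat.eq_zero_or_pos (ν.bot j₀) with h0 | h0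
  -- The part was `1`: the head entry `-1` becomes `1`.
  · refine ⟨ε n (K + 1 - j₀), covers_of_head hK hw hv hsize ?_ fun u hu i hi hi' => ?_, ?_⟩
    · exact mem_Inv.2 ⟨ε_mem_posRoots (by omega) (by omega),
        (hgt_W_single w (by omega) (by omega)).2 (by omega)⟩
    · rw [wt_refl_single (by omega) (by omega) hu hi (by omega)]
      split_ifs with h
      · rw [ha, neg_neg]; exact hold
      · have := hw.perm.ne_zero i hi (by omega)
        exact hother i hi hi' h (by omega)
    · rw [cor_single (by omega) (by omega), fundWeight_dot (by omega) (by omega),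
        if_pos (by omega)]; norm_num
  · obtain ⟨p, hp, hp', e⟩ := hw.perm.surj (t := ν.bot j₀) (by omega) (ν.bot_le j₀)
    have hpK : p ≤ K := by
      by_contra h
      have h1 := hw.sorted.pos (i := p) (by omega) hp'
      have h3 := hno (p - K) (by omega) (by omega)
      rw [show K + (p - K) = p by omega] at h3
      omega
    have hpp : wt w p = ν.bot j₀ := by
      rcases lt_or_ge (wt w p) 0 with h | h
      · have h1 := hw.bot_of_neg hp hpK h
        have h2 : K + 1 - p ≠ j₀ := by intro h2; rw [h2] at h1; omega
        rw [← hb _ h2] at h1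
        exact absurd (ν.bot_injOn (by omega) (by omega)) h2
      · omega
    have hpa : p ≠ K + 1 - j₀ := by rintro rfl; omega
    refine ⟨ε n p + ε n (K + 1 - j₀), covers_of_head hK hw hv hsize ?_ fun u hu i hi hi' => ?_, ?_⟩
    · exact mem_Inv.2 ⟨add_mem_posRoots hp hp' (by omega) (by omega) hpa,
        (hgt_W_add w hp hp' (by omega) (by omega)).2 (by omega)⟩
    · rw [wt_refl_add hp hp' (by omega) (by omega) hpa hu hi (by omega)]
      split_ifs with h h'
      · rw [ha, neg_neg]; exact hold
      · rw [hpp]; exact hv.mem_head_of_bot h0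
      · refine hother i hi hi' h' fun h5 => h ?_
        exact hw.perm.inj i p hi (by omega) hp hp' (by omega)
    · rw [cor_add hp hp' (by omega) (by omega) hpa, fundWeight_dot (by omega) (by omega),
        fundWeight_dot (by omega) (by omega), if_pos (by omega), if_pos (by omega)]; norm_num

/-- The tail entry that equals the new bottom part changes places, up to signs, with the old one,
through the root `ε_{K+1-j₀} + ε_{K+r₀}`. The second summand contributes to the pairing only at
position `K + 1`, that is for `r₀ = 1`. The case `f = 0` is allowed: the tail entry rises by one,
one bottom part fewer exceeds it, and the top part stays the same. -/
theorem covers_of_bot_top (hK : K < n) {w v : W n} {μ ν : Shape n K} (hw : Std (wt w) μ)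
    (hv : Std (wt v) ν) {f j₀ r₀ : ℕ} (hj : 1 ≤ j₀) (hj' : j₀ ≤ μ.len)
    (hr : 1 ≤ r₀) (hr' : r₀ ≤ n - K)
    (hb : ∀ j, j ≠ j₀ → ν.bot j = μ.bot j) (hb₀ : ν.bot j₀ + (f + 1) = μ.bot j₀)
    (ht : ∀ r, 1 ≤ r → r ≤ n - K → r ≠ r₀ → ν.top r = μ.top r)
    (ht₀ : ν.top r₀ = μ.top r₀ + f) (he : wt w (K + r₀) = ν.bot j₀) :
    ∃ γ, Covers w v γ ∧ cor γ (fundWeight n (K + 1)) = if r₀ = 1 then 2 else 1 := by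
  have hlen := μ.len_le
  have hwpos := hw.tail_pos hK hr hr'
  have hcnt := cnt_add_of_eq_of_ne (ν := ν) (μ := μ) hj (by omega) hb (by omega)
  have hbet := fun t => cnt_eq_of_between (ν := ν) (μ := μ) (t := t) hj (by omega) hb (by omega)
  have hold := cnt_old_part (ν := ν) (μ := μ) hj (by omega) hb (by omega)
  have ha := hw.bot j₀ hj hj'
  have hbn := μ.bot_le j₀
  have htop₀ : (μ.top r₀ : ℤ) = ν.bot j₀ + j₀ := by
    have e2 := hw.top r₀ hr hr'
    rw [he, hbet _ le_rfl (by omega)] at e2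
    exact e2
  have htail : ∀ r, 1 ≤ r → r ≤ n - K → r ≠ r₀ → wt v (K + r) = wt w (K + r) := by
    intro r h1 h2 h3
    have e1 := hv.top r h1 h2
    have e2 := hw.top r h1 h2
    have h4 : wt w (K + r) ≠ ν.bot j₀ := by
      intro h4
      have := hw.perm.inj (K + r) (K + r₀) (by omega) (by omega) (by omega) (by omega) (by omega)
      omega
    -- Such an entry would lie to the left of `K + r₀`, and its top part, at most `μ.bot j₀ + j₀ - 1
    -- = ν.top r₀`, would violate strictness in `ν`.
    have h5 : ¬ (ν.bot j₀ ≤ wt w (K + r) ∧ wt w (K + r) < μ.bot j₀) := by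
      rintro ⟨h5, h6⟩
      rw [hbet _ h5 h6] at e2
      have h7 : r < r₀ := by
        by_contra h7
        have := hw.sorted.anti (i := K + r₀) (j := K + r) (by omega) (by omega) (by omega)
          (Or.inr (by omega))
        omega
      have := ν.top_strict r r₀ h1 h7 hr'
      rw [ht r h1 h2 h3, ht₀] at this
      omega
    refine eq_of_add_cnt_eq ν (hv.tail_pos hK h1 h2).le (hw.tail_pos hK h1 h2).le
      (hv.bot_ne hK (by omega) (by omega) (hv.tail_pos hK h1 h2)) (fun j => ?_) ?_
    · by_cases h : j = j₀
      · rw [h]; exact h4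
      · rw [hb j h]; exact hw.bot_ne hK (by omega) (by omega) (hw.tail_pos hK h1 h2) j
    · have := hcnt (wt w (K + r))
      rw [if_neg h5] at this
      rw [← e1, ht r h1 h2 h3, e2, ← this, add_zero]
  -- Exactly `j₀ - 1` parts of `ν` exceed `μ.bot j₀`, and `μ.bot j₀ + (j₀ - 1)` is the new top part.
  have htail₀ : wt v (K + r₀) = μ.bot j₀ := by
    have e1 := hv.top r₀ hr hr'
    refine eq_of_add_cnt_eq ν (hv.tail_pos hK hr hr').le (by omega)
      (hv.bot_ne hK (by omega) (by omega) (hv.tail_pos hK hr hr')) (fun j e => ?_) ?_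
    · by_cases h : j = j₀
      · subst h; omega
      · rw [hb j h] at e
        exact h (μ.bot_injOn (by exact_mod_cast e.symm) (by omega))
    · rw [← e1]; omega
  refine ⟨ε n (K + 1 - j₀) + ε n (K + r₀), covers_of_head hK hw hv ?_ ?_ fun u hu i hi hi' => ?_, ?_⟩
  · have h1 := size_eq_of_bot hj (by omega) hb
    have h2 := size_eq_of_top hr hr' ht
    simp only [size]; omega
  · exact mem_Inv.2 ⟨add_mem_posRoots (by omega) (by omega) (by omega) (by omega) (by omega),
      (hgt_W_add w (by omega) (by omega) (by omega) (by omega)).2 (by omega)⟩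
  · rw [wt_refl_add (by omega) (by omega) (by omega) (by omega) (by omega) hu hi (by omega),
      if_neg (show i ≠ K + r₀ by omega)]
    split_ifs with hij
    · rw [he]; exact hv.mem_head_of_bot (by omega)
    · rcases lt_or_ge (wt w i) 0 with h | h
      · have h1 := hw.bot_of_neg hi hi' h
        have h2 := hb (K + 1 - i) (by omega)
        rw [h1, ← h2]
        exact hv.mem_head_of_bot (by omega)
      · have h0 := hw.perm.ne_zero i hi (by omega)
        have h1 := hw.perm.natAbs_le i hi (by omega)
        refine hv.mem_head_of_pos hK (by omega) (by omega) (fun j => ?_) fun r h1 h2 h4 => ?_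
        · by_cases h5 : j = j₀
          · rw [h5, ← he]
            intro h6
            have := hw.perm.inj i (K + r₀) (by omega) (by omega) (by omega) (by omega) (by omega)
            omega
          · rw [hb j h5]; exact hw.bot_ne hK (by omega) (by omega) (by omega) j
        · by_cases h3 : r = r₀
          · rw [h3, htail₀] at h4
            exact hw.bot_ne hK hi (by omega) (by omega) _ h4
          · rw [htail r h1 h2 h3] at h4
            have := hw.perm.inj i (K + r) (by omega) (by omega) (by omega) (by omega) (by omega)
            omega
  · rw [cor_add (by omega) (by omega) (by omega) (by omega) (by omega),
      fundWeight_dot (by omega) (by omega), fundWeight_dot (by omega) (by omega),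
      if_pos (by omega)]
    by_cases h : r₀ = 1
    · rw [if_pos (by omega), if_pos h]; norm_num
    · rw [if_neg (by omega), if_neg h]; norm_num

end TypeB

/-! ### Vectors of shapes, and covers for the shapes in `S μ`. -/

namespace TypeB

variable {n K : ℕ}

/-! ### The vector of a shape -/

theorem Shape.vec_top (μ : Shape n K) {r : ℕ} (h : r ≤ n - K) : μ.vec r = μ.top r := if_pos h

theorem Shape.vec_bot (μ : Shape n K) {j : ℕ} (h : 1 ≤ j) : μ.vec (n - K + j) = μ.bot j := by
  rw [Shape.vec, if_neg (by omega), Nat.add_sub_cancel_left]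

theorem e_apply (i j : ℕ) : e i j = if j = i then 1 else 0 := by
  rw [e, Pi.single_apply]

theorem vec_eq {μ ν : Shape n K} {x : ℕ → ℤ} (h0 : x 0 = 0)
    (ht : ∀ r, 1 ≤ r → r ≤ n - K → (ν.top r : ℤ) = μ.top r + x r)
    (hb : ∀ j, 1 ≤ j → (ν.bot j : ℤ) = μ.bot j + x (n - K + j)) : ν.vec = μ.vec + x := by
  funext i
  rw [Pi.add_apply]
  by_cases h : i ≤ n - K
  · rw [ν.vec_top h, μ.vec_top h]
    by_cases h1 : 1 ≤ i
    · exact ht i h1 h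
    · obtain rfl : i = 0 := by omega
      rw [ν.top_zero 0 (by omega), μ.top_zero 0 (by omega), h0]; rfl
  · obtain ⟨j, rfl⟩ : ∃ j, i = n - K + j := ⟨i - (n - K), by omega⟩
    rw [ν.vec_bot (by omega), μ.vec_bot (by omega)]
    exact hb j (by omega)

theorem top_of_vec {μ ν : Shape n K} {x : ℕ → ℤ} (h : ν.vec = μ.vec + x) {r : ℕ}
    (hr : r ≤ n - K) : (ν.top r : ℤ) = μ.top r + x r := by
  rw [← ν.vec_top hr, ← μ.vec_top hr, h]; rfl

theorem bot_of_vec {μ ν : Shape n K} {x : ℕ → ℤ} (h : ν.vec = μ.vec + x) {j : ℕ}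
    (hj : 1 ≤ j) : (ν.bot j : ℤ) = μ.bot j + x (n - K + j) := by
  rw [← ν.vec_bot hj, ← μ.vec_bot hj, h]; rfl

theorem bot_zero (μ : Shape n K) : μ.bot 0 = 0 := μ.bot_eq_zero (by omega)

theorem of_vec_sub_top {μ ν : Shape n K} {r₀ : ℕ} (h : ν.vec = μ.vec - e r₀)
    (h2 : r₀ ≤ n - K) : (∀ j, ν.bot j = μ.bot j) ∧
      (∀ r, 1 ≤ r → r ≤ n - K → r ≠ r₀ → ν.top r = μ.top r) ∧ ν.top r₀ + 1 = μ.top r₀ := by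
  rw [sub_eq_add_neg] at h
  refine ⟨fun j => ?_, fun r hr hr' hne => ?_, ?_⟩
  · rcases Nat.eq_zero_or_pos j with rfl | hj
    · rw [bot_zero, bot_zero]
    · have := bot_of_vec h hj
      rw [Pi.neg_apply, e_apply, if_neg (by omega)] at this; omega
  · have := top_of_vec h hr'
    rw [Pi.neg_apply, e_apply, if_neg (by omega)] at this; omega
  · have := top_of_vec h h2
    rw [Pi.neg_apply, e_apply, if_pos rfl] at this; omega

theorem of_vec_sub_bot {μ ν : Shape n K} {j₀ : ℕ} (h : ν.vec = μ.vec - e (n - K + j₀))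
    (h1 : 1 ≤ j₀) : (∀ j, j ≠ j₀ → ν.bot j = μ.bot j) ∧ ν.bot j₀ + 1 = μ.bot j₀ ∧
      ∀ r, 1 ≤ r → r ≤ n - K → ν.top r = μ.top r := by
  rw [sub_eq_add_neg] at h
  refine ⟨fun j hne => ?_, ?_, fun r hr hr' => ?_⟩
  · rcases Nat.eq_zero_or_pos j with rfl | hj
    · rw [bot_zero, bot_zero]
    · have := bot_of_vec h hj
      rw [Pi.neg_apply, e_apply, if_neg (by omega)] at this; omega
  · have := bot_of_vec h h1
    rw [Pi.neg_apply, e_apply, if_pos rfl] at this; omega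
  · have := top_of_vec h hr'
    rw [Pi.neg_apply, e_apply, if_neg (by omega)] at this; omega

theorem of_vec_sub_bot_top {μ ν : Shape n K} {f j₀ r₀ : ℕ}
    (h : ν.vec = μ.vec - ((f : ℤ) + 1) • e (n - K + j₀) + (f : ℤ) • e r₀)
    (h1 : 1 ≤ j₀) (h2 : r₀ ≤ n - K) :
    (∀ j, j ≠ j₀ → ν.bot j = μ.bot j) ∧ ν.bot j₀ + (f + 1) = μ.bot j₀ ∧
      (∀ r, 1 ≤ r → r ≤ n - K → r ≠ r₀ → ν.top r = μ.top r) ∧ ν.top r₀ = μ.top r₀ + f := by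
  rw [sub_add_eq_add_sub, add_sub_assoc] at h
  refine ⟨fun j hne => ?_, ?_, fun r hr hr' hne => ?_, ?_⟩
  · rcases Nat.eq_zero_or_pos j with rfl | hj
    · rw [bot_zero, bot_zero]
    · have := bot_of_vec h hj
      simp only [Pi.sub_apply, Pi.smul_apply, e_apply, smul_eq_mul] at this
      rw [if_neg (by omega), if_neg (by omega)] at this; omega
  · have := bot_of_vec h h1
    simp only [Pi.sub_apply, Pi.smul_apply, e_apply, smul_eq_mul] at this
    rw [if_neg (by omega), if_pos trivial] at this; omega
  · have := top_of_vec h hr'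
    simp only [Pi.sub_apply, Pi.smul_apply, e_apply, smul_eq_mul] at this
    rw [if_neg (by omega), if_neg (by omega)] at this; omega
  · have := top_of_vec h h2
    simp only [Pi.sub_apply, Pi.smul_apply, e_apply, smul_eq_mul] at this
    rw [if_pos trivial, if_neg (by omega)] at this; omega

/-! ### Covers from the sets of shapes -/

/-- The number of parts of `μ` that exceed `ν.bot j₀` is `j₀`, so this value yields the given top
part and injectivity applies. It explains the equation for `μ^t_i` in `S` and `Γ₂`: it detects a
tail entry equal to the new bottom part. -/
theorem Std.tail_eq_of_top_eq (hK : K < n) {w : W n} {μ ν : Shape n K} (hw : Std (wt w) μ)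
    {j₀ r : ℕ} (hj : 1 ≤ j₀) (hj' : j₀ ≤ μ.len)
    (hb : ∀ j, j ≠ j₀ → ν.bot j = μ.bot j) (hlt : ν.bot j₀ < μ.bot j₀)
    (hr : 1 ≤ r) (hr' : r ≤ n - K) (h : (μ.top r : ℤ) = ν.bot j₀ + j₀) :
    wt w (K + r) = ν.bot j₀ := by
  have hlen := μ.len_le
  have h0 : 0 < ν.bot j₀ := by
    by_contra h0
    -- Only the last part can drop to zero; then the hypothesis would give `μ.top r = μ.len`,
    -- against `len + 1 ≤ top`.
    have h1 : ν.bot j₀ = 0 := by omega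
    have h2 := μ.len_lt_top r hr hr'
    have h3 : j₀ = μ.len := by
      by_contra h3
      have h4 : 0 < ν.bot μ.len := by
        rw [hb _ (by omega)]; exact (μ.bot_pos_iff _).2 ⟨by omega, le_rfl⟩
      have h5 := (ν.bot_pos_iff _).1 h4
      have h6 := (ν.bot_pos_iff j₀).2 ⟨hj, by omega⟩
      omega
    omega
  have e2 := hw.top r hr hr'
  have hc := cnt_eq_of_between (ν := ν) (μ := μ) hj (by omega) hb h0 (t := ν.bot j₀) le_rfl
    (by omega)
  refine eq_of_add_cnt_eq μ (hw.tail_pos hK hr hr').le (by omega)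
    (hw.bot_ne hK (by omega) (by omega) (hw.tail_pos hK hr hr')) (fun j e => ?_) (by omega)
  by_cases h5 : j = j₀
  · subst h5; omega
  · rw [← hb j h5] at e
    exact h5 (ν.bot_injOn (by omega) (by omega))

theorem Std.top_of_tail_eq (hK : K < n) {w : W n} {μ ν : Shape n K} (hw : Std (wt w) μ)
    {j₀ r : ℕ} (hj : 1 ≤ j₀) (hj' : j₀ ≤ μ.len)
    (hb : ∀ j, j ≠ j₀ → ν.bot j = μ.bot j) (hlt : ν.bot j₀ < μ.bot j₀)
    (hr : 1 ≤ r) (hr' : r ≤ n - K) (h : wt w (K + r) = ν.bot j₀) :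
    (μ.top r : ℤ) = ν.bot j₀ + j₀ := by
  have hlen := μ.len_le
  have hwpos := hw.tail_pos hK hr hr'
  have e2 := hw.top r hr hr'
  rw [h, cnt_eq_of_between (ν := ν) (μ := μ) hj (by omega) hb (by omega) le_rfl (by omega)] at e2
  exact e2

/-- For a loss of one bottom box, the condition in `Γ₂` means that no tail entry other than the
first can equal the new part, so either the tail is untouched or the first entry moves; both give
pairing `2`. -/
theorem covers_of_mem_Γ₂ (hK : K < n) {w v : W n} {μ ν : Shape n K} (hw : Std (wt w) μ)
    (hv : Std (wt v) ν) (h : ν ∈ Γ₂ μ) :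
    ∃ γ, Covers w v γ ∧ cor γ (fundWeight n (K + 1)) = 2 := by
  rcases h with ⟨j₀, hj, hj', hvec, hne⟩ | ⟨f, j₀, hf, hj, hj', hvec, htop⟩
  · obtain ⟨hb, hb₀, ht⟩ := of_vec_sub_bot hvec hj
    by_cases hex : ∃ r, 1 ≤ r ∧ r ≤ n - K ∧ wt w (K + r) = ν.bot j₀
    · obtain ⟨r, hr, hr', he⟩ := hex
      have h1 := hw.top_of_tail_eq hK hj hj' hb (by omega) hr hr' he
      have h2 : r = 1 := by
        by_contra h2
        exact hne r (by omega) hr' (by omega)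
      -- With `f = 0` the top part does not move although the tail entry does.
      obtain ⟨γ, h3, h4⟩ := covers_of_bot_top (f := 0) hK hw hv hj hj' hr hr' hb (by omega)
        (fun r h1 h2 _ => ht r h1 h2) (by rw [ht r hr hr']; rfl) he
      exact ⟨γ, h3, by rw [h4, if_pos h2]⟩
    · push Not at hex
      exact covers_of_bot hK hw hv hj hj' hb hb₀ ht hex
  · obtain ⟨hb, hb₀, ht, ht₀⟩ := of_vec_sub_bot_top hvec hj (by omega)
    have he := hw.tail_eq_of_top_eq (r := 1) hK hj hj' hb (by omega) le_rfl (by omega) (by omega)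
    obtain ⟨γ, h3, h4⟩ := covers_of_bot_top hK hw hv hj hj' le_rfl (by omega) hb hb₀ ht ht₀ he
    exact ⟨γ, h3, by rw [h4, if_pos rfl]⟩

/-- Outside `Γ₂` a bottom box is lost only if a tail entry of index at least `2` equals the new
part, and a move with `f > 0` involves a top part other than the first. So the tail position lies
beyond `K + 1` and the pairing is `1`. -/
theorem covers_of_mem_S (hK : K < n) {w v : W n} {μ ν : Shape n K} (hw : Std (wt w) μ)
    (hv : Std (wt v) ν) (h : ν ∈ S μ) (h' : ν ∉ Γ₂ μ) :
    ∃ γ, Covers w v γ ∧ cor γ (fundWeight n (K + 1)) = 1 := by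
  rcases h with ⟨i, hi, hi', hvec⟩ | ⟨f, j₀, r₀, hf, hj, hj', hr, hr', hvec, htop⟩
  · by_cases h1 : i ≤ n - K
    · obtain ⟨hb, ht, ht₀⟩ := of_vec_sub_top hvec h1
      exact covers_of_top hK hw hv hi h1 hb ht ht₀
    · obtain ⟨j₀, rfl⟩ : ∃ j, i = n - K + j := ⟨i - (n - K), by omega⟩
      have hj : 1 ≤ j₀ := by omega
      have hj' : j₀ ≤ μ.len := by omega
      obtain ⟨hb, hb₀, ht⟩ := of_vec_sub_bot hvec hj
      obtain ⟨r, hr, hr', htop⟩ : ∃ r, 2 ≤ r ∧ r ≤ n - K ∧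
          (μ.top r : ℤ) = (μ.bot j₀ : ℤ) + j₀ - 1 := by
        by_contra! hc
        exact h' (Or.inl ⟨j₀, hj, hj', hvec, hc⟩)
      have he := hw.tail_eq_of_top_eq (r := r) hK hj hj' hb (by omega) (by omega) hr' (by omega)
      obtain ⟨γ, h3, h4⟩ := covers_of_bot_top (f := 0) hK hw hv hj hj' (by omega) hr' hb (by omega)
        (fun r h1 h2 _ => ht r h1 h2) (by rw [ht r (by omega) hr']; rfl) he
      exact ⟨γ, h3, by rw [h4, if_neg (by omega)]⟩
  · obtain ⟨hb, hb₀, ht, ht₀⟩ := of_vec_sub_bot_top hvec hj (by omega)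
    have he := hw.tail_eq_of_top_eq hK hj hj' hb (by omega) hr hr' (by omega)
    obtain ⟨γ, h3, h4⟩ := covers_of_bot_top hK hw hv hj hj' hr hr' hb hb₀ ht ht₀ he
    refine ⟨γ, h3, h4.trans (if_neg ?_)⟩
    rintro rfl
    exact h' (Or.inr ⟨f, j₀, hf, hj, hj', hvec, htop⟩)

end TypeB

/-! ### From a cover with nonzero pairing to a shape in `S μ`. -/

namespace TypeB

variable {n K : ℕ}

/-! ### Shapes from covers -/

theorem vec_eq_sub_e_bot {μ ν : Shape n K} {j₀ : ℕ}
    (ht : ∀ r, 1 ≤ r → r ≤ n - K → ν.top r = μ.top r)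
    (hb : ∀ j, j ≠ j₀ → ν.bot j = μ.bot j) (hb₀ : ν.bot j₀ + 1 = μ.bot j₀) :
    ν.vec = μ.vec - e (n - K + j₀) := by
  have hj : 1 ≤ j₀ := ((μ.bot_pos_iff j₀).1 (by omega)).1
  rw [sub_eq_add_neg]
  refine vec_eq ?_ (fun r h1 h2 => ?_) fun j h1 => ?_
  · rw [Pi.neg_apply, e_apply, if_neg (by omega), neg_zero]
  · rw [Pi.neg_apply, e_apply, if_neg (by omega), ht r h1 h2]; omega
  · rw [Pi.neg_apply, e_apply]
    by_cases h : j = j₀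
    · rw [if_pos (by omega)]; subst h; omega
    · rw [if_neg (by omega), hb j h]; omega

/-- With the tail fixed, a smaller bottom part can only lower the top parts. The bottom already
loses a box and only one is lost, so no top part changes and the bottom part drops by one. -/
theorem mem_S_of_bot (hK : K < n) {w v : W n} {μ ν : Shape n K} (hw : Std (wt w) μ)
    (hv : Std (wt v) ν) (hsize : size ν + 1 = size μ) {j₀ : ℕ}
    (hb : ∀ j, j ≠ j₀ → ν.bot j = μ.bot j) (hlt : ν.bot j₀ < μ.bot j₀)
    (htail : ∀ r, 1 ≤ r → r ≤ n - K → wt v (K + r) = wt w (K + r)) : ν ∈ S μ := by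
  obtain ⟨hj, hj'⟩ := (μ.bot_pos_iff j₀).1 (by omega)
  have hlen := μ.len_le
  have hcnt := cnt_add_of_eq_of_ne (ν := ν) (μ := μ) hj (by omega) hb hlt
  have hle : ∀ r ∈ Finset.Icc 1 (n - K), ν.top r ≤ μ.top r := by
    intro r hr
    rw [Finset.mem_Icc] at hr
    have e1 := hv.top r hr.1 hr.2
    have e2 := hw.top r hr.1 hr.2
    rw [htail r hr.1 hr.2] at e1
    have := hcnt (wt w (K + r))
    omega
  have h1 := size_eq_of_bot hj (by omega) hb
  have h2 := Finset.sum_le_sum hle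
  simp only [size] at hsize
  have h3 := (Finset.sum_eq_sum_iff_of_le hle).1 (by omega)
  exact Or.inl ⟨n - K + j₀, by omega, by omega, vec_eq_sub_e_bot
    (fun r hr hr' => h3 r (Finset.mem_Icc.2 ⟨hr, hr'⟩)) hb (by omega)⟩

/-- Here `f` is one less than the drop of the bottom part, because the old part, now a tail entry,
is exceeded by one part fewer. For `f = 0` the result belongs to the first set in the union defining
`S`. -/
theorem mem_S_of_bot_top (hK : K < n) {w v : W n} {μ ν : Shape n K} (hw : Std (wt w) μ)
    (hv : Std (wt v) ν) {j₀ r₀ : ℕ} (hr : 1 ≤ r₀) (hr' : r₀ ≤ n - K)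
    (hb : ∀ j, j ≠ j₀ → ν.bot j = μ.bot j) (hlt : ν.bot j₀ < μ.bot j₀)
    (he : wt w (K + r₀) = ν.bot j₀) (he' : wt v (K + r₀) = μ.bot j₀)
    (htail : ∀ r, 1 ≤ r → r ≤ n - K → r ≠ r₀ → wt v (K + r) = wt w (K + r)) : ν ∈ S μ := by
  obtain ⟨hj, hj'⟩ := (μ.bot_pos_iff j₀).1 (by omega)
  have hlen := μ.len_le
  have hwpos := hw.tail_pos hK hr hr'
  have hcnt := cnt_add_of_eq_of_ne (ν := ν) (μ := μ) hj (by omega) hb hlt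
  have htop₀ := hw.top_of_tail_eq hK hj hj' hb hlt hr hr' he
  have hold := cnt_old_part (ν := ν) (μ := μ) hj (by omega) hb hlt
  have htop₀' : (ν.top r₀ : ℤ) + 1 = μ.bot j₀ + j₀ := by
    rw [hv.top r₀ hr hr', he']; omega
  have ht : ∀ r, 1 ≤ r → r ≤ n - K → r ≠ r₀ → ν.top r = μ.top r := by
    intro r h1 h2 h3
    have e1 := hv.top r h1 h2
    have e2 := hw.top r h1 h2
    have h4 := hcnt (wt w (K + r))
    -- A tail entry in between would be out of order with `K + r₀`: in `v` if it lies to the left,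
    -- in `w` if it lies to the right.
    have h5 : ¬ (ν.bot j₀ ≤ wt w (K + r) ∧ wt w (K + r) < μ.bot j₀) := by
      rintro ⟨h5, h6⟩
      rcases lt_or_gt_of_ne h3 with h7 | h7
      · have := hv.sorted.anti (i := K + r) (j := K + r₀) (by omega) (by omega) (by omega)
          (Or.inr (by omega))
        rw [htail r h1 h2 h3] at this
        omega
      · have := hw.sorted.anti (i := K + r₀) (j := K + r) (by omega) (by omega) (by omega)
          (Or.inr (by omega))
        omega
    rw [if_neg h5] at h4
    rw [htail r h1 h2 h3] at e1
    omega
  obtain ⟨f, hf⟩ : ∃ f, ν.bot j₀ + (f + 1) = μ.bot j₀ := ⟨μ.bot j₀ - ν.bot j₀ - 1, by omega⟩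
  rcases Nat.eq_zero_or_pos f with h0 | h0
  · refine Or.inl ⟨n - K + j₀, by omega, by omega, vec_eq_sub_e_bot (fun r h1 h2 => ?_) hb
      (by omega)⟩
    by_cases h : r = r₀
    · subst h; omega
    · exact ht r h1 h2 h
  · refine Or.inr ⟨f, j₀, r₀, h0, hj, hj', hr, hr', ?_, by omega⟩
    rw [sub_add_eq_add_sub, add_sub_assoc]
    refine vec_eq ?_ (fun r h1 h2 => ?_) fun j h1 => ?_
    · simp only [Pi.sub_apply, Pi.smul_apply, e_apply, smul_eq_mul]
      rw [if_neg (by omega), if_neg (by omega)]; omega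
    · simp only [Pi.sub_apply, Pi.smul_apply, e_apply, smul_eq_mul]
      rw [if_neg (show ¬ r = n - K + j₀ by omega)]
      by_cases h : r = r₀
      · rw [if_pos h, h]; omega
      · rw [if_neg h, ht r h1 h2 h]; omega
    · simp only [Pi.sub_apply, Pi.smul_apply, e_apply, smul_eq_mul]
      rw [if_neg (show ¬ n - K + j = r₀ by omega)]
      by_cases h : j = j₀
      · rw [if_pos (by omega), h]; omega
      · rw [if_neg (by omega), hb j h]; omega

/-- All other parts are forced to stay, so the box count says that the remaining top part drops by
exactly one. -/
theorem mem_S_of_top {w v : W n} {μ ν : Shape n K} (hw : Std (wt w) μ)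
    (hv : Std (wt v) ν) (hsize : size ν + 1 = size μ) {r₀ : ℕ} (hr : 2 ≤ r₀) (hr' : r₀ ≤ n - K)
    (hb : ∀ j, ν.bot j = μ.bot j)
    (htail : ∀ r, 1 ≤ r → r ≤ n - K → r ≠ r₀ → wt v (K + r) = wt w (K + r)) : ν ∈ S μ := by
  have ht : ∀ r, 1 ≤ r → r ≤ n - K → r ≠ r₀ → ν.top r = μ.top r := by
    intro r h1 h2 h3
    have e1 := hv.top r h1 h2
    have e2 := hw.top r h1 h2
    rw [htail r h1 h2 h3, cnt_congr hb] at e1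
    omega
  have h1 := size_eq_of_top (by omega) hr' ht
  simp only [size, hb] at hsize
  refine Or.inl ⟨r₀, hr, by omega, ?_⟩
  rw [sub_eq_add_neg]
  refine vec_eq ?_ (fun r h1 h2 => ?_) fun j h1 => ?_
  · rw [Pi.neg_apply, e_apply, if_neg (by omega), neg_zero]
  · rw [Pi.neg_apply, e_apply]
    by_cases h : r = r₀
    · rw [if_pos h, h]; omega
    · rw [if_neg h, ht r h1 h2 h]; omega
  · rw [Pi.neg_apply, e_apply, if_neg (by omega), hb j]; omega

/-- The parts of `μ^b` in terms of the first `K` weights. -/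
theorem Std.bot_eq_of_wt {P Q : ℕ → ℤ} {μ ν : Shape n K} (hP : Std P μ) (hQ : Std Q ν) {j : ℕ}
    (h : 1 ≤ j → j ≤ K → max (- Q (K + 1 - j)) 0 = max (- P (K + 1 - j)) 0) :
    ν.bot j = μ.bot j := by
  by_cases hj : 1 ≤ j ∧ j ≤ K
  · have h1 := hP.bot_eq hj.1 hj.2
    have h2 := hQ.bot_eq hj.1 hj.2
    rw [h hj.1 hj.2, ← h1] at h2
    exact_mod_cast h2
  · have h1 := μ.len_le
    have h2 := ν.len_le
    rw [ν.bot_eq_zero (by omega), μ.bot_eq_zero (by omega)]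

/-- Two parts of `μ^b` cannot become smaller when only one box is lost and no tail entry moves. -/
theorem not_size_add_one_of_bot_lt {w v : W n} {μ ν : Shape n K} (hw : Std (wt w) μ)
    (hv : Std (wt v) ν) (hsize : size ν + 1 = size μ) {j₁ j₂ : ℕ} (hj₁ : 1 ≤ j₁ ∧ j₁ ≤ K)
    (hj₂ : 1 ≤ j₂ ∧ j₂ ≤ K) (hj : j₁ ≠ j₂) (h₁ : ν.bot j₁ < μ.bot j₁) (h₂ : ν.bot j₂ < μ.bot j₂)
    (hb : ∀ j, j ≠ j₁ → j ≠ j₂ → ν.bot j = μ.bot j)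
    (htail : ∀ r, 1 ≤ r → r ≤ n - K → wt v (K + r) = wt w (K + r)) : False := by
  have hle : ∀ j, ν.bot j + ((if j = j₁ then 1 else 0) + if j = j₂ then 1 else 0) ≤ μ.bot j := by
    intro j
    by_cases e₁ : j = j₁
    · subst e₁; rw [if_pos rfl, if_neg hj]; omega
    · by_cases e₂ : j = j₂
      · subst e₂; rw [if_pos rfl, if_neg e₁]; omega
      · rw [if_neg e₁, if_neg e₂, hb j e₁ e₂]; omega
  have hcnt : ∀ t, cnt ν t ≤ cnt μ t := fun t => by
    refine Finset.card_le_card fun j hj => ?_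
    rw [Finset.mem_filter] at hj ⊢
    have := hle j
    exact ⟨hj.1, by omega⟩
  have htop : ∑ r ∈ Finset.Icc 1 (n - K), ν.top r ≤ ∑ r ∈ Finset.Icc 1 (n - K), μ.top r := by
    refine Finset.sum_le_sum fun r hr => ?_
    rw [Finset.mem_Icc] at hr
    have e1 := hv.top r hr.1 hr.2
    have e2 := hw.top r hr.1 hr.2
    have e3 := hcnt (wt w (K + r))
    rw [htail r hr.1 hr.2] at e1
    omega
  have hbot := Finset.sum_le_sum fun j (_ : j ∈ Finset.Icc 1 K) => hle j
  rw [Finset.sum_add_distrib, Finset.sum_add_distrib, Finset.sum_ite_eq', Finset.sum_ite_eq',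
    if_pos (Finset.mem_Icc.2 hj₁), if_pos (Finset.mem_Icc.2 hj₂)] at hbot
  simp only [size] at hsize
  omega

/-- Sortedness of `w` limits which positive roots can be inversions: `ε_p - ε_q` must join head to
tail, and `ε_p` and `ε_p + ε_q` must involve the head. The box count of a cover then fixes how far
the parts move. -/
theorem mem_S_of_covers (hK : K < n) {w v : W n} {μ ν : Shape n K} (hw : Std (wt w) μ)
    (hv : Std (wt v) ν) {γ : V n} (hc : Covers w v γ) (hne : cor γ (fundWeight n (K + 1)) ≠ 0) :
    ν ∈ S μ := by
  obtain ⟨hγ, hrefl, hinv⟩ := hc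
  have hsize : size ν + 1 = size μ := by
    have := hw.inv_add_size hK hv; omega
  obtain ⟨hpos, hneg⟩ := mem_Inv.1 hγ
  obtain ⟨p, q, hp, hp', hq, hq', rfl⟩ := mem_posRoots.1 hpos
  have hP := hw.perm
  have hp0 := hP.ne_zero p hp hp'
  have hq0 := hP.ne_zero q hq hq'
  have htp : K < p → 0 < wt w p := fun h => hw.sorted.pos h hp'
  have htq : K < q → 0 < wt w q := fun h => hw.sorted.pos h hq'
  have hbot := fun j (h1 : 1 ≤ j) (h2 : j ≤ K) => hw.bot_eq h1 h2
  have hbot' := fun j (h1 : 1 ≤ j) (h2 : j ≤ K) => hv.bot_eq h1 h2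
  rcases lt_trichotomy p q with hpq | rfl | hpq
  · -- the root `ε_p - ε_q`
    have e : rt n p q = ε n p - ε n q := by simp [rt, hpq]
    rw [e] at hneg hne hrefl
    rw [hgt_W_sub w hp hp' hq hq'] at hneg
    rw [cor_sub hp hp' hq hq' hpq.ne, fundWeight_dot (by omega) hp, fundWeight_dot (by omega) hq]
      at hne
    have hv' := fun i (h1 : 1 ≤ i) (h2 : i ≤ n) =>
      wt_refl_sub hp hp' hq hq' hpq.ne hrefl h1 h2
    have hsp : ¬ (q ≤ K ∨ K < p) := fun h => by
      have := hw.sorted.anti hp hpq hq' h; omega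
    -- Position `K + 1` is excluded because `ε_p - ε_{K+1}` is orthogonal to the fundamental weight.
    -- This is why the first set in `S` starts at index `2`.
    have hq2 : K + 1 < q := by
      by_contra h
      rw [if_pos (by omega), if_pos (by omega), sub_self] at hne
      exact hne rfl
    have h1 := hv' p hp hp'
    have h2 := hv' q hq hq'
    rw [if_pos rfl] at h1
    rw [if_neg hpq.ne', if_pos rfl] at h2
    have h3 := hv.sorted.pos (i := q) (by omega) hq'
    refine mem_S_of_top hw hv hsize (r₀ := q - K) (by omega) (by omega) (fun j => ?_)
      fun r hr hr' hrq => ?_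
    · refine hw.bot_eq_of_wt hv fun hj hj' => ?_
      by_cases h : K + 1 - j = p
      · rw [h]; omega
      · rw [hv' _ (by omega) (by omega), if_neg h, if_neg (by omega)]
    · rw [hv' _ (by omega) (by omega), if_neg (by omega), if_neg (by omega)]
  · -- the root `ε_p`
    have e : rt n p p = ε n p := by simp [rt]
    rw [e] at hneg hrefl
    rw [hgt_W_single w hp hp'] at hneg
    have hv' := fun i (h1 : 1 ≤ i) (h2 : i ≤ n) => wt_refl_single hp hp' hrefl h1 h2
    have h1 := hv' p hp hp'
    rw [if_pos rfl] at h1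
    have h2 := hbot (K + 1 - p) (by omega) (by omega)
    have h3 := hbot' (K + 1 - p) (by omega) (by omega)
    rw [show K + 1 - (K + 1 - p) = p by omega] at h2 h3
    refine mem_S_of_bot hK hw hv hsize (j₀ := K + 1 - p) (fun j hj => ?_) (by omega)
      fun r hr hr' => ?_
    · refine hw.bot_eq_of_wt hv fun hj1 hj2 => ?_
      rw [hv' _ (by omega) (by omega), if_neg (by omega)]
    · rw [hv' _ (by omega) (by omega), if_neg (by omega)]
  · -- the root `ε_p + ε_q`
    have e : rt n p q = ε n p + ε n q := by simp [rt, hpq, hpq.not_gt]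
    rw [e] at hneg hrefl
    rw [hgt_W_add w hp hp' hq hq'] at hneg
    have hv' := fun i (h1 : 1 ≤ i) (h2 : i ≤ n) =>
      wt_refl_add hp hp' hq hq' hpq.ne' hrefl h1 h2
    have h1 := hv' p hp hp'
    have h2 := hv' q hq hq'
    rw [if_pos rfl] at h1
    rw [if_neg hpq.ne, if_pos rfl] at h2
    have hqK : q ≤ K := by
      by_contra h
      have := htp (by omega)
      have := htq (by omega)
      omega
    have hbq := hbot (K + 1 - q) (by omega) (by omega)
    have hbq' := hbot' (K + 1 - q) (by omega) (by omega)
    rw [show K + 1 - (K + 1 - q) = q by omega] at hbq hbq'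
    rcases le_or_gt p K with hpK | hpK
    · have h3 := hw.sorted.anti hq hpq hp' (Or.inl hpK)
      have hbp := hbot (K + 1 - p) (by omega) (by omega)
      have hbp' := hbot' (K + 1 - p) (by omega) (by omega)
      rw [show K + 1 - (K + 1 - p) = p by omega] at hbp hbp'
      rcases lt_or_gt_of_ne hq0 with h4 | h4
      -- If both head entries are negative, both become positive. Two bottom parts would disappear,
      -- which costs more than one box.
      · exfalso
        refine not_size_add_one_of_bot_lt hw hv hsize (j₁ := K + 1 - p) (j₂ := K + 1 - q)
          (by omega) (by omega) (by omega) (by omega) (by omega) (fun j hj hj' => ?_)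
          fun r hr hr' => ?_
        · refine hw.bot_eq_of_wt hv fun hj1 hj2 => ?_
          rw [hv' _ (by omega) (by omega), if_neg (by omega), if_neg (by omega)]
        · rw [hv' _ (by omega) (by omega), if_neg (by omega), if_neg (by omega)]
      · refine mem_S_of_bot hK hw hv hsize (j₀ := K + 1 - p) (fun j hj => ?_) (by omega)
          fun r hr hr' => ?_
        · refine hw.bot_eq_of_wt hv fun hj1 hj2 => ?_
          by_cases h : K + 1 - j = q
          · rw [h]; omega
          · rw [hv' _ (by omega) (by omega), if_neg (by omega), if_neg h]
        · rw [hv' _ (by omega) (by omega), if_neg (by omega), if_neg (by omega)]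
    · have h3 := htp hpK
      refine mem_S_of_bot_top hK hw hv (j₀ := K + 1 - q) (r₀ := p - K) (by omega) (by omega)
        (fun j hj => ?_) (by omega) ?_ ?_ fun r hr hr' hrp => ?_
      · refine hw.bot_eq_of_wt hv fun hj1 hj2 => ?_
        rw [hv' _ (by omega) (by omega), if_neg (by omega), if_neg (by omega)]
      · rw [show K + (p - K) = p by omega]; omega
      · rw [show K + (p - K) = p by omega]; omega
      · rw [hv' _ (by omega) (by omega), if_neg (by omega), if_neg (by omega)]

end TypeB

theorem mainTheorem7 (n k : ℕ) (hk : 1 ≤ k) (hkn : k < n)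
    (ν μ : TypeB.Shape n (k - 1)) (v' w' : TypeB.W n)
    (hv : TypeB.Corresponds v' ν) (hw : TypeB.Corresponds w' μ) :
    (TypeB.N (TypeB.s n k) v' w' ≠ 0 ↔ ν ∈ TypeB.S μ) ∧
    (ν ∈ TypeB.Γ₁ μ → TypeB.N (TypeB.s n k) v' w' = 1) ∧
    (ν ∈ TypeB.Γ₂ μ → TypeB.N (TypeB.s n k) v' w' = 2) := by
  have hK : k - 1 < n := by omega
  have hv' := hv.std hK
  have hw' := hw.std hK
  have key : ∀ c : ℚ, (∃ γ, TypeB.Covers w' v' γ ∧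
      TypeB.cor γ (TypeB.fundWeight n (k - 1 + 1)) = c) → TypeB.N (TypeB.s n k) v' w' = c := by
    rintro c ⟨γ, h1, rfl⟩
    rw [Nat.sub_add_cancel hk]
    exact TypeB.N_eq_cor hk hkn h1
  have h1 : ν ∈ TypeB.Γ₁ μ → TypeB.N (TypeB.s n k) v' w' = 1 := fun h =>
    key 1 (TypeB.covers_of_mem_S hK hw' hv' h.1 h.2)
  have h2 : ν ∈ TypeB.Γ₂ μ → TypeB.N (TypeB.s n k) v' w' = 2 := fun h =>
    key 2 (TypeB.covers_of_mem_Γ₂ hK hw' hv' h)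
  refine ⟨⟨fun h => ?_, fun h => ?_⟩, h1, h2⟩
  · obtain ⟨γ, h3, h4⟩ := TypeB.exists_covers hk hkn h
    exact TypeB.mem_S_of_covers hK hw' hv' h3 (by rwa [Nat.sub_add_cancel hk])
  · by_cases h3 : ν ∈ TypeB.Γ₂ μ
    · rw [h2 h3]; norm_num
    · rw [h1 ⟨h, h3⟩]; norm_num
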